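/- Let $\mathcal N$ be an exact category (an additive category with an exact structure in the sense of Quillen). Call a chain complex $(P_*,d)$ in $\mathcal N$ acyclic if its differentials factor as $P_n\twoheadrightarrow J_{n-1}\rightarrowtail P_{n-1}$ with all $J_n\rightarrowtail P_n\twoheadrightarrow J_{n-1}$ short exact. A binary acyclic complex $(P_*,d,d')$ is a bounded $\mathbb Z$-graded object $P_*$ of $\mathcal N$ with two differentials $d,d'$ of degree $-1$ (top and bottom) such that $(P_*,d)$ and $(P_*,d')$ are acyclic chain complexes; a morphism is a degree-$0$ map commuting with both top and both bottom differentials. Let $K_0(\Omega\mathcal N)$ be the abelian group generated by the binary acyclic complexes, subject to the relations $[P]=[P']+[P'']$ for every sequence of morphisms $P'\to P\to P''$ that is short exact in each degree, and $[(P_*,d,d')]=0$ whenever $d=d'$. Let $K_0(\Omega_{[0,\infty)}\mathcal N)$ be the group defined in the same way using only complexes with $P_n\cong 0$ for $n<0$. Let $K_1^N(\mathcal N)$ be the abelian group generated by the binary acyclic complexes of length two, i.e. pairs of short exact sequences $P_2\rightarrowtail P_1\twoheadrightarrow P_0$ (top and bottom) on the same three objects, subject to the following relations. 1. $[P]=0$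 if the top and bottom short exact sequences of $P$ coincide. 2. Suppose given objects $P_{k,l}$ ($0\le k,l\le 2$), and for each $l$ a binary acyclic complex of length two $P_{2,l}\rightarrowtail P_{1,l}\twoheadrightarrow P_{0,l}$ (the row $R_l$), and for each $k$ a binary acyclic complex of length two $P_{k,2}\rightarrowtail P_{k,1}\twoheadrightarrow P_{k,0}$ (the column $C_k$), such that the top horizontal maps commute with the top vertical maps and the bottom horizontal maps commute with the bottom vertical maps. Then $[C_0]-[C_1]+[C_2]=[R_2]-[R_1]+[R_0]$. **Theorem.** For every exact category $\mathcal N$, sending the class of a binary acyclic complex of length two to the class of the same complex, placed in degrees $2,1,0$ and extended by zero, gives a well-defined group homomorphism $$\Phi\colon K_1^N(\mathcal N)\to K_0(\Omega\mathcal N),$$ and $\Phi$ is an isomorphism. The same holds with $K_0(\Omega_{[0,\infty)}\mathcal N)$ in place of $K_0(\Omega\mathcal N)$. -/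

import Mathlib

open CategoryTheory CategoryTheory.Limits
open scoped ZeroObject

universe v u

/-- The first morphisms `f` of the short sequences `X --f--> Y --g--> Z` in a given class. -/
def admissibleMonos {C : Type u} [Category.{v} C] [Preadditive C]
    (S : ObjectProperty (ShortComplex C)) : MorphismProperty C :=
  fun _ Y f => ∃ (Z : C) (g : Y ⟶ Z) (w : f ≫ g = 0), S (ShortComplex.mk f g w)

/-- The second morphisms `g` of the short sequences `X --f--> Y --g--> Z` in a given class. -/
def admissibleEpis {C : Type u} [Category.{v} C] [Preadditive C]
    (S : ObjectProperty (ShortComplex C)) : MorphismProperty C :=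
  fun Y _ g => ∃ (X : C) (f : X ⟶ Y) (w : f ≫ g = 0), S (ShortComplex.mk f g w)

/-- An exact structure (in the sense of Quillen) on a preadditive category: a class of
kernel-cokernel pairs, closed under isomorphism, such that identities are admissible
monomorphisms and admissible epimorphisms, both classes are closed under composition, and
admissible monomorphisms (epimorphisms) are stable under pushouts (pullbacks), which exist.
An exact category is an additive category with an exact structure. -/
structure ExactStructure (C : Type u) [Category.{v} C] [Preadditive C] where
  /-- the class of short exact sequences -/
  shortExact : ObjectProperty (ShortComplex C)
  isKernel : ∀ S : ShortComplex C, shortExact S → Nonempty (IsLimit (KernelFork.ofι S.f S.zero))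
  isCokernel : ∀ S : ShortComplex C, shortExact S →
    Nonempty (IsColimit (CokernelCofork.ofπ S.g S.zero))
  of_iso : ∀ S T : ShortComplex C, (S ≅ T) → shortExact S → shortExact T
  id_mono : ∀ X : C, admissibleMonos shortExact (𝟙 X)
  id_epi : ∀ X : C, admissibleEpis shortExact (𝟙 X)
  comp_mono : ∀ {X Y Z : C} (f : X ⟶ Y) (g : Y ⟶ Z), admissibleMonos shortExact f →
    admissibleMonos shortExact g → admissibleMonos shortExact (f ≫ g)
  comp_epi : ∀ {X Y Z : C} (f : X ⟶ Y) (g : Y ⟶ Z), admissibleEpis shortExact f →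
    admissibleEpis shortExact g → admissibleEpis shortExact (f ≫ g)
  pushout_mono : ∀ {X Y X' : C} (i : X ⟶ Y) (f : X ⟶ X'), admissibleMonos shortExact i →
    ∃ (Y' : C) (f' : Y ⟶ Y') (i' : X' ⟶ Y'),
      IsPushout i f f' i' ∧ admissibleMonos shortExact i'
  pullback_epi : ∀ {Y Z Z' : C} (p : Y ⟶ Z) (f : Z' ⟶ Z), admissibleEpis shortExact p →
    ∃ (Y' : C) (f' : Y' ⟶ Y) (p' : Y' ⟶ Z'),
      IsPullback f' p' p f ∧ admissibleEpis shortExact p'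

namespace ExactStructure

variable {C : Type u} [Category.{v} C] [Preadditive C]

/-- `X --f--> Y --g--> Z` is a short exact sequence of the exact category. -/
def IsSES (E : ExactStructure C) {X Y Z : C} (f : X ⟶ Y) (g : Y ⟶ Z) : Prop :=
  ∃ w : f ≫ g = 0, E.shortExact (ShortComplex.mk f g w)

/-- A chain complex is acyclic if its differentials factor as
`P n ↠ J (n - 1) ↣ P (n - 1)` with all `J n ↣ P n ↠ J (n - 1)` short exact. -/
def IsAcyclic (E : ExactStructure C) (P : ChainComplex C ℤ) : Prop :=
  ∃ (J : ℤ → C) (m : ∀ n, J n ⟶ P.X n) (e : ∀ n, P.X n ⟶ J (n - 1)),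
    (∀ n, E.IsSES (m n) (e n)) ∧ ∀ n, P.d n (n - 1) = e n ≫ m (n - 1)

/-- `0 ⟶ X ⟶ X` is short exact. -/
theorem isSES_zero_id (E : ExactStructure C) {Z X : C} (hZ : IsZero Z) (f : Z ⟶ X) :
    E.IsSES f (𝟙 X) := by
  obtain ⟨K, k, w, hk⟩ := E.id_epi X
  have hk0 : k = 0 := by simpa using w
  obtain ⟨hl⟩ := E.isKernel _ hk
  have hm : Mono k := ⟨fun a b h => Fork.IsLimit.hom_ext hl (by simpa using h)⟩
  have hK : IsZero K := by
    rw [IsZero.iff_id_eq_zero, ← cancel_mono k]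
    simp [hk0]
  refine ⟨hZ.eq_of_src _ _, E.of_iso _ _ ?_ hk⟩
  exact ShortComplex.isoMk (hK.iso hZ) (Iso.refl _) (Iso.refl _)
    (hK.eq_of_src _ _) (by simp)

/-- `X ⟶ X ⟶ 0` is short exact. -/
theorem isSES_id_zero (E : ExactStructure C) {Z X : C} (hZ : IsZero Z) (g : X ⟶ Z) :
    E.IsSES (𝟙 X) g := by
  obtain ⟨K, k, w, hk⟩ := E.id_mono X
  have hk0 : k = 0 := by simpa using w
  obtain ⟨hl⟩ := E.isCokernel _ hk
  have hm : Epi k := ⟨fun a b h => Cofork.IsColimit.hom_ext hl (by simpa using h)⟩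
  have hK : IsZero K := by
    rw [IsZero.iff_id_eq_zero, ← cancel_epi k]
    simp [hk0]
  refine ⟨hZ.eq_of_tgt _ _, E.of_iso _ _ ?_ hk⟩
  exact ShortComplex.isoMk (Iso.refl _) (Iso.refl _) (hK.iso hZ)
    (by simp) (hZ.eq_of_tgt _ _)

end ExactStructure

/-- A binary complex: a graded object with two differentials of degree `-1`, the top
differential `d` and the bottom differential `d'`, in the format of `HomologicalComplex`. -/
structure BinaryComplex (C : Type u) [Category.{v} C] [Preadditive C] where
  X : ℤ → C
  d : ∀ i j, X i ⟶ X j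
  d' : ∀ i j, X i ⟶ X j
  shape : ∀ i j, ¬ (ComplexShape.down ℤ).Rel i j → d i j = 0
  shape' : ∀ i j, ¬ (ComplexShape.down ℤ).Rel i j → d' i j = 0
  d_comp_d : ∀ i j k, d i j ≫ d j k = 0
  d'_comp_d' : ∀ i j k, d' i j ≫ d' j k = 0

namespace BinaryComplex

variable {C : Type u} [Category.{v} C] [Preadditive C]

/-- The chain complex given by the top differential. -/
def top (P : BinaryComplex C) : ChainComplex C ℤ where
  X := P.X
  d := P.d
  shape := P.shape
  d_comp_d' := fun i j k _ _ => P.d_comp_d i j k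

/-- The chain complex given by the bottom differential. -/
def bot (P : BinaryComplex C) : ChainComplex C ℤ where
  X := P.X
  d := P.d'
  shape := P.shape'
  d_comp_d' := fun i j k _ _ => P.d'_comp_d' i j k

/-- All objects in degrees outside `I` are zero. -/
def SupportedOn (P : BinaryComplex C) (I : Set ℤ) : Prop :=
  ∀ n, n ∉ I → IsZero (P.X n)

/-- A morphism of binary complexes: a degree `0` map commuting with both differentials. -/
structure Hom (P Q : BinaryComplex C) where
  f : ∀ n, P.X n ⟶ Q.X n
  comm : ∀ i j, f i ≫ Q.d i j = P.d i j ≫ f j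
  comm' : ∀ i j, f i ≫ Q.d' i j = P.d' i j ≫ f j

end BinaryComplex

/-- A (bounded) binary acyclic complex in an exact category. -/
structure BinaryAcyclicComplex {C : Type u} [Category.{v} C] [Preadditive C]
    (E : ExactStructure C) extends BinaryComplex C where
  bounded : ∃ a b : ℤ, toBinaryComplex.SupportedOn (Set.Icc a b)
  top_acyclic : E.IsAcyclic toBinaryComplex.top
  bot_acyclic : E.IsAcyclic toBinaryComplex.bot

section Grayson

variable {C : Type u} [Category.{v} C] [Preadditive C]

/-- Binary acyclic complexes supported on `I`. -/
abbrev BinaryAcyclicComplexOn (E : ExactStructure C) (I : Set ℤ) :=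
  {P : BinaryAcyclicComplex E // P.SupportedOn I}

/-- The defining relations of `K_0` of the exact category of binary acyclic complexes supported
on `I` (short exact sequences are the degreewise short exact ones), together with the relations
that kill the complexes with equal top and bottom differential. -/
inductive GraysonRel (E : ExactStructure C) (I : Set ℤ) :
    FreeAbelianGroup (BinaryAcyclicComplexOn E I) → Prop
  | ses (P' P P'' : BinaryAcyclicComplexOn E I)
      (f : BinaryComplex.Hom P'.1.toBinaryComplex P.1.toBinaryComplex)
      (g : BinaryComplex.Hom P.1.toBinaryComplex P''.1.toBinaryComplex)
      (h : ∀ n, E.IsSES (f.f n) (g.f n)) :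
      GraysonRel E I
        (FreeAbelianGroup.of P - FreeAbelianGroup.of P' - FreeAbelianGroup.of P'')
  | diag (P : BinaryAcyclicComplexOn E I) (h : ∀ i j, P.1.d i j = P.1.d' i j) :
      GraysonRel E I (FreeAbelianGroup.of P)

/-- Grayson's group `K_0(Ω_I 𝒩)`; the unrestricted group `K_0(Ω 𝒩)` is the case `I = univ`. -/
abbrev GraysonK0 (E : ExactStructure C) (I : Set ℤ) :=
  FreeAbelianGroup (BinaryAcyclicComplexOn E I) ⧸ AddSubgroup.closure {x | GraysonRel E I x}

/-- The class of a binary acyclic complex in Grayson's group. -/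
def GraysonK0.of (E : ExactStructure C) {I : Set ℤ} (P : BinaryAcyclicComplex E)
    (hP : P.SupportedOn I) : GraysonK0 E I :=
  QuotientAddGroup.mk (FreeAbelianGroup.of ⟨P, hP⟩)

end Grayson

/-- A binary acyclic complex of length two: a pair of short exact sequences
`X 2 ↣ X 1 ↠ X 0` on the same three objects. -/
structure BinarySES {C : Type u} [Category.{v} C] [Preadditive C] (E : ExactStructure C) where
  X : Fin 3 → C
  i : X 2 ⟶ X 1
  p : X 1 ⟶ X 0
  i' : X 2 ⟶ X 1
  p' : X 1 ⟶ X 0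
  top_exact : E.IsSES i p
  bot_exact : E.IsSES i' p'

/-- A binary acyclic double complex with rows and columns of length two. The object in column `k`
and row `l` is `X k l`; horizontal maps lower `k`, vertical maps lower `l`. The unprimed maps form
one commutative diagram, the primed maps another. -/
structure BinaryDoubleSES {C : Type u} [Category.{v} C] [Preadditive C]
    (E : ExactStructure C) where
  X : Fin 3 → Fin 3 → C
  hi : ∀ l, X 2 l ⟶ X 1 l
  hp : ∀ l, X 1 l ⟶ X 0 l
  hi' : ∀ l, X 2 l ⟶ X 1 l
  hp' : ∀ l, X 1 l ⟶ X 0 l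
  vi : ∀ k, X k 2 ⟶ X k 1
  vp : ∀ k, X k 1 ⟶ X k 0
  vi' : ∀ k, X k 2 ⟶ X k 1
  vp' : ∀ k, X k 1 ⟶ X k 0
  row_top : ∀ l, E.IsSES (hi l) (hp l)
  row_bot : ∀ l, E.IsSES (hi' l) (hp' l)
  col_top : ∀ k, E.IsSES (vi k) (vp k)
  col_bot : ∀ k, E.IsSES (vi' k) (vp' k)
  comm_ii : hi 2 ≫ vi 1 = vi 2 ≫ hi 1
  comm_pi : hp 2 ≫ vi 0 = vi 1 ≫ hp 1
  comm_ip : hi 1 ≫ vp 1 = vp 2 ≫ hi 0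
  comm_pp : hp 1 ≫ vp 0 = vp 1 ≫ hp 0
  comm_ii' : hi' 2 ≫ vi' 1 = vi' 2 ≫ hi' 1
  comm_pi' : hp' 2 ≫ vi' 0 = vi' 1 ≫ hp' 1
  comm_ip' : hi' 1 ≫ vp' 1 = vp' 2 ≫ hi' 0
  comm_pp' : hp' 1 ≫ vp' 0 = vp' 1 ≫ hp' 0

namespace BinaryDoubleSES

variable {C : Type u} [Category.{v} C] [Preadditive C] {E : ExactStructure C}

/-- The `l`-th row. -/
def row (D : BinaryDoubleSES E) (l : Fin 3) : BinarySES E where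
  X := fun k => D.X k l
  i := D.hi l
  p := D.hp l
  i' := D.hi' l
  p' := D.hp' l
  top_exact := D.row_top l
  bot_exact := D.row_bot l

/-- The `k`-th column. -/
def col (D : BinaryDoubleSES E) (k : Fin 3) : BinarySES E where
  X := fun l => D.X k l
  i := D.vi k
  p := D.vp k
  i' := D.vi' k
  p' := D.vp' k
  top_exact := D.col_top k
  bot_exact := D.col_bot k

end BinaryDoubleSES

section Nenashev

variable {C : Type u} [Category.{v} C] [Preadditive C]

/-- The defining relations of Nenashev's group. -/
inductive NenashevRel (E : ExactStructure C) : FreeAbelianGroup (BinarySES E) → Prop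
  | diag (P : BinarySES E) (hi : P.i = P.i') (hp : P.p = P.p') :
      NenashevRel E (FreeAbelianGroup.of P)
  | double (D : BinaryDoubleSES E) :
      NenashevRel E
        ((FreeAbelianGroup.of (D.col 0) - FreeAbelianGroup.of (D.col 1)
            + FreeAbelianGroup.of (D.col 2))
          - (FreeAbelianGroup.of (D.row 2) - FreeAbelianGroup.of (D.row 1)
            + FreeAbelianGroup.of (D.row 0)))

/-- Nenashev's group `K_1^N(𝒩)`. -/
abbrev NenashevK1 (E : ExactStructure C) :=
  FreeAbelianGroup (BinarySES E) ⧸ AddSubgroup.closure {x | NenashevRel E x}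

/-- The class of a binary acyclic complex of length two in Nenashev's group. -/
def NenashevK1.of (E : ExactStructure C) (P : BinarySES E) : NenashevK1 E :=
  QuotientAddGroup.mk (FreeAbelianGroup.of P)

end Nenashev

/-! Regarding a binary acyclic complex of length two as a graded binary acyclic complex,
in degrees `0, 1, 2` and extended by zero. -/

section ExtendByZero

variable {C : Type u} [Category.{v} C] [HasZeroObject C]

/-- The graded object with `X 2, X 1, X 0` in degrees `2, 1, 0` and zero elsewhere. -/
noncomputable def extX (X : Fin 3 → C) : ℤ → C
  | 0 => X 0
  | 1 => X 1
  | 2 => X 2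
  | _ => 0

theorem extX_isZero (X : Fin 3 → C) {n : ℤ} (h0 : n ≠ 0) (h1 : n ≠ 1) (h2 : n ≠ 2) :
    IsZero (extX X n) := by
  unfold extX
  split <;> first | contradiction | exact isZero_zero C

variable [Preadditive C]

/-- The differential with `i` in degree `2`, `p` in degree `1` and zero elsewhere. -/
noncomputable def extD (X : Fin 3 → C) (i : X 2 ⟶ X 1) (p : X 1 ⟶ X 0) :
    ∀ m n : ℤ, extX X m ⟶ extX X n
  | 2, 1 => i
  | 1, 0 => p
  | _, _ => 0

theorem extD_zero (X : Fin 3 → C) (i : X 2 ⟶ X 1) (p : X 1 ⟶ X 0) (m n : ℤ)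
    (h : ¬ (n + 1 = m)) : extD X i p m n = 0 := by
  by_cases hm : m = 0 ∨ m = 1 ∨ m = 2
  · by_cases hn : n = 0 ∨ n = 1 ∨ n = 2
    · rcases hm with rfl | rfl | rfl <;> rcases hn with rfl | rfl | rfl <;>
        first
        | rfl
        | exact absurd (by norm_num) h
    · exact (extX_isZero X (by omega) (by omega) (by omega)).eq_of_tgt _ _
  · exact (extX_isZero X (by omega) (by omega) (by omega)).eq_of_src _ _

theorem extD_comp (X : Fin 3 → C) (i : X 2 ⟶ X 1) (p : X 1 ⟶ X 0) (w : i ≫ p = 0) (l m n : ℤ) :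
    extD X i p l m ≫ extD X i p m n = 0 := by
  by_cases h1 : m + 1 = l
  · by_cases h2 : n + 1 = m
    · subst h2 h1
      by_cases h : n = 0
      · subst h
        exact w
      · by_cases h' : n = 1 ∨ n = -1 ∨ n = 2
        · rcases h' with rfl | rfl | rfl
          · exact (extX_isZero X (by norm_num) (by norm_num) (by norm_num)).eq_of_src _ _
          · exact (extX_isZero X (by norm_num) (by norm_num) (by norm_num)).eq_of_tgt _ _
          · exact (extX_isZero X (by norm_num) (by norm_num) (by norm_num)).eq_of_src _ _
        · exact (extX_isZero X (by omega) (by omega) (by omega)).eq_of_tgt _ _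
    · rw [extD_zero X i p m n h2, comp_zero]
  · rw [extD_zero X i p l m h1, zero_comp]

/-- The chain complex `X 2 ⟶ X 1 ⟶ X 0` in degrees `2, 1, 0`. -/
noncomputable def extComplex (X : Fin 3 → C) (i : X 2 ⟶ X 1) (p : X 1 ⟶ X 0) (w : i ≫ p = 0) :
    ChainComplex C ℤ where
  X := extX X
  d := extD X i p
  shape := fun m n h => extD_zero X i p m n h
  d_comp_d' := fun l m n _ _ => extD_comp X i p w l m n

theorem extComplex_isAcyclic (E : ExactStructure C) (X : Fin 3 → C) (i : X 2 ⟶ X 1)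
    (p : X 1 ⟶ X 0) (h : E.IsSES i p) : E.IsAcyclic (extComplex X i p h.1) := by
  let J : ℤ → C := fun n => match n with
    | 0 => X 0
    | 1 => X 2
    | _ => 0
  let m : ∀ n, J n ⟶ extX X n := fun n => match n with
    | 0 => 𝟙 (X 0)
    | 1 => i
    | _ => 0
  let e : ∀ n, extX X n ⟶ J (n - 1) := fun n => match n with
    | 2 => 𝟙 (X 2)
    | 1 => p
    | _ => 0
  have hJ : ∀ n : ℤ, n ≠ 0 → n ≠ 1 → IsZero (J n) := by
    intro n h0 h1
    dsimp only [J]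
    split <;> first | contradiction | exact isZero_zero C
  refine ⟨J, m, e, fun n => ?_, fun n => ?_⟩
  · by_cases h0 : n = 0
    · subst h0
      exact E.isSES_id_zero (hJ (-1) (by norm_num) (by norm_num)) _
    by_cases h1 : n = 1
    · subst h1
      exact h
    by_cases h2 : n = 2
    · subst h2
      exact E.isSES_zero_id (hJ 2 (by norm_num) (by norm_num)) _
    · have hX := extX_isZero X h0 h1 h2
      have hJn := hJ n h0 h1
      have hJn' := hJ (n - 1) (by omega) (by omega)
      obtain ⟨w, hw⟩ := E.isSES_zero_id hJn (0 : J n ⟶ extX X n)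
      refine ⟨hX.eq_zero_of_tgt (m n) ▸ zero_comp, E.of_iso _ _ ?_ hw⟩
      exact ShortComplex.isoMk (Iso.refl _) (Iso.refl _) (hX.iso hJn')
        (hX.eq_of_tgt _ _) (hJn'.eq_of_tgt _ _)
  · by_cases h1 : n = 1
    · subst h1
      exact (Category.comp_id p).symm
    by_cases h2 : n = 2
    · subst h2
      exact (Category.id_comp i).symm
    by_cases h0 : n = 0
    · subst h0
      exact (extX_isZero X (n := -1) (by norm_num) (by norm_num) (by norm_num)).eq_of_tgt _ _
    · exact (extX_isZero X h0 h1 h2).eq_of_src _ _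

/-- A binary acyclic complex of length two as a binary acyclic complex. -/
noncomputable def BinarySES.toBinaryAcyclicComplex {E : ExactStructure C} (P : BinarySES E) :
    BinaryAcyclicComplex E where
  X := extX P.X
  d := extD P.X P.i P.p
  d' := extD P.X P.i' P.p'
  shape := fun m n h => extD_zero P.X P.i P.p m n h
  shape' := fun m n h => extD_zero P.X P.i' P.p' m n h
  d_comp_d := extD_comp P.X P.i P.p P.top_exact.1
  d'_comp_d' := extD_comp P.X P.i' P.p' P.bot_exact.1
  bounded := ⟨0, 2, fun n hn => extX_isZero P.X
    (fun h => hn (by simp [h])) (fun h => hn (by simp [h])) (fun h => hn (by simp [h]))⟩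
  top_acyclic := extComplex_isAcyclic E P.X P.i P.p P.top_exact
  bot_acyclic := extComplex_isAcyclic E P.X P.i' P.p' P.bot_exact

theorem BinarySES.toBinaryAcyclicComplex_supportedOn {E : ExactStructure C} (P : BinarySES E)
    {I : Set ℤ} (hI : Set.Icc 0 2 ⊆ I) : P.toBinaryAcyclicComplex.SupportedOn I :=
  fun n hn => extX_isZero P.X (fun h => hn (hI (by simp [h])))
    (fun h => hn (hI (by simp [h]))) (fun h => hn (hI (by simp [h])))

/-- The class of a binary acyclic complex of length two in Grayson's group `K_0(Ω_I 𝒩)`. -/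
noncomputable def BinarySES.graysonClass {E : ExactStructure C} (P : BinarySES E)
    {I : Set ℤ} (hI : Set.Icc 0 2 ⊆ I) : GraysonK0 E I :=
  GraysonK0.of E P.toBinaryAcyclicComplex (P.toBinaryAcyclicComplex_supportedOn hI)

end ExtendByZero

/-! The proof compares the rows and the columns of a `Triple`: three bounded binary complexes R₂,
R₁, R₀ with degreewise short exact sequences R₂ → R₁ → R₀, one family of maps commuting with the top
differentials and an unrelated family commuting with the bottom ones. In degree n the two sequences
form a binary short exact sequence, the column c_n. If the rows are acyclic and live in nonnegative
degrees, filtering the total complex by rows and by degrees gives [R₀] - [R₁] + [R₂] = Σ (-1)^n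
[c_n] in Grayson's group (`Triple.cls_rows_eq_cls_cols`). For rows of length two this is Nenashev's
relation, so Φ is well defined.

Surjectivity uses Heller's criterion. The chain complexes (P, d) and (P, d') have the same objects.
An acyclic complex is built by extensions from identity complexes on its cycle objects J_n, and P_n
is an extension of J_(n-1) by J_n; so, inductively, the objects P_n determine the class of the
complex in K_0 of acyclic complexes. Equality of these classes is made concrete by extensions A →
(P, d) ⊕ K → B and A → (P, d') ⊕ K → B with the same A, B, K (`IsoClass.exists_isExt`). Together
they form a triple with middle row P ⊕ K and diagonal outer rows, a `Witness` for P. Diagonal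
complexes have class zero, so [P] = -Σ (-1)^n [c_n] for P in nonnegative degrees. The general case
follows because a shift changes the class only by a sign.

The inverse sends P to -Σ (-1)^n [c_n], computed in Nenashev's group from any witness. To see that
the choice does not matter (`Witness.chi_unique`), one witness is added to another with top and
bottom exchanged; the sum is a witness for P ⊕ P.op. Swapping the two copies of P identifies the
bottom differential of the middle row with the top one. The price is the swap class of P_n in each
column; swap classes are additive and P is acyclic, so their alternating sum is zero. What remains
is a triple with diagonal rows, whose columns are extensions of binary short exact sequences of
cycles, and the alternating sum telescopes. A similar swap proves additivity in P
(`Witness.exists_of_isSES`). A complex of length two has a witness whose only nondiagonal column is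
the complex itself, so the second map is a left inverse of Φ. -/

section

/-! ### Short exact sequences in a Quillen exact category -/

namespace ExactStructure

variable {C : Type u} [Category.{v} C] [Preadditive C] {E : ExactStructure C}

namespace IsSES

variable {X Y Z : C} {f : X ⟶ Y} {g : Y ⟶ Z}

theorem mono (h : E.IsSES f g) : Mono f := by
  obtain ⟨w, hs⟩ := h
  obtain ⟨hl⟩ := E.isKernel _ hs
  exact ⟨fun a b h => Fork.IsLimit.hom_ext hl (by simpa using h)⟩

theorem epi (h : E.IsSES f g) : Epi g := by
  obtain ⟨w, hs⟩ := h
  obtain ⟨hl⟩ := E.isCokernel _ hs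
  exact ⟨fun a b h => Cofork.IsColimit.hom_ext hl (by simpa using h)⟩

theorem exists_lift (h : E.IsSES f g) {T : C} (x : T ⟶ Y) (hx : x ≫ g = 0) :
    ∃ y : T ⟶ X, y ≫ f = x := by
  obtain ⟨w, hs⟩ := h
  obtain ⟨hl⟩ := E.isKernel _ hs
  exact ⟨hl.lift (KernelFork.ofι x hx), hl.fac _ WalkingParallelPair.zero⟩

theorem exists_desc (h : E.IsSES f g) {T : C} (x : Y ⟶ T) (hx : f ≫ x = 0) :
    ∃ y : Z ⟶ T, g ≫ y = x := by
  obtain ⟨w, hs⟩ := h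
  obtain ⟨hl⟩ := E.isCokernel _ hs
  exact ⟨hl.desc (CokernelCofork.ofπ x hx), hl.fac _ WalkingParallelPair.one⟩

/-- The factorization of a map through the kernel. -/
noncomputable def lift (h : E.IsSES f g) {T : C} (x : T ⟶ Y) (hx : x ≫ g = 0) : T ⟶ X :=
  (h.exists_lift x hx).choose

theorem lift_comp (h : E.IsSES f g) {T : C} (x : T ⟶ Y) (hx : x ≫ g = 0) :
    h.lift x hx ≫ f = x := (h.exists_lift x hx).choose_spec

theorem admissibleMono (h : E.IsSES f g) : admissibleMonos E.shortExact f := ⟨Z, g, h.1, h.2⟩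

theorem admissibleEpi (h : E.IsSES f g) : admissibleEpis E.shortExact g := ⟨X, f, h.1, h.2⟩

theorem of_iso {X' Y' Z' : C} {f' : X' ⟶ Y'} {g' : Y' ⟶ Z'} (h : E.IsSES f g)
    (a : X ≅ X') (b : Y ≅ Y') (c : Z ≅ Z') (hf : f ≫ b.hom = a.hom ≫ f')
    (hg : g ≫ c.hom = b.hom ≫ g') : E.IsSES f' g' := by
  have w : f' ≫ g' = 0 := by
    rw [← cancel_epi a.hom, ← Category.assoc, ← hf, Category.assoc, ← hg, ← Category.assoc, h.1]
    simp
  exact ⟨w, E.of_iso _ _ (ShortComplex.isoMk a b c hf.symm hg.symm) h.2⟩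

theorem isZero_left (h : E.IsSES f g) (hY : IsZero Y) : IsZero X := by
  have := h.mono
  rw [IsZero.iff_id_eq_zero, ← cancel_mono f]
  exact hY.eq_of_tgt _ _

theorem isZero_right (h : E.IsSES f g) (hY : IsZero Y) : IsZero Z := by
  have := h.epi
  rw [IsZero.iff_id_eq_zero, ← cancel_epi g]
  exact hY.eq_of_src _ _

end IsSES

/-- An admissible epimorphism comes with one kernel by definition. Kernels are unique up to
isomorphism and short exact sequences are closed under isomorphism, so every kernel will do. -/
theorem isSES_of_kernel {X Y Z : C} {f : X ⟶ Y} {g : Y ⟶ Z}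
    (hg : admissibleEpis E.shortExact g) (w : f ≫ g = 0) (hf : Mono f)
    (hl : ∀ (T : C) (x : T ⟶ Y), x ≫ g = 0 → ∃ y : T ⟶ X, y ≫ f = x) : E.IsSES f g := by
  obtain ⟨K, k, wk, hk⟩ := hg
  have hk : E.IsSES k g := ⟨wk, hk⟩
  have := hk.mono
  obtain ⟨a, ha⟩ := hk.exists_lift f w
  obtain ⟨b, hb⟩ := hl _ k wk
  refine hk.of_iso ⟨b, a, ?_, ?_⟩ (Iso.refl _) (Iso.refl _) (by simp [hb]) (by simp)
  · rw [← cancel_mono k]; simp [ha, hb]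
  · rw [← cancel_mono f]; simp [ha, hb]

theorem isSES_of_cokernel {X Y Z : C} {f : X ⟶ Y} {g : Y ⟶ Z}
    (hf : admissibleMonos E.shortExact f) (w : f ≫ g = 0) (hg : Epi g)
    (hl : ∀ (T : C) (x : Y ⟶ T), f ≫ x = 0 → ∃ y : Z ⟶ T, g ≫ y = x) : E.IsSES f g := by
  obtain ⟨K, k, wk, hk⟩ := hf
  have hk : E.IsSES f k := ⟨wk, hk⟩
  have := hk.epi
  obtain ⟨a, ha⟩ := hk.exists_desc g w
  obtain ⟨b, hb⟩ := hl _ k wk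
  refine hk.of_iso (Iso.refl _) (Iso.refl _) ⟨a, b, ?_, ?_⟩ (by simp) (by simp [ha])
  · rw [← cancel_epi k, ← Category.assoc, ha, hb]; simp
  · rw [← cancel_epi g, ← Category.assoc, hb, ha]; simp

theorem admissibleEpi_comp_iso {X Y Z : C} {g : Y ⟶ Z} (e : X ≅ Y)
    (hg : admissibleEpis E.shortExact g) : admissibleEpis E.shortExact (e.hom ≫ g) := by
  obtain ⟨K, k, w, hk⟩ := hg
  have hk : E.IsSES k g := ⟨w, hk⟩
  exact (hk.of_iso (Iso.refl _) e.symm (Iso.refl _) (f' := k ≫ e.inv) (g' := e.hom ≫ g)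
    (by simp) (by simp)).admissibleEpi

/-- The axiom supplies one good pullback square; uniqueness of pullbacks transfers its conclusion to
every pullback square. -/
theorem admissibleEpi_of_isPullback {P Y Z Z' : C} {f' : P ⟶ Y} {p' : P ⟶ Z'} {p : Y ⟶ Z}
    {f : Z' ⟶ Z} (h : IsPullback f' p' p f) (hp : admissibleEpis E.shortExact p) :
    admissibleEpis E.shortExact p' := by
  obtain ⟨Q, f₁, p₁, hQ, hp₁⟩ := E.pullback_epi p f hp
  have := admissibleEpi_comp_iso (h.isoIsPullback _ _ hQ) hp₁
  rwa [h.isoIsPullback_hom_snd] at this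

/-- The short five lemma with identities at both ends. -/
theorem isIso_of_isSES {A D D₂ Z : C} {i : A ⟶ D} {p : D ⟶ Z} {i₂ : A ⟶ D₂} {p₂ : D₂ ⟶ Z}
    (h : E.IsSES i p) (h₂ : E.IsSES i₂ p₂) (b : D ⟶ D₂) (hi : i ≫ b = i₂) (hp : b ≫ p₂ = p) :
    IsIso b := by
  have := h.mono
  have := h₂.mono
  have hb : Mono b := by
    rw [Preadditive.mono_iff_cancel_zero]
    intro T x hx
    obtain ⟨y, rfl⟩ := h.exists_lift x (by rw [← hp, reassoc_of% hx, zero_comp])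
    rw [Category.assoc, hi] at hx
    rw [show y = 0 by rw [← cancel_mono i₂, hx, zero_comp], zero_comp]
  -- This replaces a chase with elements. `F` consists of pairs from `D₂` and `D` with the same
  -- image in `Z`. Correcting the `D`-component by a map to `A` gives a preimage under `b` of the
  -- `D₂`-component, and this descends along `π₂` to a section of `b`.
  obtain ⟨F, π₂, π₁, hF, -⟩ := E.pullback_epi p₂ p h₂.admissibleEpi
  have hπ₂ := admissibleEpi_of_isPullback hF.flip h.admissibleEpi
  obtain ⟨K, k, wk, hk⟩ := hπ₂
  have hk : E.IsSES k π₂ := ⟨wk, hk⟩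
  -- the difference of the two maps to `D₂` factors through `A`
  obtain ⟨a, ha⟩ := h₂.exists_lift (π₂ - π₁ ≫ b) (by
    rw [Preadditive.sub_comp, hF.w, Category.assoc, hp, sub_self])
  have hs : (π₁ + a ≫ i) ≫ b = π₂ := by
    rw [Preadditive.add_comp, Category.assoc, hi, ha]; abel
  obtain ⟨r, hr⟩ := hk.exists_desc (π₁ + a ≫ i) (by
    rw [← cancel_mono b, Category.assoc, hs, wk, zero_comp])
  have := hk.epi
  have hrb : r ≫ b = 𝟙 _ := by
    rw [← cancel_epi π₂, ← Category.assoc, hr, hs, Category.comp_id]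
  exact ⟨r, by rw [← cancel_mono b, Category.assoc, hrb]; simp, hrb⟩

section ThreeByThree

variable {Ka A' A Kc C' Z B' B : C} {ka : Ka ⟶ A'} {a : A' ⟶ A} {kc : Kc ⟶ C'} {c : C' ⟶ Z}
  {i' : A' ⟶ B'} {p' : B' ⟶ C'} {i : A ⟶ B} {p : B ⟶ Z} {b : B' ⟶ B}

/-- A map of short exact sequences that is an admissible epimorphism at both ends is one
in the middle, and the kernels form a short exact sequence. -/
theorem three_by_three (ha : E.IsSES ka a) (hc : E.IsSES kc c) (h' : E.IsSES i' p')
    (h : E.IsSES i p) (wi : i' ≫ b = a ≫ i) (wp : b ≫ p = p' ≫ c) :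
    admissibleEpis E.shortExact b ∧
      ∀ {Kb : C} {kb : Kb ⟶ B'} (_ : E.IsSES kb b) (u : Ka ⟶ Kb) (w : Kb ⟶ Kc)
        (_ : u ≫ kb = ka ≫ i') (_ : w ≫ kc = kb ≫ p'), E.IsSES u w := by
  have := h'.mono
  have := h.mono
  have := ha.mono
  have := hc.mono
  have := ha.epi
  have := h'.epi
  -- The map `b` factors through the pullback `D` of `p` and `c`. The part `D ⟶ B` is a base change
  -- of `c`, and `B' ⟶ D` turns out to be a cobase change of `a`; both are admissible epimorphisms.
  obtain ⟨D, q, p₂, hD, hp₂⟩ := E.pullback_epi p c h.admissibleEpi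
  have hq := admissibleEpi_of_isPullback hD.flip hc.admissibleEpi
  have hi₂ : E.IsSES (hD.lift i 0 (by rw [h.1, zero_comp])) p₂ := by
    refine isSES_of_kernel hp₂ (by simp) (mono_of_mono_fac (hD.lift_fst _ _ _)) fun T x hx => ?_
    obtain ⟨y, hy⟩ := h.exists_lift (x ≫ q) (by rw [Category.assoc, hD.w, reassoc_of% hx, zero_comp])
    exact ⟨y, hD.hom_ext (by simp [hy]) (by simp [hx])⟩
  have hk₂ : E.IsSES (hD.lift 0 kc (by rw [hc.1, zero_comp])) q := by
    refine isSES_of_kernel hq (by simp) (mono_of_mono_fac (hD.lift_snd _ _ _)) fun T x hx => ?_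
    obtain ⟨y, hy⟩ := hc.exists_lift (x ≫ p₂)
      (by rw [Category.assoc, ← hD.w, reassoc_of% hx, zero_comp])
    exact ⟨y, hD.hom_ext (by simp [hx]) (by simp [hy])⟩
  have hfst : hD.lift b p' wp ≫ q = b := hD.lift_fst _ _ _
  have hsnd : hD.lift b p' wp ≫ p₂ = p' := hD.lift_snd _ _ _
  have hbq : admissibleEpis E.shortExact (hD.lift b p' wp) := by
    -- Like `D`, the pushout `W` of `i'` and `a` is an extension of `C'` by `A`, so the short five
    -- lemma identifies them. The map `r : B' ⟶ W` is the cokernel of the admissible monomorphism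
    -- `ka ≫ i'`.
    obtain ⟨W, r, j, hW, hj⟩ := E.pushout_mono i' a h'.admissibleMono
    obtain ⟨t, ht⟩ : ∃ t, t = hW.desc p' (0 : A ⟶ C') (by rw [h'.1, comp_zero]) := ⟨_, rfl⟩
    have hrt : r ≫ t = p' := by rw [ht, hW.inl_desc]
    have hjt : j ≫ t = 0 := by rw [ht, hW.inr_desc]
    have hjt : E.IsSES j t := by
      refine isSES_of_cokernel hj hjt (epi_of_epi_fac hrt) fun T x hx => ?_
      obtain ⟨y, hy⟩ := h'.exists_desc (r ≫ x) (by rw [← Category.assoc, hW.w, Category.assoc, hx, comp_zero])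
      refine ⟨y, hW.hom_ext (by rw [← Category.assoc, hrt, hy]) ?_⟩
      rw [← Category.assoc, hjt, zero_comp, hx]
    have hr : E.IsSES (ka ≫ i') r := by
      refine isSES_of_cokernel (E.comp_mono _ _ ha.admissibleMono h'.admissibleMono) ?_ ?_
        fun T x hx => ?_
      · rw [Category.assoc, hW.w, ← Category.assoc, ha.1, zero_comp]
      · refine ⟨fun x y hxy => hW.hom_ext hxy ?_⟩
        rw [← cancel_epi a, ← Category.assoc, ← hW.w, ← Category.assoc, ← hW.w,
          Category.assoc, hxy, Category.assoc]
      · obtain ⟨y, hy⟩ := ha.exists_desc (i' ≫ x) (by rw [← Category.assoc, hx])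
        exact ⟨hW.desc x y hy.symm, hW.inl_desc _ _ _⟩
    obtain ⟨s, hs⟩ : ∃ s, s = hW.desc (hD.lift b p' wp) (hD.lift i 0 (by rw [h.1, zero_comp]))
      (hD.hom_ext (by simp [wi]) (by simp [h'.1])) := ⟨_, rfl⟩
    have hrs : r ≫ s = hD.lift b p' wp := by rw [hs, hW.inl_desc]
    have : IsIso s := isIso_of_isSES hjt hi₂ s (by rw [hs, hW.inr_desc])
      (hW.hom_ext (by rw [← Category.assoc, hrs, hsnd, hrt])
        (by rw [← Category.assoc, hs, hW.inr_desc, hD.lift_snd, hjt.1]))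
    rw [← hrs]
    exact (hr.of_iso (Iso.refl _) (Iso.refl _) (asIso s) (f' := ka ≫ i') (by simp)
      (by simp)).admissibleEpi
  refine ⟨hfst ▸ E.comp_epi _ _ hbq hq, fun {Kb kb} hb u w hu hw => ?_⟩
  have := hb.mono
  -- The kernel of `b` is the preimage in `B'` of `Kc`, the kernel of `q`. Thus `w` is a base change
  -- of `B' ⟶ D`, hence an admissible epimorphism.
  have hP : IsPullback kb w (hD.lift b p' wp) (hD.lift 0 kc (by rw [hc.1, zero_comp])) := by
    refine ⟨⟨hD.hom_ext (by simp [hb.1]) (by simp [hw])⟩, ⟨PullbackCone.IsLimit.mk _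
      (fun s => hb.lift s.fst ?_) (fun s => hb.lift_comp _ _) (fun s => ?_) fun s m h₁ _ => ?_⟩⟩
    · have := s.condition =≫ q
      simpa using this
    · have := s.condition =≫ p₂
      simp only [Category.assoc, hD.lift_snd] at this
      rw [← cancel_mono kc, ← this, Category.assoc, hw, ← Category.assoc, hb.lift_comp]
    · rw [← cancel_mono kb, h₁, hb.lift_comp]
  refine isSES_of_kernel (admissibleEpi_of_isPullback hP hbq) ?_
    (by have : Mono (u ≫ kb) := by rw [hu]; infer_instance
        exact mono_of_mono u kb) fun T x hx => ?_
  · rw [← cancel_mono kc, Category.assoc, hw, ← Category.assoc, hu, Category.assoc, h'.1]; simp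
  · obtain ⟨y, hy⟩ := h'.exists_lift (x ≫ kb) (by rw [Category.assoc, ← hw, ← Category.assoc, hx, zero_comp])
    obtain ⟨z, hz⟩ := ha.exists_lift y (by
      rw [← cancel_mono i, Category.assoc, ← wi, ← Category.assoc, hy, Category.assoc, hb.1]; simp)
    exact ⟨z, by rw [← cancel_mono kb, Category.assoc, hu, ← Category.assoc, hz, hy]⟩

end ThreeByThree

theorem isSES_of_isZero {X Y Z : C} (hX : IsZero X) (hY : IsZero Y) (hZ : IsZero Z)
    (f : X ⟶ Y) (g : Y ⟶ Z) : E.IsSES f g :=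
  (E.isSES_zero_id hX f).of_iso (Iso.refl _) (Iso.refl _) (hY.iso hZ) (by simp)
    (hZ.eq_of_tgt _ _)

theorem isSES_zero_iso {X Y Z : C} (hX : IsZero X) (f : X ⟶ Y) (g : Y ⟶ Z) [IsIso g] :
    E.IsSES f g :=
  (E.isSES_zero_id hX f).of_iso (Iso.refl _) (Iso.refl _) (asIso g) (by simp) (by simp)

variable [HasZeroObject C] [HasBinaryBiproducts C]

theorem isSES_inl_snd (E : ExactStructure C) (X Y : C) :
    E.IsSES (biprod.inl : X ⟶ X ⊞ Y) biprod.snd := by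
  refine isSES_of_kernel (admissibleEpi_of_isPullback (IsPullback.of_has_biproduct X Y)
    (E.isSES_id_zero (isZero_zero C) _).admissibleEpi) (by simp) inferInstance
    fun T x hx => ⟨x ≫ biprod.fst, ?_⟩
  ext <;> simp [hx]

theorem isSES_inr_fst (E : ExactStructure C) (X Y : C) :
    E.IsSES (biprod.inr : Y ⟶ X ⊞ Y) biprod.fst :=
  (E.isSES_inl_snd Y X).of_iso (Iso.refl _) (biprod.braiding _ _) (Iso.refl _)
    (by ext <;> simp) (by ext <;> simp)

/-- The maps `g` and `g'` are the ends of a map between the split sequences of the two direct sums,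
so `three_by_three` makes their sum an admissible epimorphism; its kernel is found componentwise. -/
theorem IsSES.biprod {X Y Z X' Y' Z' : C} {f : X ⟶ Y} {g : Y ⟶ Z} {f' : X' ⟶ Y'} {g' : Y' ⟶ Z'}
    (h : E.IsSES f g) (h' : E.IsSES f' g') :
    E.IsSES (biprod.map f f') (biprod.map g g') := by
  have := h.mono
  have := h'.mono
  refine isSES_of_kernel (three_by_three (i' := biprod.inl) (p' := biprod.snd) (i := biprod.inl)
    (p := biprod.snd) h h' (E.isSES_inl_snd _ _) (E.isSES_inl_snd _ _) (by simp) (by simp)).1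
    (by ext <;> simp [h.1, h'.1]) inferInstance fun T x hx => ?_
  obtain ⟨y, hy⟩ := h.exists_lift (x ≫ biprod.fst) (by simpa using hx =≫ biprod.fst)
  obtain ⟨y', hy'⟩ := h'.exists_lift (x ≫ biprod.snd) (by simpa using hx =≫ biprod.snd)
  exact ⟨biprod.lift y y', by ext <;> simp [hy, hy']⟩

end ExactStructure

end

/-! ### Cycles of acyclic complexes -/

section

/-- A choice of short exact sequences witnessing that a chain complex is acyclic. -/
structure AcyclicData {C : Type u} [Category.{v} C] [Preadditive C] (E : ExactStructure C)
    (P : ChainComplex C ℤ) where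
  J : ℤ → C
  m : ∀ n, J n ⟶ P.X n
  e : ∀ n, P.X n ⟶ J (n - 1)
  exact : ∀ n, E.IsSES (m n) (e n)
  d_eq : ∀ n, P.d n (n - 1) = e n ≫ m (n - 1)

namespace AcyclicData

variable {C : Type u} [Category.{v} C] [Preadditive C] {E : ExactStructure C}
  {A B D : ChainComplex C ℤ}

theorem isAcyclic (dA : AcyclicData E A) : E.IsAcyclic A :=
  ⟨dA.J, dA.m, dA.e, dA.exact, dA.d_eq⟩

theorem nonempty (h : E.IsAcyclic A) : Nonempty (AcyclicData E A) := by
  obtain ⟨J, m, e, h₁, h₂⟩ := h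
  exact ⟨⟨J, m, e, h₁, h₂⟩⟩

instance (dA : AcyclicData E A) (n : ℤ) : Mono (dA.m n) := (dA.exact n).mono

theorem m_d (dA : AcyclicData E A) (n : ℤ) : dA.m n ≫ A.d n (n - 1) = 0 := by
  rw [dA.d_eq, ← Category.assoc, (dA.exact n).1, zero_comp]

theorem isZero_J (dA : AcyclicData E A) {n : ℤ} (h : IsZero (A.X n)) : IsZero (dA.J n) :=
  (dA.exact n).isZero_left h

/-- The map induced by a chain map on cycles. -/
noncomputable def map (dA : AcyclicData E A) (dB : AcyclicData E B) (f : A ⟶ B) (n : ℤ) :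
    dA.J n ⟶ dB.J n :=
  (dB.exact n).lift (dA.m n ≫ f.f n) (by
    rw [← cancel_mono (dB.m (n - 1)), Category.assoc, Category.assoc, ← dB.d_eq, f.comm,
      ← Category.assoc, m_d, zero_comp, zero_comp])

theorem map_m (dA : AcyclicData E A) (dB : AcyclicData E B) (f : A ⟶ B) (n : ℤ) :
    dA.map dB f n ≫ dB.m n = dA.m n ≫ f.f n := (dB.exact n).lift_comp _ _

theorem e_map (dA : AcyclicData E A) (dB : AcyclicData E B) (f : A ⟶ B) (n : ℤ) :
    dA.e n ≫ dA.map dB f (n - 1) = f.f n ≫ dB.e n := by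
  rw [← cancel_mono (dB.m (n - 1)), Category.assoc, map_m, ← Category.assoc, ← dA.d_eq,
    Category.assoc, ← dB.d_eq, f.comm]

/-- Induction upwards from the lower bound: exactness on cycles in degree `n - 1` is the right-hand
input of `three_by_three` for the terms of degree `n`, whose statement on kernels is exactness on
cycles in degree `n`. -/
theorem map_exact (dA : AcyclicData E A) (dB : AcyclicData E B) (dD : AcyclicData E D)
    (f : A ⟶ B) (g : B ⟶ D) (h : ∀ n, E.IsSES (f.f n) (g.f n)) {a : ℤ}
    (hB : ∀ n < a, IsZero (B.X n)) (n : ℤ) : E.IsSES (dA.map dB f n) (dB.map dD g n) := by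
  suffices H : ∀ (k : ℕ) (n : ℤ), n < a + k →
      E.IsSES (dA.map dB f n) (dB.map dD g n) from
    H (n + 1 - a).toNat n (by omega)
  intro k
  induction k with
  | zero =>
    intro n hn
    have := hB n (by simpa using hn)
    exact ExactStructure.isSES_of_isZero (dA.isZero_J ((h n).isZero_left this)) (dB.isZero_J this)
      (dD.isZero_J ((h n).isZero_right this)) _ _
  | succ k ih =>
    intro n hn
    exact (ExactStructure.three_by_three (dA.exact n) (dD.exact n) (h n)
      (ih (n - 1) (by push_cast at hn; omega)) (dA.e_map dB f n).symm (dB.e_map dD g n)).2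
      (dB.exact n) _ _ (dA.map_m dB f n) (dB.map_m dD g n)

end AcyclicData

namespace ExactStructure

variable {C : Type u} [Category.{v} C] [Preadditive C] {E : ExactStructure C}
  {A B D : ChainComplex C ℤ}

/-- An extension of acyclic complexes that is bounded below is acyclic. -/
theorem isAcyclic_of_isSES (f : A ⟶ B) (g : B ⟶ D) (h : ∀ n, E.IsSES (f.f n) (g.f n))
    (hA : E.IsAcyclic A) (hD : E.IsAcyclic D) {a : ℤ} (hB : ∀ n < a, IsZero (B.X n)) :
    E.IsAcyclic B := by
  obtain ⟨dA⟩ := AcyclicData.nonempty hA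
  obtain ⟨dD⟩ := AcyclicData.nonempty hD
  -- The cycles of `B` have to be constructed. `Q n` provides a kernel of the differential together
  -- with a compatible structure of an extension of the cycles of `D` by those of `A`; `step` passes
  -- from degree `n - 1` to degree `n`.
  let Q : ℤ → Prop := fun n => ∃ (K : C) (k : K ⟶ B.X n) (u : dA.J n ⟶ K) (w : K ⟶ dD.J n),
    (Mono k ∧ k ≫ B.d n (n - 1) = 0 ∧
      ∀ (T : C) (x : T ⟶ B.X n), x ≫ B.d n (n - 1) = 0 → ∃ y, y ≫ k = x) ∧
    u ≫ k = dA.m n ≫ f.f n ∧ w ≫ dD.m n = k ≫ g.f n ∧ E.IsSES u w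
  have step : ∀ (n : ℤ) (K : C) (k : K ⟶ B.X (n - 1)) (u : dA.J (n - 1) ⟶ K)
      (w : K ⟶ dD.J (n - 1)), Mono k → u ≫ k = dA.m (n - 1) ≫ f.f (n - 1) →
      w ≫ dD.m (n - 1) = k ≫ g.f (n - 1) → E.IsSES u w → ∀ (e : B.X n ⟶ K),
      e ≫ k = B.d n (n - 1) → admissibleEpis E.shortExact e ∧
        ∀ {Kb : C} {kb : Kb ⟶ B.X n} (_ : E.IsSES kb e) (u' : dA.J n ⟶ Kb) (w' : Kb ⟶ dD.J n)
        (_ : u' ≫ kb = dA.m n ≫ f.f n) (_ : w' ≫ dD.m n = kb ≫ g.f n), E.IsSES u' w' := by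
    intro n K k u w hk hu hw huw e he
    refine three_by_three (dA.exact n) (dD.exact n) (h n) huw ?_ ?_
    · rw [← cancel_mono k, Category.assoc, he, f.comm, Category.assoc, hu, ← Category.assoc,
        ← dA.d_eq]
    · rw [← cancel_mono (dD.m (n - 1)), Category.assoc, hw, ← Category.assoc, he, Category.assoc,
        ← dD.d_eq, g.comm]
  have key : ∀ n, Q n := by
    suffices H : ∀ (k : ℕ) (n : ℤ), n < a + k → Q n from fun n => H (n + 1 - a).toNat n (by omega)
    intro k
    induction k with
    | zero =>
      intro n hn
      have hz := hB n (by simpa using hn)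
      refine ⟨B.X n, 𝟙 _, dA.m n ≫ f.f n, hz.to_ _, ⟨inferInstance, hz.eq_of_src _ _,
        fun T x _ => ⟨x, by simp⟩⟩, by simp, hz.eq_of_src _ _, ?_⟩
      exact isSES_of_isZero (dA.isZero_J ((h n).isZero_left hz)) hz
        (dD.isZero_J ((h n).isZero_right hz)) _ _
    | succ k ih =>
      intro n hn
      obtain ⟨K, k, u, w, ⟨hk, hkd, hl⟩, hu, hw, huw⟩ := ih (n - 1) (by push_cast at hn; omega)
      obtain ⟨e, he⟩ := hl _ (B.d n (n - 1)) (B.d_comp_d _ _ _)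
      obtain ⟨⟨K', k', hk', hs'⟩, hs⟩ := step n K k u w hk hu hw huw e he
      have hs' : E.IsSES k' e := ⟨hk', hs'⟩
      have hz : ∀ {T : C} (x : T ⟶ B.X n), x ≫ B.d n (n - 1) = 0 → x ≫ e = 0 := by
        intro T x hx
        rw [← cancel_mono k, Category.assoc, he, hx, zero_comp]
      obtain ⟨u', hu'⟩ := hs'.exists_lift (dA.m n ≫ f.f n) (hz _ (by
        rw [Category.assoc, f.comm, ← Category.assoc, dA.m_d, zero_comp]))
      obtain ⟨w', hw'⟩ := (dD.exact n).exists_lift (k' ≫ g.f n) (by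
        rw [← cancel_mono (dD.m (n - 1)), Category.assoc, Category.assoc, ← dD.d_eq, g.comm, ← he,
          Category.assoc, reassoc_of% hk', zero_comp, zero_comp])
      exact ⟨K', k', u', w', ⟨hs'.mono, by rw [← he, ← Category.assoc, hk', zero_comp],
        fun T x hx => hs'.exists_lift x (hz x hx)⟩, hu', hw', hs hs' u' w' hu' hw'⟩
  choose K k u w hk hu hw huw using key
  have he : ∀ n, ∃ e : B.X n ⟶ K (n - 1), e ≫ k (n - 1) = B.d n (n - 1) := fun n =>
    (hk (n - 1)).2.2 _ _ (B.d_comp_d _ _ _)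
  choose e he using he
  refine ⟨K, k, e, fun n => ?_, fun n => (he n).symm⟩
  have := (hk (n - 1)).1
  refine isSES_of_kernel (step n _ _ _ _ (hk (n - 1)).1 (hu _) (hw _) (huw _) (e n) (he n)).1 ?_
    (hk n).1 fun T x hx => (hk n).2.2 _ _ (by rw [← he, ← Category.assoc, hx, zero_comp])
  rw [← cancel_mono (k (n - 1)), Category.assoc, he, (hk n).2.1, zero_comp]

end ExactStructure

end

/-! ### Relations in Nenashev's group -/

section

theorem ExactStructure.isSES_zero_isoHom {C : Type u} [Category.{v} C] [Preadditive C]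
    {E : ExactStructure C} {X Y Z : C} (hX : IsZero X) (f : X ⟶ Y) (e : Y ≅ Z) :
    E.IsSES f e.hom := isSES_zero_iso hX _ _

section NenashevGroup

variable {C : Type u} [Category.{v} C] [Preadditive C] {E : ExactStructure C}

namespace NenashevK1

theorem of_diag (P : BinarySES E) (hi : P.i = P.i') (hp : P.p = P.p') : of E P = 0 :=
  (QuotientAddGroup.eq_zero_iff _).2 (AddSubgroup.subset_closure (NenashevRel.diag P hi hp))

theorem of_eq_zero_of_isZero (P : BinarySES E) (h : ∀ k, IsZero (P.X k)) : of E P = 0 :=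
  of_diag _ ((h 2).eq_of_src _ _) ((h 1).eq_of_src _ _)

theorem of_double (D : BinaryDoubleSES E) :
    of E (D.col 0) - of E (D.col 1) + of E (D.col 2) =
      of E (D.row 2) - of E (D.row 1) + of E (D.row 0) := by
  have := (QuotientAddGroup.eq_zero_iff _).2
    (AddSubgroup.subset_closure (NenashevRel.double D))
  exact sub_eq_zero.1 this

/-- Additivity of the class for short exact sequences of binary short exact sequences. -/
theorem of_eq_add (P' P P'' : BinarySES E) {u2 : P'.X 2 ⟶ P.X 2} {u1 : P'.X 1 ⟶ P.X 1}
    {u0 : P'.X 0 ⟶ P.X 0} {w2 : P.X 2 ⟶ P''.X 2} {w1 : P.X 1 ⟶ P''.X 1} {w0 : P.X 0 ⟶ P''.X 0}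
    (h2 : E.IsSES u2 w2) (h1 : E.IsSES u1 w1) (h0 : E.IsSES u0 w0)
    (ui : P'.i ≫ u1 = u2 ≫ P.i) (up : P'.p ≫ u0 = u1 ≫ P.p)
    (ui' : P'.i' ≫ u1 = u2 ≫ P.i') (up' : P'.p' ≫ u0 = u1 ≫ P.p')
    (wi : P.i ≫ w1 = w2 ≫ P''.i) (wp : P.p ≫ w0 = w1 ≫ P''.p)
    (wi' : P.i' ≫ w1 = w2 ≫ P''.i') (wp' : P.p' ≫ w0 = w1 ≫ P''.p') :
    of E P = of E P' + of E P'' := by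
  let R : Fin 3 → BinarySES E := ![P'', P, P']
  let D : BinaryDoubleSES E :=
    { X := fun k l => (R l).X k
      hi := fun l => (R l).i
      hp := fun l => (R l).p
      hi' := fun l => (R l).i'
      hp' := fun l => (R l).p'
      vi := fun | 0 => u0 | 1 => u1 | 2 => u2
      vp := fun | 0 => w0 | 1 => w1 | 2 => w2
      vi' := fun | 0 => u0 | 1 => u1 | 2 => u2
      vp' := fun | 0 => w0 | 1 => w1 | 2 => w2
      row_top := fun l => (R l).top_exact
      row_bot := fun l => (R l).bot_exact
      col_top := fun | 0 => h0 | 1 => h1 | 2 => h2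
      col_bot := fun | 0 => h0 | 1 => h1 | 2 => h2
      comm_ii := ui
      comm_pi := up
      comm_ip := wi
      comm_pp := wp
      comm_ii' := ui'
      comm_pi' := up'
      comm_ip' := wi'
      comm_pp' := wp' }
  -- The same vertical maps serve the top and the bottom diagram, so the columns are diagonal.
  have h : ∀ k, of E (D.col k) = 0 := fun k => of_diag _ (by fin_cases k <;> rfl)
    (by fin_cases k <;> rfl)
  have := of_double D
  rw [h, h, h] at this
  change _ = of E P' - of E P + of E P'' at this
  rw [sub_self, add_zero, eq_comm, sub_add_eq_add_sub, sub_eq_zero] at this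
  exact this.symm

end NenashevK1

variable [HasZeroObject C]

/-- The binary short exact sequence `0 ⟶ X ⟶ Y` given by two isomorphisms. -/
noncomputable def BinarySES.ofIso (E : ExactStructure C) {X Y : C} (ψ φ : X ≅ Y) : BinarySES E where
  X := ![Y, X, 0]
  i := (0 : (0 : C) ⟶ X)
  p := ψ.hom
  i' := (0 : (0 : C) ⟶ X)
  p' := φ.hom
  top_exact := ExactStructure.isSES_zero_isoHom (isZero_zero C) _ ψ
  bot_exact := ExactStructure.isSES_zero_isoHom (isZero_zero C) _ φ

namespace NenashevK1

theorem of_ofIso_self {X Y : C} (ψ : X ≅ Y) : of E (BinarySES.ofIso E ψ ψ) = 0 :=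
  of_diag _ rfl rfl

/-- Changing the top and bottom sequences by isomorphisms. -/
theorem of_sub_of (P Q : BinarySES E) (ψ2 φ2 : P.X 2 ≅ Q.X 2) (ψ1 φ1 : P.X 1 ≅ Q.X 1)
    (ψ0 φ0 : P.X 0 ≅ Q.X 0)
    (hi : P.i ≫ ψ1.hom = ψ2.hom ≫ Q.i) (hp : P.p ≫ ψ0.hom = ψ1.hom ≫ Q.p)
    (hi' : P.i' ≫ φ1.hom = φ2.hom ≫ Q.i') (hp' : P.p' ≫ φ0.hom = φ1.hom ≫ Q.p') :
    of E Q - of E P = of E (BinarySES.ofIso E ψ0 φ0) - of E (BinarySES.ofIso E ψ1 φ1) +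
      of E (BinarySES.ofIso E ψ2 φ2) := by
  have h0 : IsZero (0 : C) := isZero_zero C
  -- With a zero row on one side, vertical isomorphisms become short exact columns.
  let Z : BinarySES E := ⟨fun _ => 0, 0, 0, 0, 0,
    ExactStructure.isSES_of_isZero h0 h0 h0 _ _, ExactStructure.isSES_of_isZero h0 h0 h0 _ _⟩
  let R : Fin 3 → BinarySES E := ![Q, P, Z]
  let D : BinaryDoubleSES E :=
    { X := fun k l => (R l).X k
      hi := fun l => (R l).i
      hp := fun l => (R l).p
      hi' := fun l => (R l).i'
      hp' := fun l => (R l).p'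
      vi := fun _ => (h0.to_ _)
      vp := fun | 0 => ψ0.hom | 1 => ψ1.hom | 2 => ψ2.hom
      vi' := fun _ => (h0.to_ _)
      vp' := fun | 0 => φ0.hom | 1 => φ1.hom | 2 => φ2.hom
      row_top := fun l => (R l).top_exact
      row_bot := fun l => (R l).bot_exact
      col_top := fun
        | 0 => ExactStructure.isSES_zero_isoHom h0 _ ψ0
        | 1 => ExactStructure.isSES_zero_isoHom h0 _ ψ1
        | 2 => ExactStructure.isSES_zero_isoHom h0 _ ψ2
      col_bot := fun
        | 0 => ExactStructure.isSES_zero_isoHom h0 _ φ0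
        | 1 => ExactStructure.isSES_zero_isoHom h0 _ φ1
        | 2 => ExactStructure.isSES_zero_isoHom h0 _ φ2
      comm_ii := h0.eq_of_src _ _
      comm_pi := h0.eq_of_src _ _
      comm_ip := hi
      comm_pp := hp
      comm_ii' := h0.eq_of_src _ _
      comm_pi' := h0.eq_of_src _ _
      comm_ip' := hi'
      comm_pp' := hp' }
  have h := of_double D
  -- The objects of `D.col k` and of `ofIso` agree for each index but are given by different
  -- functions on `Fin 3`. They are compared through an extension with zero quotient.
  have hcol : ∀ (k : Fin 3) (ψ φ : P.X k ≅ Q.X k), ψ.hom = D.vp k → φ.hom = D.vp' k →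
      of E (D.col k) = of E (BinarySES.ofIso E ψ φ) := by
    intro k ψ φ hψ hφ
    have := of_eq_add (BinarySES.ofIso E ψ φ) (D.col k) Z (u2 := 𝟙 (0 : C)) (u1 := 𝟙 (P.X k))
      (u0 := 𝟙 (Q.X k)) (w2 := 𝟙 (0 : C)) (w1 := h0.from_ (P.X k)) (w0 := h0.from_ (Q.X k))
      (E.isSES_id_zero h0 _) (E.isSES_id_zero h0 _) (E.isSES_id_zero h0 _)
      (h0.eq_of_src _ _)
      ((Category.comp_id ψ.hom).trans (hψ.trans (Category.id_comp (D.vp k)).symm))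
      (h0.eq_of_src _ _)
      ((Category.comp_id φ.hom).trans (hφ.trans (Category.id_comp (D.vp' k)).symm))
      (h0.eq_of_src _ _) (h0.eq_of_tgt _ _) (h0.eq_of_src _ _) (h0.eq_of_tgt _ _)
    rw [of_eq_zero_of_isZero Z fun _ => h0, add_zero] at this
    exact this
  rw [hcol 0 ψ0 φ0 rfl rfl, hcol 1 ψ1 φ1 rfl rfl, hcol 2 ψ2 φ2 rfl rfl] at h
  change _ = of E Z - of E P + of E Q at h
  rw [of_eq_zero_of_isZero Z fun _ => h0] at h
  rw [h]; abel

variable [HasBinaryBiproducts C]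

/-- The class of the swap of two copies of an object. -/
noncomputable def swap (E : ExactStructure C) (X : C) : NenashevK1 E :=
  of E (BinarySES.ofIso E (Iso.refl (X ⊞ X)) (biprod.braiding X X))

/-- Swapping two copies of an object is natural, so a short exact sequence of objects induces one of
swap sequences. -/
theorem swap_eq_add {X Y Z : C} {f : X ⟶ Y} {g : Y ⟶ Z} (h : E.IsSES f g) :
    swap E Y = swap E X + swap E Z := by
  have h0 : IsZero (0 : C) := isZero_zero C
  refine of_eq_add _ _ _ (u2 := 𝟙 (0 : C)) (w2 := 𝟙 (0 : C)) (u1 := biprod.map f f)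
    (u0 := biprod.map f f) (w1 := biprod.map g g) (w0 := biprod.map g g)
    (E.isSES_id_zero h0 _) (h.biprod h) (h.biprod h) (h0.eq_of_src _ _) ?_ (h0.eq_of_src _ _) ?_
    (h0.eq_of_src _ _) ?_ (h0.eq_of_src _ _) ?_
  · exact (Category.id_comp _).trans (Category.comp_id _).symm
  · change (biprod.braiding X X).hom ≫ _ = _ ≫ (biprod.braiding Y Y).hom
    ext <;> simp
  · exact (Category.id_comp _).trans (Category.comp_id _).symm
  · change (biprod.braiding Y Y).hom ≫ _ = _ ≫ (biprod.braiding Z Z).hom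
    ext <;> simp

end NenashevK1

end NenashevGroup

namespace BinarySES

variable {C : Type u} [Category.{v} C] [Preadditive C] {E : ExactStructure C}

/-- Exchange of top and bottom. -/
def op (P : BinarySES E) : BinarySES E where
  X := P.X
  i := P.i'
  p := P.p'
  i' := P.i
  p' := P.p
  top_exact := P.bot_exact
  bot_exact := P.top_exact

variable [HasZeroObject C] [HasBinaryBiproducts C]

/-- The direct sum. -/
noncomputable def biprod (P Q : BinarySES E) : BinarySES E where
  X := fun k => P.X k ⊞ Q.X k
  i := biprod.map P.i Q.i
  p := biprod.map P.p Q.p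
  i' := biprod.map P.i' Q.i'
  p' := biprod.map P.p' Q.p'
  top_exact := P.top_exact.biprod Q.top_exact
  bot_exact := P.bot_exact.biprod Q.bot_exact

theorem of_biprod (P Q : BinarySES E) :
    NenashevK1.of E (P.biprod Q) = NenashevK1.of E P + NenashevK1.of E Q :=
  NenashevK1.of_eq_add _ _ _ (E.isSES_inl_snd _ _) (E.isSES_inl_snd _ _) (E.isSES_inl_snd _ _)
    (biprod.inl_map _ _).symm (biprod.inl_map _ _).symm (biprod.inl_map _ _).symm
    (biprod.inl_map _ _).symm (biprod.map_snd _ _) (biprod.map_snd _ _) (biprod.map_snd _ _)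
    (biprod.map_snd _ _)

/-- The identity on top and the swap on the bottom carry `P ⊕ P.op` to a diagonal sequence. The
error in `of_sub_of` is the alternating sum of the swap classes of the objects of `P`, which
vanishes by additivity. -/
theorem of_op (P : BinarySES E) : NenashevK1.of E P.op = - NenashevK1.of E P := by
  let Q : BinarySES E :=
    { (P.biprod P.op) with
      i' := (P.biprod P.op).i
      p' := (P.biprod P.op).p
      bot_exact := (P.biprod P.op).top_exact }
  have h := NenashevK1.of_sub_of (P.biprod P.op) Q (Iso.refl _) (biprod.braiding _ _)
    (Iso.refl _) (biprod.braiding _ _) (Iso.refl _) (biprod.braiding _ _)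
    ((Category.comp_id _).trans (Category.id_comp _).symm)
    ((Category.comp_id _).trans (Category.id_comp _).symm)
    (Limits.biprod.braid_natural _ _) (Limits.biprod.braid_natural _ _)
  change _ = NenashevK1.swap E (P.X 0) - NenashevK1.swap E (P.X 1) + NenashevK1.swap E (P.X 2) at h
  rw [NenashevK1.swap_eq_add P.top_exact, NenashevK1.of_diag Q rfl rfl, of_biprod] at h
  have h' := h.trans (show _ = (0 : NenashevK1 E) by abel)
  rw [zero_sub, neg_eq_zero] at h'
  exact (neg_eq_of_add_eq_zero_right h').symm

end BinarySES

end

/-! ### Alternating sums of the columns of a triple -/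

section

section SignedSum

variable {A : Type*} [AddCommGroup A]

/-- The alternating sum of a finitely supported family. -/
noncomputable def signedSum (F : ℤ → A) : A := ∑ᶠ n : ℤ, n.negOnePow • F n

theorem support_negOnePow_smul (F : ℤ → A) :
    (Function.support fun n : ℤ => n.negOnePow • F n) = Function.support F := by
  ext n
  rcases Int.units_eq_one_or n.negOnePow with h | h <;> simp [h]

theorem signedSum_add {F G : ℤ → A} (hF : F.support.Finite) (hG : G.support.Finite) :
    signedSum (fun n => F n + G n) = signedSum F + signedSum G := by
  unfold signedSum
  rw [← support_negOnePow_smul] at hF hG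
  rw [← finsum_add_distrib hF hG]
  simp only [smul_add]

theorem signedSum_neg (F : ℤ → A) : signedSum (fun n => - F n) = - signedSum F := by
  unfold signedSum
  rw [← finsum_neg_distrib]
  simp only [smul_neg]

theorem signedSum_zero : signedSum (fun _ : ℤ => (0 : A)) = 0 := by
  simp [signedSum]

/-- A telescoping alternating sum. -/
theorem signedSum_telescope {F G : ℤ → A} (hG : G.support.Finite)
    (h : ∀ n, F n = G n + G (n - 1)) : signedSum F = 0 := by
  have hG' : (fun n => G (n - 1)).support.Finite := by
    refine (hG.image (fun n => n + 1)).subset fun n hn => ⟨n - 1, hn, by simp⟩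
  rw [show F = fun n => G n + G (n - 1) from funext h, signedSum_add hG hG',
    add_eq_zero_iff_eq_neg, ← signedSum_neg]
  unfold signedSum
  rw [← finsum_comp_equiv (Equiv.subRight (1 : ℤ))]
  refine finsum_congr fun n => ?_
  simp [Int.negOnePow_sub]

end SignedSum

variable {C : Type u} [Category.{v} C] [Preadditive C]

theorem biprod_map_comp_eq [HasBinaryBiproducts C] {X Y Y' Z X₁ Y₁ Y₁' Z₁ : C} {a : X ⟶ Y}
    {b : Y ⟶ Z} {c : X ⟶ Y'} {d : Y' ⟶ Z} {a₁ : X₁ ⟶ Y₁} {b₁ : Y₁ ⟶ Z₁} {c₁ : X₁ ⟶ Y₁'}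
    {d₁ : Y₁' ⟶ Z₁} (h : a ≫ b = c ≫ d) (h₁ : a₁ ≫ b₁ = c₁ ≫ d₁) :
    biprod.map a a₁ ≫ biprod.map b b₁ = biprod.map c c₁ ≫ biprod.map d d₁ := by
  ext <;> simp [h, h₁]

theorem biprod_map_eq_comp [HasBinaryBiproducts C] {X Y' Z X₁ Y₁' Z₁ : C} {a : X ⟶ Z}
    {c : X ⟶ Y'} {d : Y' ⟶ Z} {a₁ : X₁ ⟶ Z₁} {c₁ : X₁ ⟶ Y₁'}
    {d₁ : Y₁' ⟶ Z₁} (h : a = c ≫ d) (h₁ : a₁ = c₁ ≫ d₁) :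
    biprod.map a a₁ = biprod.map c c₁ ≫ biprod.map d d₁ := by
  ext <;> simp [h, h₁]

namespace BinaryComplex

/-- Top and bottom differential agree. -/
def IsDiag (P : BinaryComplex C) : Prop := ∀ i j, P.d i j = P.d' i j

/-- Supported in a bounded range of degrees. -/
def IsBounded (P : BinaryComplex C) : Prop := ∃ a b : ℤ, P.SupportedOn (Set.Icc a b)

/-- Both differentials are acyclic. -/
structure IsAcyclic (E : ExactStructure C) (P : BinaryComplex C) : Prop where
  top : E.IsAcyclic P.top
  bot : E.IsAcyclic P.bot

theorem IsDiag.bot_eq_top {P : BinaryComplex C} (h : P.IsDiag) : P.bot = P.top := by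
  have : P.d = P.d' := by ext i j; exact h i j
  simp only [bot, top, this]

theorem IsDiag.isAcyclic {E : ExactStructure C} {P : BinaryComplex C} (h : P.IsDiag)
    (ht : E.IsAcyclic P.top) : P.IsAcyclic E := ⟨ht, h.bot_eq_top ▸ ht⟩

theorem SupportedOn.mono {P : BinaryComplex C} {I J : Set ℤ} (hP : P.SupportedOn I)
    (h : I ⊆ J) : P.SupportedOn J := fun n hn => hP n fun hn' => hn (h hn')

/-- Exchange of top and bottom. -/
def op (P : BinaryComplex C) : BinaryComplex C where
  X := P.X
  d := P.d'
  d' := P.d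
  shape := P.shape'
  shape' := P.shape
  d_comp_d := P.d'_comp_d'
  d'_comp_d' := P.d_comp_d

/-- A chain complex with equal top and bottom differential. -/
def ofChain (A : ChainComplex C ℤ) : BinaryComplex C where
  X := A.X
  d := A.d
  d' := A.d
  shape := A.shape
  shape' := A.shape
  d_comp_d := A.d_comp_d
  d'_comp_d' := A.d_comp_d

theorem IsAcyclic.op {E : ExactStructure C} {P : BinaryComplex C} (h : P.IsAcyclic E) :
    P.op.IsAcyclic E := ⟨h.bot, h.top⟩

/-- An isomorphism of binary complexes. -/
structure Isom (P Q : BinaryComplex C) where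
  f : ∀ n, P.X n ≅ Q.X n
  comm : ∀ i j, (f i).hom ≫ Q.d i j = P.d i j ≫ (f j).hom
  comm' : ∀ i j, (f i).hom ≫ Q.d' i j = P.d' i j ≫ (f j).hom

theorem finite_not_isZero {P : BinaryComplex C} (h : P.IsBounded) :
    {n | ¬ IsZero (P.X n)}.Finite := by
  obtain ⟨a, b, h⟩ := h
  exact (Set.finite_Icc a b).subset fun n hn => by_contra fun hn' => hn (h n hn')

section

variable [HasBinaryBiproducts C]

/-- The direct sum. -/
noncomputable def biprod (P Q : BinaryComplex C) : BinaryComplex C where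
  X := fun n => P.X n ⊞ Q.X n
  d := fun i j => biprod.map (P.d i j) (Q.d i j)
  d' := fun i j => biprod.map (P.d' i j) (Q.d' i j)
  shape := fun i j h => by rw [P.shape i j h, Q.shape i j h]; ext <;> simp
  shape' := fun i j h => by rw [P.shape' i j h, Q.shape' i j h]; ext <;> simp
  d_comp_d := fun i j k => by ext <;> simp [P.d_comp_d, Q.d_comp_d]
  d'_comp_d' := fun i j k => by ext <;> simp [P.d'_comp_d', Q.d'_comp_d']

theorem IsDiag.biprod {P Q : BinaryComplex C} (hP : P.IsDiag) (hQ : Q.IsDiag) :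
    (P.biprod Q).IsDiag := fun i j => by
  change biprod.map _ _ = biprod.map _ _
  rw [hP, hQ]

theorem SupportedOn.biprod {P Q : BinaryComplex C} {I : Set ℤ} (hP : P.SupportedOn I)
    (hQ : Q.SupportedOn I) : (P.biprod Q).SupportedOn I := fun n hn =>
  (biprod_isZero_iff _ _).2 ⟨hP n hn, hQ n hn⟩

theorem IsBounded.biprod {P Q : BinaryComplex C} (hP : P.IsBounded)
    (hQ : Q.IsBounded) : (P.biprod Q).IsBounded := by
  obtain ⟨a, b, h⟩ := hP
  obtain ⟨a', b', h'⟩ := hQ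
  exact ⟨min a a', max b b', (h.mono (Set.Icc_subset_Icc (min_le_left _ _) (le_max_left _ _))).biprod
    (h'.mono (Set.Icc_subset_Icc (min_le_right _ _) (le_max_right _ _)))⟩

variable [HasZeroObject C] {E : ExactStructure C}

/-- The direct sum of acyclicity data. -/
noncomputable def acyclicDataBiprod {P Q : BinaryComplex C} (dP : AcyclicData E P.top)
    (dQ : AcyclicData E Q.top) : AcyclicData E (P.biprod Q).top where
  J := fun n => dP.J n ⊞ dQ.J n
  m := fun n => biprod.map (dP.m n) (dQ.m n)
  e := fun n => biprod.map (dP.e n) (dQ.e n)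
  exact := fun n => (dP.exact n).biprod (dQ.exact n)
  d_eq := fun n => biprod_map_eq_comp (dP.d_eq n) (dQ.d_eq n)

theorem IsAcyclic.biprod {P Q : BinaryComplex C} (hP : P.IsAcyclic E) (hQ : Q.IsAcyclic E) :
    (P.biprod Q).IsAcyclic E := by
  obtain ⟨dP⟩ := AcyclicData.nonempty hP.top
  obtain ⟨dQ⟩ := AcyclicData.nonempty hQ.top
  obtain ⟨dP'⟩ := AcyclicData.nonempty hP.bot
  obtain ⟨dQ'⟩ := AcyclicData.nonempty hQ.bot
  exact ⟨(acyclicDataBiprod dP dQ).isAcyclic,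
    (acyclicDataBiprod (P := P.op) (Q := Q.op) dP' dQ').isAcyclic⟩

end

section

variable [HasZeroObject C]

/-- The zero complex. -/
noncomputable def zero (C : Type u) [Category.{v} C] [Preadditive C] [HasZeroObject C] :
    BinaryComplex C where
  X := fun _ => 0
  d := fun _ _ => 0
  d' := fun _ _ => 0
  shape := fun _ _ _ => rfl
  shape' := fun _ _ _ => rfl
  d_comp_d := fun _ _ _ => by simp
  d'_comp_d' := fun _ _ _ => by simp

theorem zero_supportedOn (I : Set ℤ) : (zero C).SupportedOn I := fun _ _ => isZero_zero C

theorem isAcyclic_of_isZero {E : ExactStructure C} {P : BinaryComplex C}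
    (h : ∀ n, IsZero (P.X n)) : P.IsAcyclic E where
  top := ⟨fun _ => 0, fun _ => 0, fun _ => 0, fun n =>
    ExactStructure.isSES_of_isZero (isZero_zero C) (h n) (isZero_zero C) _ _, fun n =>
      (h n).eq_of_src _ _⟩
  bot := ⟨fun _ => 0, fun _ => 0, fun _ => 0, fun n =>
    ExactStructure.isSES_of_isZero (isZero_zero C) (h n) (isZero_zero C) _ _, fun n =>
      (h n).eq_of_src _ _⟩

/-- Adding the zero complex. -/
noncomputable def isomBiprodZero [HasBinaryBiproducts C] (P : BinaryComplex C) :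
    P.Isom (P.biprod (zero C)) where
  f := fun n => ⟨biprod.inl, biprod.fst, biprod.inl_fst, (by
    ext
    simp :
      (biprod.fst : P.X n ⊞ (0 : C) ⟶ P.X n) ≫ biprod.inl = 𝟙 _)⟩
  comm := fun i j => biprod.inl_map _ _
  comm' := fun i j => biprod.inl_map _ _

end

end BinaryComplex

/-- Three binary complexes, with two degreewise short exact sequences of chain complexes, one
between the top and one between the bottom complexes. -/
structure Triple (E : ExactStructure C) where
  R : Fin 3 → BinaryComplex C
  f : ∀ n, (R 2).X n ⟶ (R 1).X n
  g : ∀ n, (R 1).X n ⟶ (R 0).X n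
  f' : ∀ n, (R 2).X n ⟶ (R 1).X n
  g' : ∀ n, (R 1).X n ⟶ (R 0).X n
  f_comm : ∀ i j, f i ≫ (R 1).d i j = (R 2).d i j ≫ f j
  g_comm : ∀ i j, g i ≫ (R 0).d i j = (R 1).d i j ≫ g j
  f_comm' : ∀ i j, f' i ≫ (R 1).d' i j = (R 2).d' i j ≫ f' j
  g_comm' : ∀ i j, g' i ≫ (R 0).d' i j = (R 1).d' i j ≫ g' j
  exact : ∀ n, E.IsSES (f n) (g n)
  exact' : ∀ n, E.IsSES (f' n) (g' n)

namespace Triple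

variable {E : ExactStructure C}

/-- The binary short exact sequence in degree `n`. -/
def col (t : Triple E) (n : ℤ) : BinarySES E where
  X := fun l => (t.R l).X n
  i := t.f n
  p := t.g n
  i' := t.f' n
  p' := t.g' n
  top_exact := t.exact n
  bot_exact := t.exact' n

/-- The alternating sum of the classes of the columns. -/
noncomputable def chi (t : Triple E) : NenashevK1 E :=
  signedSum fun n => NenashevK1.of E (t.col n)

theorem finite_support_col (t : Triple E) (hb : ∀ l, (t.R l).IsBounded) :
    (Function.support fun n => NenashevK1.of E (t.col n)).Finite := by
  refine (Set.finite_iUnion fun l => BinaryComplex.finite_not_isZero (hb l)).subset fun n hn => ?_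
  by_contra h
  simp only [Set.mem_iUnion, Set.mem_ofPred_eq, not_exists, not_not] at h
  exact hn (NenashevK1.of_eq_zero_of_isZero _ h)

/-- If all three rows have equal top and bottom differential, the alternating sum of the
columns vanishes. -/
theorem chi_eq_zero_of_isDiag (t : Triple E) (hb : ∀ l, (t.R l).IsBounded)
    (hd : ∀ l, (t.R l).IsDiag) (ha : ∀ l, E.IsAcyclic (t.R l).top) : t.chi = 0 := by
  -- As the rows are diagonal, one choice of cycles serves both differentials. The maps between
  -- cycles and terms are then the same on top and bottom, as `of_eq_add` requires.
  have d := fun l => (AcyclicData.nonempty (ha l)).some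
  let F : (t.R 2).top ⟶ (t.R 1).top := ⟨t.f, fun i j _ => t.f_comm i j⟩
  let G : (t.R 1).top ⟶ (t.R 0).top := ⟨t.g, fun i j _ => t.g_comm i j⟩
  let F' : (t.R 2).top ⟶ (t.R 1).top := ⟨t.f', fun i j _ => by
    change t.f' i ≫ (t.R 1).d i j = (t.R 2).d i j ≫ t.f' j
    rw [hd, hd, t.f_comm']⟩
  let G' : (t.R 1).top ⟶ (t.R 0).top := ⟨t.g', fun i j _ => by
    change t.g' i ≫ (t.R 0).d i j = (t.R 1).d i j ≫ t.g' j
    rw [hd, hd, t.g_comm']⟩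
  obtain ⟨a, b, hab⟩ := hb 1
  have hz : ∀ n < a, IsZero ((t.R 1).top.X n) := fun n hn => hab n fun h => by
    have := h.1; omega
  let D : ℤ → BinarySES E := fun n =>
    { X := fun l => (d l).J n
      i := (d 2).map (d 1) F n
      p := (d 1).map (d 0) G n
      i' := (d 2).map (d 1) F' n
      p' := (d 1).map (d 0) G' n
      top_exact := (d 2).map_exact (d 1) (d 0) F G t.exact hz n
      bot_exact := (d 2).map_exact (d 1) (d 0) F' G' t.exact' hz n }
  refine signedSum_telescope (G := fun n => NenashevK1.of E (D n)) ?_ fun n => ?_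
  · refine (Set.finite_iUnion fun l => BinaryComplex.finite_not_isZero (hb l)).subset
      fun n hn => ?_
    by_contra h
    simp only [Set.mem_iUnion, Set.mem_ofPred_eq, not_exists, not_not] at h
    exact hn (NenashevK1.of_eq_zero_of_isZero _ fun l => (d l).isZero_J (h l))
  · exact NenashevK1.of_eq_add (D n) (t.col n) (D (n - 1)) ((d 2).exact n) ((d 1).exact n)
      ((d 0).exact n) ((d 2).map_m (d 1) F n) ((d 1).map_m (d 0) G n) ((d 2).map_m (d 1) F' n)
      ((d 1).map_m (d 0) G' n) ((d 2).e_map (d 1) F n).symm ((d 1).e_map (d 0) G n).symm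
      ((d 2).e_map (d 1) F' n).symm ((d 1).e_map (d 0) G' n).symm

/-- Exchange of top and bottom. -/
def op (t : Triple E) : Triple E where
  R := fun l => (t.R l).op
  f := t.f'
  g := t.g'
  f' := t.f
  g' := t.g
  f_comm := t.f_comm'
  g_comm := t.g_comm'
  f_comm' := t.f_comm
  g_comm' := t.g_comm
  exact := t.exact'
  exact' := t.exact

variable [HasZeroObject C] [HasBinaryBiproducts C]

theorem chi_op (t : Triple E) : t.op.chi = - t.chi :=
  (congrArg signedSum (funext fun n => BinarySES.of_op (t.col n))).trans (signedSum_neg _)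

/-- The direct sum. -/
noncomputable def biprod (t s : Triple E) : Triple E where
  R := fun l => (t.R l).biprod (s.R l)
  f := fun n => biprod.map (t.f n) (s.f n)
  g := fun n => biprod.map (t.g n) (s.g n)
  f' := fun n => biprod.map (t.f' n) (s.f' n)
  g' := fun n => biprod.map (t.g' n) (s.g' n)
  f_comm := fun i j => biprod_map_comp_eq (t.f_comm i j) (s.f_comm i j)
  g_comm := fun i j => biprod_map_comp_eq (t.g_comm i j) (s.g_comm i j)
  f_comm' := fun i j => biprod_map_comp_eq (t.f_comm' i j) (s.f_comm' i j)
  g_comm' := fun i j => biprod_map_comp_eq (t.g_comm' i j) (s.g_comm' i j)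
  exact := fun n => (t.exact n).biprod (s.exact n)
  exact' := fun n => (t.exact' n).biprod (s.exact' n)

theorem chi_biprod (t s : Triple E) (ht : ∀ l, (t.R l).IsBounded) (hs : ∀ l, (s.R l).IsBounded) :
    (t.biprod s).chi = t.chi + s.chi :=
  (congrArg signedSum (funext fun n => BinarySES.of_biprod (t.col n) (s.col n))).trans
    (signedSum_add (t.finite_support_col ht) (s.finite_support_col hs))

end Triple

/-- The alternating sum of the swap classes of an acyclic complex vanishes. -/
theorem signedSum_swap [HasZeroObject C] [HasBinaryBiproducts C] {E : ExactStructure C}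
    {P : BinaryComplex C} (hb : P.IsBounded) (ha : E.IsAcyclic P.top) :
    signedSum (fun n => NenashevK1.swap E (P.X n)) = 0 := by
  obtain ⟨d⟩ := AcyclicData.nonempty ha
  refine signedSum_telescope (G := fun n => NenashevK1.swap E (d.J n)) ?_ fun n =>
    NenashevK1.swap_eq_add (d.exact n)
  refine (BinaryComplex.finite_not_isZero hb).subset fun n hn => ?_
  by_contra h
  have hz : IsZero (d.J n) := d.isZero_J (not_not.1 h)
  have := NenashevK1.swap_eq_add (ExactStructure.isSES_of_isZero (E := E) hz hz hz (𝟙 _) (𝟙 _))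
  exact hn (by simpa using this)

end

/-! ### Witnesses and their independence of choices -/

section

variable {C : Type u} [Category.{v} C] [Preadditive C] [HasBinaryBiproducts C]

/-- Exchange of the two inner summands. -/
noncomputable def biprodShuffle (X Y Z W : C) : (X ⊞ Y) ⊞ (Z ⊞ W) ≅ (X ⊞ Z) ⊞ (Y ⊞ W) where
  hom := biprod.lift (biprod.map biprod.fst biprod.fst) (biprod.map biprod.snd biprod.snd)
  inv := biprod.lift (biprod.map biprod.fst biprod.fst) (biprod.map biprod.snd biprod.snd)
  hom_inv_id := by ext <;> simp
  inv_hom_id := by ext <;> simp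

theorem biprodShuffle_natural {X Y Z W X' Y' Z' W' : C} (a : X ⟶ X') (b : Y ⟶ Y') (c : Z ⟶ Z')
    (d : W ⟶ W') : biprod.map (biprod.map a b) (biprod.map c d) ≫ (biprodShuffle X' Y' Z' W').hom =
      (biprodShuffle X Y Z W).hom ≫ biprod.map (biprod.map a c) (biprod.map b d) := by
  ext <;> simp [biprodShuffle]

theorem braiding_comp_braiding_comp {X Y Z : C} (h : X ⊞ Y ⟶ Z) :
    (biprod.braiding X Y).hom ≫ (biprod.braiding Y X).hom ≫ h = h := by
  ext <;> simp

variable [HasZeroObject C]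

/-- A presentation of a binary complex, up to a summand with equal differentials, as the middle
row of a triple whose outer rows have equal differentials. -/
structure Witness (E : ExactStructure C) (P : BinaryComplex C) where
  t : Triple E
  acyclic : ∀ l, (t.R l).IsAcyclic E
  bounded : ∀ l, (t.R l).IsBounded
  diag2 : (t.R 2).IsDiag
  diag0 : (t.R 0).IsDiag
  K : BinaryComplex C
  K_diag : K.IsDiag
  K_acyclic : K.IsAcyclic E
  iso : (t.R 1).Isom (P.biprod K)

namespace Witness

variable {E : ExactStructure C} {P Q : BinaryComplex C}

/-- The direct sum of witnesses. -/
noncomputable def biprod (w : Witness E P) (w' : Witness E Q) : Witness E (P.biprod Q) where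
  t := w.t.biprod w'.t
  acyclic := fun l => (w.acyclic l).biprod (w'.acyclic l)
  bounded := fun l => (w.bounded l).biprod (w'.bounded l)
  diag2 := w.diag2.biprod w'.diag2
  diag0 := w.diag0.biprod w'.diag0
  K := w.K.biprod w'.K
  K_diag := w.K_diag.biprod w'.K_diag
  K_acyclic := w.K_acyclic.biprod w'.K_acyclic
  iso :=
    { f := fun n => biprod.mapIso (w.iso.f n) (w'.iso.f n) ≪≫ biprodShuffle _ _ _ _
      comm := fun i j => by
        have := biprod_map_comp_eq (w.iso.comm i j) (w'.iso.comm i j)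
        change (biprod.map _ _ ≫ (biprodShuffle _ _ _ _).hom) ≫ biprod.map (biprod.map _ _)
          (biprod.map _ _) = biprod.map _ _ ≫ (biprod.map _ _ ≫ (biprodShuffle _ _ _ _).hom)
        rw [Category.assoc, ← biprodShuffle_natural, ← Category.assoc, ← Category.assoc]
        exact congrArg (· ≫ _) this
      comm' := fun i j => by
        have := biprod_map_comp_eq (w.iso.comm' i j) (w'.iso.comm' i j)
        change (biprod.map _ _ ≫ (biprodShuffle _ _ _ _).hom) ≫ biprod.map (biprod.map _ _)
          (biprod.map _ _) = biprod.map _ _ ≫ (biprod.map _ _ ≫ (biprodShuffle _ _ _ _).hom)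
        rw [Category.assoc, ← biprodShuffle_natural, ← Category.assoc, ← Category.assoc]
        exact congrArg (· ≫ _) this }

theorem chi_biprod (w : Witness E P) (w' : Witness E Q) :
    (w.biprod w').t.chi = w.t.chi + w'.t.chi := Triple.chi_biprod _ _ w.bounded w'.bounded

/-- Exchange of top and bottom. -/
def op (w : Witness E P) : Witness E P.op where
  t := w.t.op
  acyclic := fun l => (w.acyclic l).op
  bounded := fun l => w.bounded l
  diag2 := fun i j => (w.diag2 i j).symm
  diag0 := fun i j => (w.diag0 i j).symm
  K := w.K.op
  K_diag := fun i j => (w.K_diag i j).symm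
  K_acyclic := w.K_acyclic.op
  iso := ⟨w.iso.f, w.iso.comm', w.iso.comm⟩

theorem chi_op (w : Witness E P) : w.op.t.chi = - w.t.chi := Triple.chi_op _

/-- The swap of the two summands conjugates the top differential of `P ⊕ P.op` to the bottom one.
Absorbing it into the bottom maps makes all rows diagonal, so the new columns sum to zero. Each
column changes by `swap E (P.X n)`, and these classes cancel since `P` is acyclic. -/
theorem chi_eq_zero_of_biprod_op (w : Witness E (P.biprod P.op)) (hb : P.IsBounded)
    (ha : P.IsAcyclic E) : w.t.chi = 0 := by
  let θ : ∀ n, (w.t.R 1).X n ≅ (P.X n ⊞ P.X n) ⊞ w.K.X n := w.iso.f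
  let σ : ∀ n, (w.t.R 1).X n ≅ (w.t.R 1).X n := fun n =>
    θ n ≪≫ biprod.mapIso (biprod.braiding _ _) (Iso.refl _) ≪≫ (θ n).symm
  have hθ : ∀ i j, (θ i).hom ≫ biprod.map (biprod.map (P.d i j) (P.d' i j)) (w.K.d i j) =
      (w.t.R 1).d i j ≫ (θ j).hom := w.iso.comm
  have hθ' : ∀ i j, (θ i).hom ≫ biprod.map (biprod.map (P.d' i j) (P.d i j)) (w.K.d i j) =
      (w.t.R 1).d' i j ≫ (θ j).hom := fun i j => by
    rw [w.K_diag i j]; exact w.iso.comm' i j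
  have hθi : ∀ i j, (θ i).inv ≫ (w.t.R 1).d i j =
      biprod.map (biprod.map (P.d i j) (P.d' i j)) (w.K.d i j) ≫ (θ j).inv := fun i j => by
    rw [Iso.inv_comp_eq, ← Category.assoc, hθ, Category.assoc, Iso.hom_inv_id, Category.comp_id]
  have hsw : ∀ i j, (biprod.mapIso (biprod.braiding (P.X i) (P.X i)) (Iso.refl (w.K.X i))).hom ≫
      biprod.map (biprod.map (P.d i j) (P.d' i j)) (w.K.d i j) =
      biprod.map (biprod.map (P.d' i j) (P.d i j)) (w.K.d i j) ≫
        (biprod.mapIso (biprod.braiding (P.X j) (P.X j)) (Iso.refl (w.K.X j))).hom := fun i j => by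
    ext <;> simp
  have hσ : ∀ i j, (σ i).hom ≫ (w.t.R 1).d i j = (w.t.R 1).d' i j ≫ (σ j).hom := fun i j => by
    simp only [σ, Iso.trans_hom, Iso.symm_hom, Category.assoc]
    rw [hθi, reassoc_of% hsw, ← Category.assoc, hθ', Category.assoc]
  have hσi : ∀ i j, (σ i).inv ≫ (w.t.R 1).d' i j = (w.t.R 1).d i j ≫ (σ j).inv := fun i j => by
    rw [Iso.inv_comp_eq, ← Category.assoc, hσ, Category.assoc, Iso.hom_inv_id, Category.comp_id]
  let R : Fin 3 → BinaryComplex C := ![w.t.R 0, BinaryComplex.ofChain (w.t.R 1).top, w.t.R 2]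
  let s : Triple E :=
    { R := R
      f := w.t.f
      g := w.t.g
      f' := fun n => w.t.f' n ≫ (σ n).hom
      g' := fun n => (σ n).inv ≫ w.t.g' n
      f_comm := w.t.f_comm
      g_comm := w.t.g_comm
      f_comm' := fun i j => by
        change (w.t.f' i ≫ (σ i).hom) ≫ (w.t.R 1).d i j =
          (w.t.R 2).d' i j ≫ w.t.f' j ≫ (σ j).hom
        rw [Category.assoc, hσ, ← Category.assoc, w.t.f_comm', Category.assoc]
      g_comm' := fun i j => by
        change ((σ i).inv ≫ w.t.g' i) ≫ (w.t.R 0).d' i j =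
          (w.t.R 1).d i j ≫ (σ j).inv ≫ w.t.g' j
        rw [Category.assoc, w.t.g_comm', ← Category.assoc, hσi, Category.assoc]
      exact := w.t.exact
      exact' := fun n => (w.t.exact' n).of_iso (Iso.refl _) (σ n) (Iso.refl _)
        (Category.id_comp _).symm
        ((Category.comp_id (w.t.g' n)).trans (Iso.hom_inv_id_assoc (σ n) (w.t.g' n)).symm) }
  have hs : s.chi = 0 := by
    refine s.chi_eq_zero_of_isDiag ?_ ?_ ?_
    · intro l; fin_cases l
      exacts [w.bounded 0, w.bounded 1, w.bounded 2]
    · intro l; fin_cases l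
      exacts [w.diag0, fun _ _ => rfl, w.diag2]
    · intro l; fin_cases l
      exacts [(w.acyclic 0).top, (w.acyclic 1).top, (w.acyclic 2).top]
  have hcol : ∀ n, NenashevK1.of E (w.t.col n) =
      NenashevK1.of E (s.col n) + NenashevK1.swap E (P.X n) := fun n => by
    have h₁ := NenashevK1.of_sub_of (w.t.col n) (s.col n) (Iso.refl _) (Iso.refl _) (Iso.refl _)
      (σ n) (Iso.refl _) (Iso.refl _)
      ((Category.comp_id _).trans (Category.id_comp _).symm)
      ((Category.comp_id _).trans (Category.id_comp _).symm)
      (Category.id_comp _).symm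
      ((Category.comp_id (w.t.g' n)).trans ((Iso.hom_inv_id_assoc (σ n) (w.t.g' n)).symm))
    -- Under `θ n`, the automorphism `σ n` is the swap on two copies of `P.X n` plus the identity of
    -- `w.K.X n`, and the second summand has class zero.
    have h₂ : NenashevK1.of E (BinarySES.ofIso E (Iso.refl ((w.t.R 1).X n)) (σ n)) =
        NenashevK1.swap E (P.X n) +
          NenashevK1.of E (BinarySES.ofIso E (Iso.refl (w.K.X n)) (Iso.refl (w.K.X n))) := by
      have h0 : IsZero (0 : C) := isZero_zero C
      have hx : E.IsSES (biprod.inl ≫ (θ n).inv) ((θ n).hom ≫ biprod.snd) :=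
        (E.isSES_inl_snd (P.X n ⊞ P.X n) (w.K.X n)).of_iso (Iso.refl _) (θ n).symm (Iso.refl _)
          (by simp) (by simp)
      refine NenashevK1.of_eq_add _ _ _ (u2 := 𝟙 (0 : C)) (w2 := 𝟙 (0 : C)) (E.isSES_id_zero h0 _)
        hx hx (h0.eq_of_src _ _) ?_ (h0.eq_of_src _ _) ?_ (h0.eq_of_src _ _) ?_
        (h0.eq_of_src _ _) ?_
      · exact (Category.id_comp _).trans (Category.comp_id _).symm
      · change (biprod.braiding (P.X n) (P.X n)).hom ≫ biprod.inl ≫ (θ n).inv =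
          (biprod.inl ≫ (θ n).inv) ≫ (σ n).hom
        simp [σ]
      · exact (Category.id_comp _).trans (Category.comp_id _).symm
      · change (σ n).hom ≫ (θ n).hom ≫ biprod.snd = ((θ n).hom ≫ biprod.snd) ≫ 𝟙 _
        simp [σ]
    rw [NenashevK1.of_ofIso_self, add_zero] at h₂
    have h₃ := NenashevK1.of_ofIso_self (E := E) (Iso.refl ((w.t.col n).X 0))
    have h₄ := NenashevK1.of_ofIso_self (E := E) (Iso.refl ((w.t.col n).X 2))
    rw [← h₂]
    have h₅ := h₁.trans (congrArg₂ (fun a b => a -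
      NenashevK1.of E (BinarySES.ofIso E (Iso.refl ((w.t.R 1).X n)) (σ n)) + b) h₃ h₄)
    have key : ∀ {A : Type _} [AddCommGroup A] (s w x : A), w - s = 0 - x + 0 → s = w + x :=
      fun s w x h => by rw [sub_eq_iff_eq_add] at h; rw [h]; abel
    exact key _ _ _ h₅
  unfold Triple.chi at hs ⊢
  rw [show (fun n => NenashevK1.of E (w.t.col n)) = fun n => NenashevK1.of E (s.col n) +
    NenashevK1.swap E (P.X n) from funext hcol, signedSum_add, hs, signedSum_swap hb ha.top,
    add_zero]
  · refine s.finite_support_col ?_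
    intro l; fin_cases l
    exacts [w.bounded 0, w.bounded 1, w.bounded 2]
  · refine (BinaryComplex.finite_not_isZero hb).subset fun n hn => ?_
    by_contra h
    have hz : IsZero (P.X n) := not_not.1 h
    have := NenashevK1.swap_eq_add (ExactStructure.isSES_of_isZero (E := E) hz hz hz (𝟙 _) (𝟙 _))
    exact hn (by simpa using this)

/-- The alternating sum of the columns does not depend on the witness. -/
theorem chi_unique (w w' : Witness E P) (hb : P.IsBounded) (ha : P.IsAcyclic E) :
    w.t.chi = w'.t.chi := by
  -- `w'.op` is a witness for `P.op`, so this sum is a witness for `P ⊕ P.op`; its alternating sum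
  -- is the difference of the two sides.
  have := (w.biprod w'.op).chi_eq_zero_of_biprod_op hb ha
  rw [chi_biprod, chi_op] at this
  exact add_neg_eq_zero.1 this

/-- A diagonal complex may itself be an outer row: the triple `0 ⟶ P ⟶ P` has only diagonal columns.
-/
theorem exists_of_isDiag (hd : P.IsDiag) (hb : P.IsBounded) (ha : P.IsAcyclic E) :
    ∃ w : Witness E P, w.t.chi = 0 := by
  have h0 : IsZero (0 : C) := isZero_zero C
  let R : Fin 3 → BinaryComplex C := ![P, P, BinaryComplex.zero C]
  let t : Triple E :=
    { R := R
      f := fun n => h0.to_ (P.X n)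
      g := fun n => 𝟙 (P.X n)
      f' := fun n => h0.to_ (P.X n)
      g' := fun n => 𝟙 (P.X n)
      f_comm := fun i j => h0.eq_of_src _ _
      g_comm := fun i j => (Category.id_comp (P.d i j)).trans (Category.comp_id (P.d i j)).symm
      f_comm' := fun i j => h0.eq_of_src _ _
      g_comm' := fun i j => (Category.id_comp (P.d' i j)).trans (Category.comp_id (P.d' i j)).symm
      exact := fun n => E.isSES_zero_id h0 _
      exact' := fun n => E.isSES_zero_id h0 _ }
  have hz : (BinaryComplex.zero C).IsAcyclic E := BinaryComplex.isAcyclic_of_isZero fun _ => h0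
  refine ⟨⟨t, ?_, ?_, fun _ _ => rfl, hd, BinaryComplex.zero C, fun _ _ => rfl, hz,
    P.isomBiprodZero⟩, ?_⟩
  · intro l; fin_cases l
    exacts [ha, ha, hz]
  · intro l; fin_cases l
    exacts [hb, hb, ⟨0, 0, BinaryComplex.zero_supportedOn _⟩]
  · exact (congrArg signedSum (funext fun n => NenashevK1.of_diag (t.col n) rfl rfl)).trans
      signedSum_zero

/-- A witness for the alternating sum of the terms of a short exact sequence of binary
complexes. -/
theorem exists_of_isSES {P' P'' : BinaryComplex C} (f : BinaryComplex.Hom P' P)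
    (g : BinaryComplex.Hom P P'') (h : ∀ n, E.IsSES (f.f n) (g.f n)) (hb : P.IsBounded)
    (hb' : P'.IsBounded) (hb'' : P''.IsBounded) (ha : P.IsAcyclic E) (ha' : P'.IsAcyclic E)
    (ha'' : P''.IsAcyclic E) :
    ∃ w : Witness E (P.biprod (P'.op.biprod P''.op)), w.t.chi = 0 := by
  -- The outer rows carry `d ⊕ d'` both as top and as bottom differential. On the bottom, the middle
  -- row has `d'` on `P` and `d` on `P'` and `P''`, so the summands of the outer rows must be
  -- swapped before `f ⊕ inl` and after `g ⊕ snd`.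
  let R : Fin 3 → BinaryComplex C := ![BinaryComplex.ofChain (P''.biprod P''.op).top,
    P.biprod (P'.op.biprod P''.op), BinaryComplex.ofChain (P'.biprod P'.op).top]
  have hfg : ∀ n, E.IsSES (biprod.map (f.f n) (biprod.inl : P'.X n ⟶ P'.X n ⊞ P''.X n))
      (biprod.map (g.f n) biprod.snd) := fun n => (h n).biprod (E.isSES_inl_snd _ _)
  let t : Triple E :=
    { R := R
      f := fun n => biprod.map (f.f n) (biprod.inl : P'.X n ⟶ P'.X n ⊞ P''.X n)
      g := fun n => biprod.map (g.f n) (biprod.snd : P'.X n ⊞ P''.X n ⟶ P''.X n)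
      f' := fun n => (biprod.braiding (P'.X n) (P'.X n)).hom ≫
        biprod.map (f.f n) (biprod.inl : P'.X n ⟶ P'.X n ⊞ P''.X n)
      g' := fun n => biprod.map (g.f n) (biprod.snd : P'.X n ⊞ P''.X n ⟶ P''.X n) ≫
        (biprod.braiding (P''.X n) (P''.X n)).hom
      f_comm := fun i j => biprod_map_comp_eq (f.comm i j) (biprod.inl_map _ _)
      g_comm := fun i j => biprod_map_comp_eq (g.comm i j) (biprod.map_snd _ _).symm
      f_comm' := fun i j => by
        have h₁ := biprod_map_comp_eq (f.comm' i j)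
          (biprod.inl_map (P'.d i j) (P''.d i j) :
            (biprod.inl : P'.X i ⟶ P'.X i ⊞ P''.X i) ≫ _ = _)
        change (_ ≫ biprod.map (f.f i) biprod.inl) ≫ biprod.map (P.d' i j) (biprod.map (P'.d i j)
          (P''.d i j)) = biprod.map (P'.d i j) (P'.d' i j) ≫ _ ≫ _
        exact (Category.assoc _ _ _).trans ((congrArg (_ ≫ ·) h₁).trans
          ((Category.assoc _ _ _).symm.trans ((congrArg (· ≫ _)
            (biprod.braid_natural _ _).symm).trans (Category.assoc _ _ _))))
      g_comm' := fun i j => by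
        have h₁ := biprod_map_comp_eq (g.comm' i j)
          (biprod.map_snd (P'.d i j) (P''.d i j) :
            _ = (biprod.snd : P'.X i ⊞ P''.X i ⟶ P''.X i) ≫ _).symm
        change (biprod.map (g.f i) biprod.snd ≫ _) ≫ biprod.map (P''.d i j) (P''.d' i j) =
          biprod.map (P.d' i j) (biprod.map (P'.d i j) (P''.d i j)) ≫ _ ≫ _
        exact (Category.assoc _ _ _).trans ((congrArg (_ ≫ ·)
          (biprod.braid_natural _ _).symm).trans ((Category.assoc _ _ _).symm.trans
            ((congrArg (· ≫ _) h₁).trans (Category.assoc _ _ _))))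
      exact := hfg
      exact' := fun n => (hfg n).of_iso (biprod.braiding _ _) (Iso.refl _) (biprod.braiding _ _)
        ((Category.comp_id _).trans (braiding_comp_braiding_comp _).symm)
        (Category.id_comp _).symm }
  have hz : (BinaryComplex.zero C).IsAcyclic E :=
    BinaryComplex.isAcyclic_of_isZero fun _ => isZero_zero C
  have hd : ∀ A : ChainComplex C ℤ, (BinaryComplex.ofChain A).IsDiag := fun _ _ _ => rfl
  refine ⟨⟨t, ?_, ?_, fun _ _ => rfl, fun _ _ => rfl, BinaryComplex.zero C, fun _ _ => rfl, hz,
    BinaryComplex.isomBiprodZero _⟩, ?_⟩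
  · intro l; fin_cases l
    exacts [(hd _).isAcyclic (ha''.biprod ha''.op).top, ha.biprod (ha'.op.biprod ha''.op),
      (hd _).isAcyclic (ha'.biprod ha'.op).top]
  · intro l; fin_cases l
    exacts [hb''.biprod (Q := P''.op) hb'', hb.biprod
      (BinaryComplex.IsBounded.biprod (P := P'.op) (Q := P''.op) hb' hb''),
      hb'.biprod (Q := P'.op) hb']
  -- Removing the swaps at the two ends turns the column into the diagonal sequence `b`; the two
  -- corrections add up to the swap class of `P.X n` along `h n`.
  · have hcol : ∀ n, NenashevK1.of E (t.col n) = - NenashevK1.swap E (P.X n) := fun n => by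
      let b : BinarySES E := ⟨(t.col n).X, t.f n, t.g n, t.f n, t.g n, t.exact n, t.exact n⟩
      have h₁ := NenashevK1.of_sub_of (t.col n) b (Iso.refl _) (biprod.braiding (P'.X n) (P'.X n))
        (Iso.refl _) (Iso.refl _) (Iso.refl _) (biprod.braiding (P''.X n) (P''.X n))
        ((Category.comp_id _).trans (Category.id_comp _).symm)
        ((Category.comp_id _).trans (Category.id_comp _).symm)
        (Category.comp_id _) (by
          change (biprod.map (g.f n) biprod.snd ≫ (biprod.braiding _ _).hom) ≫
            (biprod.braiding _ _).hom = 𝟙 _ ≫ biprod.map (g.f n) biprod.snd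
          simp)
      have h₂ := NenashevK1.of_ofIso_self (E := E) (Iso.refl ((t.col n).X 1))
      have h₃ := h₁.trans (congrArg (fun a => NenashevK1.swap E (P''.X n) - a +
        NenashevK1.swap E (P'.X n)) h₂)
      rw [NenashevK1.of_diag b rfl rfl, zero_sub, sub_zero, add_comm,
        ← NenashevK1.swap_eq_add (h n)] at h₃
      rw [← h₃, neg_neg]
    rw [Triple.chi, funext hcol, signedSum_neg, signedSum_swap hb ha.top, neg_zero]

end Witness

end

/-! ### Double short exact sequences and complexes of length two as triples -/

section

section ExtendMaps

variable {C : Type u} [Category.{v} C] [HasZeroObject C] [Preadditive C]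

/-- The map of graded objects with `u 2, u 1, u 0` in degrees `2, 1, 0`. -/
noncomputable def extMap {X Y : Fin 3 → C} (a : ∀ k, X k ⟶ Y k) : ∀ n : ℤ, extX X n ⟶ extX Y n
  | 0 => a 0
  | 1 => a 1
  | 2 => a 2
  | _ => 0

theorem extMap_comm {X Y : Fin 3 → C} (a : ∀ k, X k ⟶ Y k) {i : X 2 ⟶ X 1} {p : X 1 ⟶ X 0}
    {i' : Y 2 ⟶ Y 1} {p' : Y 1 ⟶ Y 0} (hi : a 2 ≫ i' = i ≫ a 1) (hp : a 1 ≫ p' = p ≫ a 0)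
    (m n : ℤ) : extMap a m ≫ extD Y i' p' m n = extD X i p m n ≫ extMap a n := by
  by_cases h : n + 1 = m
  · subst h
    by_cases h0 : n = 0
    · subst h0; exact hp
    by_cases h1 : n = 1
    · subst h1; exact hi
    by_cases h2 : n = -1
    · subst h2
      exact (extX_isZero Y (by norm_num) (by norm_num) (by norm_num)).eq_of_tgt _ _
    · exact (extX_isZero X (by omega) (by omega) (by omega)).eq_of_src _ _
  · rw [extD_zero _ _ _ _ _ h, extD_zero _ _ _ _ _ h, comp_zero, zero_comp]

theorem extMap_isSES {E : ExactStructure C} {X Y Z : Fin 3 → C} {a : ∀ k, X k ⟶ Y k}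
    {b : ∀ k, Y k ⟶ Z k} (h : ∀ k, E.IsSES (a k) (b k)) (n : ℤ) :
    E.IsSES (extMap a n) (extMap b n) := by
  by_cases h0 : n = 0
  · subst h0; exact h 0
  by_cases h1 : n = 1
  · subst h1; exact h 1
  by_cases h2 : n = 2
  · subst h2; exact h 2
  exact ExactStructure.isSES_of_isZero (extX_isZero X h0 h1 h2) (extX_isZero Y h0 h1 h2)
    (extX_isZero Z h0 h1 h2) _ _

end ExtendMaps

theorem signedSum_eq_of_support {A : Type*} [AddCommGroup A] {F : ℤ → A}
    (h : ∀ n, n ≠ 0 → n ≠ 1 → n ≠ 2 → F n = 0) : signedSum F = F 0 - F 1 + F 2 := by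
  unfold signedSum
  rw [finsum_eq_sum_of_support_subset (s := {0, 1, 2})]
  · rw [Finset.sum_insert (by simp), Finset.sum_insert (by simp), Finset.sum_singleton]
    have h1 : (1 : ℤ).negOnePow = -1 := Int.negOnePow_one
    have h2 : (2 : ℤ).negOnePow = 1 := Int.negOnePow_even 2 even_two
    rw [Int.negOnePow_zero, h1, h2, one_smul, one_smul, Units.neg_smul, one_smul]
    abel
  · intro n hn
    by_contra h'
    simp only [Finset.coe_insert, Finset.coe_singleton, Set.mem_insert_iff,
      Set.mem_singleton_iff, not_or] at h'
    exact hn (by simp [h n h'.1 h'.2.1 h'.2.2])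

variable {C : Type u} [Category.{v} C] [HasZeroObject C] [Preadditive C] {E : ExactStructure C}

theorem BinarySES.toBinaryAcyclicComplex_isAcyclic (P : BinarySES E) :
    P.toBinaryAcyclicComplex.toBinaryComplex.IsAcyclic E :=
  ⟨P.toBinaryAcyclicComplex.top_acyclic, P.toBinaryAcyclicComplex.bot_acyclic⟩

theorem BinarySES.toBinaryAcyclicComplex_isDiag (P : BinarySES E) (hi : P.i = P.i')
    (hp : P.p = P.p') : P.toBinaryAcyclicComplex.toBinaryComplex.IsDiag := fun m n => by
  change extD P.X P.i P.p m n = extD P.X P.i' P.p' m n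
  rw [hi, hp]

/-- The rows of a double short exact sequence, extended by zero. -/
noncomputable def BinaryDoubleSES.triple (D : BinaryDoubleSES E) : Triple E where
  R := fun l => (D.row l).toBinaryAcyclicComplex.toBinaryComplex
  f := extMap fun k => D.vi k
  g := extMap fun k => D.vp k
  f' := extMap fun k => D.vi' k
  g' := extMap fun k => D.vp' k
  f_comm := extMap_comm _ D.comm_ii.symm D.comm_pi.symm
  g_comm := extMap_comm _ D.comm_ip.symm D.comm_pp.symm
  f_comm' := extMap_comm _ D.comm_ii'.symm D.comm_pi'.symm
  g_comm' := extMap_comm _ D.comm_ip'.symm D.comm_pp'.symm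
  exact := extMap_isSES D.col_top
  exact' := extMap_isSES D.col_bot

theorem BinaryDoubleSES.triple_col_isZero (D : BinaryDoubleSES E) {n : ℤ} (h0 : n ≠ 0)
    (h1 : n ≠ 1) (h2 : n ≠ 2) (l : Fin 3) : IsZero ((D.triple.col n).X l) :=
  extX_isZero _ h0 h1 h2

theorem BinaryDoubleSES.chi_triple (D : BinaryDoubleSES E) :
    D.triple.chi = NenashevK1.of E (D.col 0) - NenashevK1.of E (D.col 1) +
      NenashevK1.of E (D.col 2) :=
  signedSum_eq_of_support fun _ h0 h1 h2 => NenashevK1.of_eq_zero_of_isZero _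
    (D.triple_col_isZero h0 h1 h2)

theorem NenashevK1.of_eq_of_iso (P Q : BinarySES E) (ψ2 : P.X 2 ≅ Q.X 2) (ψ1 : P.X 1 ≅ Q.X 1)
    (ψ0 : P.X 0 ≅ Q.X 0) (hi : P.i ≫ ψ1.hom = ψ2.hom ≫ Q.i) (hp : P.p ≫ ψ0.hom = ψ1.hom ≫ Q.p)
    (hi' : P.i' ≫ ψ1.hom = ψ2.hom ≫ Q.i') (hp' : P.p' ≫ ψ0.hom = ψ1.hom ≫ Q.p') :
    of E P = of E Q := by
  have h := of_sub_of P Q ψ2 ψ2 ψ1 ψ1 ψ0 ψ0 hi hp hi' hp'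
  rw [of_ofIso_self, of_ofIso_self, of_ofIso_self, sub_zero, add_zero, sub_eq_zero] at h
  exact h.symm

variable [HasBinaryBiproducts C]

/-- The outer rows are `X 2 = X 2 ⟶ 0` and `0 ⟶ X 0 = X 0`, and the middle row is `b`. Of the
columns, only the middle one is not diagonal by construction: it is `b` again, and it sits in degree
`1`, hence the sign. -/
theorem Witness.exists_of_length_two (b : BinarySES E) :
    ∃ w : Witness E b.toBinaryAcyclicComplex.toBinaryComplex,
      w.t.chi = - NenashevK1.of E b := by
  have h0 : IsZero (0 : C) := isZero_zero C
  have hz : h0.from_ (b.X 2) ≫ h0.to_ (b.X 0) = 0 := by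
    rw [h0.eq_of_src (h0.to_ (b.X 0)) 0, comp_zero]
  let b₂ : BinarySES E := ⟨![0, b.X 2, b.X 2], 𝟙 (b.X 2), h0.from_ (b.X 2), 𝟙 (b.X 2),
    h0.from_ (b.X 2), E.isSES_id_zero h0 _, E.isSES_id_zero h0 _⟩
  let b₀ : BinarySES E := ⟨![b.X 0, b.X 0, 0], h0.to_ (b.X 0), 𝟙 (b.X 0), h0.to_ (b.X 0),
    𝟙 (b.X 0), E.isSES_zero_id h0 _, E.isSES_zero_id h0 _⟩
  let R : Fin 3 → BinarySES E := ![b₀, b, b₂]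
  let D : BinaryDoubleSES E :=
    { X := fun k l => (R l).X k
      hi := fun l => (R l).i
      hp := fun l => (R l).p
      hi' := fun l => (R l).i'
      hp' := fun l => (R l).p'
      vi := fun | 0 => h0.to_ (b.X 0) | 1 => b.i | 2 => 𝟙 (b.X 2)
      vp := fun | 0 => 𝟙 (b.X 0) | 1 => b.p | 2 => h0.from_ (b.X 2)
      vi' := fun | 0 => h0.to_ (b.X 0) | 1 => b.i' | 2 => 𝟙 (b.X 2)
      vp' := fun | 0 => 𝟙 (b.X 0) | 1 => b.p' | 2 => h0.from_ (b.X 2)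
      row_top := fun l => (R l).top_exact
      row_bot := fun l => (R l).bot_exact
      col_top := fun | 0 => E.isSES_zero_id h0 _ | 1 => b.top_exact | 2 => E.isSES_id_zero h0 _
      col_bot := fun | 0 => E.isSES_zero_id h0 _ | 1 => b.bot_exact | 2 => E.isSES_id_zero h0 _
      comm_ii := rfl
      comm_pi := hz.trans b.top_exact.1.symm
      comm_ip := b.top_exact.1.trans hz.symm
      comm_pp := rfl
      comm_ii' := rfl
      comm_pi' := hz.trans b.bot_exact.1.symm
      comm_ip' := b.bot_exact.1.trans hz.symm
      comm_pp' := rfl }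
  refine ⟨⟨D.triple, fun l => (D.row l).toBinaryAcyclicComplex_isAcyclic,
    fun l => (D.row l).toBinaryAcyclicComplex.bounded,
    b₂.toBinaryAcyclicComplex_isDiag rfl rfl, b₀.toBinaryAcyclicComplex_isDiag rfl rfl,
    BinaryComplex.zero C, fun _ _ => rfl, BinaryComplex.isAcyclic_of_isZero fun _ => h0,
    BinaryComplex.isomBiprodZero _⟩, ?_⟩
  refine D.chi_triple.trans ?_
  rw [NenashevK1.of_diag (D.col 0) rfl rfl, NenashevK1.of_diag (D.col 2) rfl rfl]
  have h := NenashevK1.of_eq_of_iso b (D.col 1) (Iso.refl (b.X 2)) (Iso.refl (b.X 1))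
    (Iso.refl (b.X 0))
    ((Category.comp_id b.i).trans (Category.id_comp b.i).symm)
    ((Category.comp_id b.p).trans (Category.id_comp b.p).symm)
    ((Category.comp_id b.i').trans (Category.id_comp b.i').symm)
    ((Category.comp_id b.p').trans (Category.id_comp b.p').symm)
  rw [← h, zero_sub, add_zero]

end

/-! ### Classes of binary complexes in Grayson's group -/

section

namespace ExactStructure

variable {C : Type u} [Category.{v} C] [Preadditive C] {E : ExactStructure C}

theorem IsSES.isZero_middle {X Y Z : C} {f : X ⟶ Y} {g : Y ⟶ Z} (h : E.IsSES f g)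
    (hX : IsZero X) (hZ : IsZero Z) : IsZero Y := by
  obtain ⟨y, hy⟩ := h.exists_lift (𝟙 Y) (hZ.eq_of_tgt _ _)
  rw [IsZero.iff_id_eq_zero, ← hy, hX.eq_of_src f 0, comp_zero]

theorem IsAcyclic.of_iso {A B : ChainComplex C ℤ} (h : E.IsAcyclic A) (θ : ∀ n, A.X n ≅ B.X n)
    (hθ : ∀ i j, (θ i).hom ≫ B.d i j = A.d i j ≫ (θ j).hom) : E.IsAcyclic B := by
  obtain ⟨J, m, e, hme, hd⟩ := h
  refine ⟨J, fun n => m n ≫ (θ n).hom, fun n => (θ n).inv ≫ e n, fun n =>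
    (hme n).of_iso (Iso.refl _) (θ n) (Iso.refl _) (by simp) (by simp), fun n => ?_⟩
  rw [Category.assoc, ← reassoc_of% hd, ← hθ, Iso.inv_hom_id_assoc]

end ExactStructure

namespace BinaryComplex

variable {C : Type u} [Category.{v} C] [Preadditive C] {E : ExactStructure C} {I : Set ℤ}

/-- Bounded, acyclic and supported on `I`. -/
structure IsAdmissible (E : ExactStructure C) (I : Set ℤ) (P : BinaryComplex C) : Prop where
  bounded : P.IsBounded
  acyclic : P.IsAcyclic E
  supported : P.SupportedOn I

open Classical in
/-- The class in Grayson's group, with value zero if the complex does not define a class. -/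
noncomputable def cls (E : ExactStructure C) (I : Set ℤ) (P : BinaryComplex C) :
    GraysonK0 E I :=
  if h : P.IsAdmissible E I then
    GraysonK0.of E ⟨P, h.bounded, h.acyclic.top, h.acyclic.bot⟩ h.supported
  else 0

theorem _root_.BinaryAcyclicComplex.isAdmissible (P : BinaryAcyclicComplex E)
    (hP : P.SupportedOn I) : P.toBinaryComplex.IsAdmissible E I :=
  ⟨P.bounded, ⟨P.top_acyclic, P.bot_acyclic⟩, hP⟩

theorem _root_.BinaryAcyclicComplex.cls_eq (P : BinaryAcyclicComplex E) (hP : P.SupportedOn I) :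
    P.toBinaryComplex.cls E I = GraysonK0.of E P hP :=
  dif_pos (P.isAdmissible hP)

theorem cls_eq_zero_of_isDiag {P : BinaryComplex C} (h : P.IsDiag) : P.cls E I = 0 := by
  unfold cls
  split
  · exact (QuotientAddGroup.eq_zero_iff _).2 (AddSubgroup.subset_closure (GraysonRel.diag _ h))
  · rfl

theorem cls_eq_add {P' P P'' : BinaryComplex C} (f : P'.Hom P) (g : P.Hom P'')
    (h : ∀ n, E.IsSES (f.f n) (g.f n)) (hP' : P'.IsAdmissible E I) (hP : P.IsAdmissible E I)
    (hP'' : P''.IsAdmissible E I) : P.cls E I = P'.cls E I + P''.cls E I := by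
  unfold cls
  rw [dif_pos hP, dif_pos hP', dif_pos hP'']
  have := (QuotientAddGroup.eq_zero_iff _).2 (AddSubgroup.subset_closure
    (GraysonRel.ses ⟨⟨P', hP'.bounded, hP'.acyclic.top, hP'.acyclic.bot⟩, hP'.supported⟩
      ⟨⟨P, hP.bounded, hP.acyclic.top, hP.acyclic.bot⟩, hP.supported⟩
      ⟨⟨P'', hP''.bounded, hP''.acyclic.top, hP''.acyclic.bot⟩, hP''.supported⟩ f g h))
  rw [QuotientAddGroup.mk_sub, QuotientAddGroup.mk_sub, sub_sub, sub_eq_zero] at this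
  exact this

theorem IsBounded.of_isZero {P Q : BinaryComplex C} (h : P.IsBounded)
    (hPQ : ∀ n, IsZero (P.X n) → IsZero (Q.X n)) : Q.IsBounded :=
  let ⟨a, b, hab⟩ := h
  ⟨a, b, fun n hn => hPQ n (hab n hn)⟩

/-- This gives filtered complexes a class when acyclicity is only known on the graded pieces; both
differentials fall under `isAcyclic_of_isSES`. -/
theorem IsAdmissible.of_isSES {P' P P'' : BinaryComplex C} (f : P'.Hom P) (g : P.Hom P'')
    (h : ∀ n, E.IsSES (f.f n) (g.f n)) (hP' : P'.IsAdmissible E I)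
    (hP'' : P''.IsAdmissible E I) : P.IsAdmissible E I := by
  obtain ⟨a, b, hab⟩ := hP'.bounded
  obtain ⟨a', b', hab'⟩ := hP''.bounded
  have hs : P.SupportedOn (Set.Icc (min a a') (max b b')) := fun n hn =>
    (h n).isZero_middle (hab n fun hn' => hn ⟨(min_le_left _ _).trans hn'.1,
      hn'.2.trans (le_max_left _ _)⟩) (hab' n fun hn' => hn ⟨(min_le_right _ _).trans hn'.1,
      hn'.2.trans (le_max_right _ _)⟩)
  have hz : ∀ n < min a a', IsZero (P.X n) := fun n hn => hs n fun h => absurd h.1 (not_le.2 hn)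
  refine ⟨⟨_, _, hs⟩, ⟨?_, ?_⟩, fun n hn =>
    (h n).isZero_middle (hP'.supported n hn) (hP''.supported n hn)⟩
  · exact ExactStructure.isAcyclic_of_isSES (A := P'.top) (B := P.top) (D := P''.top)
      ⟨f.f, fun i j _ => f.comm i j⟩ ⟨g.f, fun i j _ => g.comm i j⟩ h hP'.acyclic.top
      hP''.acyclic.top hz
  · exact ExactStructure.isAcyclic_of_isSES (A := P'.bot) (B := P.bot) (D := P''.bot)
      ⟨f.f, fun i j _ => f.comm' i j⟩ ⟨g.f, fun i j _ => g.comm' i j⟩ h hP'.acyclic.bot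
      hP''.acyclic.bot hz

theorem IsAdmissible.of_isIso {P Q : BinaryComplex C} (f : P.Hom Q) (hf : ∀ n, IsIso (f.f n))
    (h : P.IsAdmissible E I) : Q.IsAdmissible E I where
  bounded := h.bounded.of_isZero fun n hn => hn.of_iso (asIso (f.f n)).symm
  acyclic := ⟨h.acyclic.top.of_iso (B := Q.top) (fun n => @asIso _ _ _ _ (f.f n) (hf n)) f.comm,
    h.acyclic.bot.of_iso (B := Q.bot) (fun n => @asIso _ _ _ _ (f.f n) (hf n)) f.comm'⟩
  supported := fun n hn => (h.supported n hn).of_iso (asIso (f.f n)).symm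

theorem isAdmissible_of_isZero [HasZeroObject C] {P : BinaryComplex C}
    (h : ∀ n, IsZero (P.X n)) : P.IsAdmissible E I :=
  ⟨⟨0, 0, fun n _ => h n⟩, isAcyclic_of_isZero h, fun n _ => h n⟩

theorem cls_eq_zero_of_isZero [HasZeroObject C] {P : BinaryComplex C}
    (h : ∀ n, IsZero (P.X n)) : P.cls E I = 0 :=
  cls_eq_zero_of_isDiag fun i _ => (h i).eq_of_src _ _

theorem cls_eq_of_isIso [HasZeroObject C] {P Q : BinaryComplex C} (f : P.Hom Q)
    (hf : ∀ n, IsIso (f.f n)) (h : P.IsAdmissible E I) : P.cls E I = Q.cls E I := by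
  have hz : (zero C).IsAdmissible E I := isAdmissible_of_isZero fun _ => isZero_zero C
  have := cls_eq_add (E := E) (I := I) (P' := zero C)
    ⟨fun n => 0, fun i j => by simp, fun i j => by simp⟩ f
    (fun n => ExactStructure.isSES_zero_iso (isZero_zero C) _ _) hz h (h.of_isIso f hf)
  rw [this, cls_eq_zero_of_isZero fun _ => isZero_zero C, zero_add]

/-- The shift by one degree, with the opposite differentials. -/
def shift (P : BinaryComplex C) : BinaryComplex C where
  X := fun n => P.X (n - 1)
  d := fun i j => - P.d (i - 1) (j - 1)
  d' := fun i j => - P.d' (i - 1) (j - 1)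
  shape := fun i j h => neg_eq_zero.2 (P.shape _ _ fun h' => h (by
    change j - 1 + 1 = i - 1 at h'; change j + 1 = i; omega))
  shape' := fun i j h => neg_eq_zero.2 (P.shape' _ _ fun h' => h (by
    change j - 1 + 1 = i - 1 at h'; change j + 1 = i; omega))
  d_comp_d := fun i j k => by simp [P.d_comp_d]
  d'_comp_d' := fun i j k => by simp [P.d'_comp_d']

theorem IsAdmissible.shift {P : BinaryComplex C} (h : P.IsAdmissible E I)
    (hI : ∀ n ∈ I, n + 1 ∈ I) : P.shift.IsAdmissible E I where
  bounded := by
    obtain ⟨a, b, hab⟩ := h.bounded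
    exact ⟨a + 1, b + 1, fun n hn => hab _ fun h' => hn ⟨by linarith [h'.1], by linarith [h'.2]⟩⟩
  acyclic := by
    obtain ⟨⟨J, m, e, hme, hd⟩, J', m', e', hme', hd'⟩ := h.acyclic
    -- The sign of the shifted differential is put on the epimorphisms; the automorphism `-𝟙` of the
    -- quotient keeps the sequences exact.
    refine ⟨⟨fun n => J (n - 1), fun n => m (n - 1), fun n => - e (n - 1), fun n => ?_,
      fun n => ?_⟩, ⟨fun n => J' (n - 1), fun n => m' (n - 1), fun n => - e' (n - 1), fun n => ?_,
      fun n => ?_⟩⟩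
    · exact (hme (n - 1)).of_iso (Iso.refl _) (Iso.refl _)
        ⟨- 𝟙 _, - 𝟙 _, by simp, by simp⟩ ((Category.comp_id _).trans (Category.id_comp _).symm)
          (by rw [Iso.refl_hom, Preadditive.comp_neg, Category.comp_id]
              exact (Category.id_comp _).symm)
    · exact (congrArg Neg.neg (hd (n - 1))).trans (Preadditive.neg_comp _ _).symm
    · exact (hme' (n - 1)).of_iso (Iso.refl _) (Iso.refl _)
        ⟨- 𝟙 _, - 𝟙 _, by simp, by simp⟩ ((Category.comp_id _).trans (Category.id_comp _).symm)
          (by rw [Iso.refl_hom, Preadditive.comp_neg, Category.comp_id]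
              exact (Category.id_comp _).symm)
    · exact (congrArg Neg.neg (hd' (n - 1))).trans (Preadditive.neg_comp _ _).symm
  supported := fun n hn => h.supported _ fun h' => hn (by simpa using hI _ h')

end BinaryComplex

section Graded

variable {C : Type u} [Category.{v} C] [Preadditive C]

/-- A map of graded objects as a matrix. -/
def gradedMap {X Y : ℤ → C} (f : ∀ n, X n ⟶ Y n) (i j : ℤ) : X i ⟶ Y j :=
  if h : i = j then f i ≫ eqToHom (congrArg Y h) else 0

@[simp]
theorem gradedMap_self {X Y : ℤ → C} (f : ∀ n, X n ⟶ Y n) (i : ℤ) : gradedMap f i i = f i := by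
  simp [gradedMap]

theorem gradedMap_of_ne {X Y : ℤ → C} (f : ∀ n, X n ⟶ Y n) {i j : ℤ} (h : i ≠ j) :
    gradedMap f i j = 0 := dif_neg h

theorem gradedMap_comp {X Y Z : ℤ → C} (f : ∀ n, X n ⟶ Y n) (g : ∀ n, Y n ⟶ Z n) (i j k : ℤ)
    (h : i = j) : gradedMap f i j ≫ gradedMap g j k = gradedMap (fun n => f n ≫ g n) i k := by
  subst h
  by_cases h : i = k
  · subst h; simp
  · simp [gradedMap_of_ne, h]

theorem gradedMap_comp_eq_zero {X Y Z : ℤ → C} {f : ∀ n, X n ⟶ Y n} {g : ∀ n, Y n ⟶ Z n}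
    (h : ∀ n, f n ≫ g n = 0) (i j k : ℤ) : gradedMap f i j ≫ gradedMap g j k = 0 := by
  by_cases hi : i = j
  · rw [gradedMap_comp _ _ _ _ _ hi, funext h]
    simp [gradedMap]
  · rw [gradedMap_of_ne _ hi, zero_comp]

theorem gradedMap_natural {X Y X' Y' : ℤ → C} {f : ∀ n, X n ⟶ Y n} {f' : ∀ n, X' n ⟶ Y' n}
    {a : ∀ n, X n ⟶ X' n} {b : ∀ n, Y n ⟶ Y' n} (h : ∀ n, a n ≫ f' n = f n ≫ b n) (i j : ℤ) :
    a i ≫ gradedMap f' i j = gradedMap f i j ≫ b j := by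
  by_cases hi : i = j
  · subst hi; simp [h]
  · rw [gradedMap_of_ne _ hi, gradedMap_of_ne _ hi, zero_comp, comp_zero]

/-- Both sides vanish unless `i = j + 1` and `k = j`, where the claim is `h`. Leaving `l` free
absorbs index identities such as `j - 1 + 1 = j`. -/
theorem comp_gradedMap_eq {X Y : ℤ → C} {d : ∀ i j, X i ⟶ X j} {d' : ∀ i j, Y i ⟶ Y j}
    (hd : ∀ i j, ¬ (j + 1 = i) → d i j = 0) (hd' : ∀ i j, ¬ (j + 1 = i) → d' i j = 0)
    {f : ∀ n, X n ⟶ Y n} (h : ∀ i j, f i ≫ d' i j = d i j ≫ f j) {i j k l : ℤ} (hl : l = j + 1) :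
    d i j ≫ gradedMap f j k = gradedMap f i l ≫ d' l k := by
  subst hl
  by_cases hk : j = k
  · subst hk
    by_cases hi : j + 1 = i
    · subst hi; simp [h]
    · rw [hd _ _ hi, gradedMap_of_ne _ (Ne.symm hi), zero_comp, zero_comp]
  · rw [gradedMap_of_ne _ hk, hd' (j + 1) k (by omega), comp_zero, comp_zero]

end Graded

end

/-! ### Iterated cones: the total complex of a triple -/

section

section TwistMap

variable {C : Type u} [Category.{v} C] [Preadditive C] [HasBinaryBiproducts C]

/-- A lower triangular matrix. -/
noncomputable def twistMap {X Y X' Y' : C} (a : X ⟶ X') (b : Y ⟶ Y') (c : X ⟶ Y') :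
    X ⊞ Y ⟶ X' ⊞ Y' := biprod.map a b + biprod.fst ≫ c ≫ biprod.inr

theorem twistMap_comp {X Y X' Y' X'' Y'' : C} (a : X ⟶ X') (b : Y ⟶ Y') (c : X ⟶ Y')
    (a' : X' ⟶ X'') (b' : Y' ⟶ Y'') (c' : X' ⟶ Y'') :
    twistMap a b c ≫ twistMap a' b' c' = twistMap (a ≫ a') (b ≫ b') (a ≫ c' + c ≫ b') := by
  ext <;> simp [twistMap, add_comm]

theorem twistMap_zero {X Y X' Y' : C} :
    twistMap (0 : X ⟶ X') (0 : Y ⟶ Y') 0 = 0 := by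
  ext <;> simp [twistMap]

theorem biprod_map_eq_twistMap {X Y X' Y' : C} (a : X ⟶ X') (b : Y ⟶ Y') :
    biprod.map a b = twistMap a b 0 := by simp [twistMap]

theorem inr_twistMap {X Y X' Y' : C} (a : X ⟶ X') (b : Y ⟶ Y') (c : X ⟶ Y') :
    biprod.inr ≫ twistMap a b c = b ≫ biprod.inr := by simp [twistMap]

theorem inl_twistMap {X Y X' Y' : C} (a : X ⟶ X') (b : Y ⟶ Y') (c : X ⟶ Y') :
    biprod.inl ≫ twistMap a b c = a ≫ biprod.inl + c ≫ biprod.inr := by simp [twistMap]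

theorem twistMap_fst {X Y X' Y' : C} (a : X ⟶ X') (b : Y ⟶ Y') (c : X ⟶ Y') :
    twistMap a b c ≫ biprod.fst = biprod.fst ≫ a := by simp [twistMap]

end TwistMap

variable {C : Type u} [Category.{v} C] [Preadditive C]

/-- The datum of an extension of binary complexes that splits in each degree. -/
structure Twist (P Q : BinaryComplex C) where
  φ : ∀ i j, P.X i ⟶ Q.X j
  φ' : ∀ i j, P.X i ⟶ Q.X j
  shape : ∀ i j, ¬ (j + 1 = i) → φ i j = 0
  shape' : ∀ i j, ¬ (j + 1 = i) → φ' i j = 0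
  comm : ∀ i j k, P.d i j ≫ φ j k + φ i j ≫ Q.d j k = 0
  comm' : ∀ i j k, P.d' i j ≫ φ' j k + φ' i j ≫ Q.d' j k = 0

namespace Twist

variable [HasBinaryBiproducts C] {P Q P' Q' P'' Q'' : BinaryComplex C}

/-- The extension of binary complexes given by a twist. -/
noncomputable def total (T : Twist P Q) : BinaryComplex C where
  X := fun n => P.X n ⊞ Q.X n
  d := fun i j => twistMap (P.d i j) (Q.d i j) (T.φ i j)
  d' := fun i j => twistMap (P.d' i j) (Q.d' i j) (T.φ' i j)
  shape := fun i j h => by rw [P.shape i j h, Q.shape i j h, T.shape i j h, twistMap_zero]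
  shape' := fun i j h => by rw [P.shape' i j h, Q.shape' i j h, T.shape' i j h, twistMap_zero]
  d_comp_d := fun i j k => by
    rw [twistMap_comp, P.d_comp_d, Q.d_comp_d, T.comm, twistMap_zero]
  d'_comp_d' := fun i j k => by
    rw [twistMap_comp, P.d'_comp_d', Q.d'_comp_d', T.comm', twistMap_zero]

/-- The subcomplex. -/
noncomputable def inr (T : Twist P Q) : Q.Hom T.total where
  f := fun n => (biprod.inr : Q.X n ⟶ P.X n ⊞ Q.X n)
  comm := fun _ _ => inr_twistMap _ _ _
  comm' := fun _ _ => inr_twistMap _ _ _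

/-- The quotient complex. -/
noncomputable def fst (T : Twist P Q) : T.total.Hom P where
  f := fun n => (biprod.fst : P.X n ⊞ Q.X n ⟶ P.X n)
  comm := fun _ _ => (twistMap_fst _ _ _).symm
  comm' := fun _ _ => (twistMap_fst _ _ _).symm

/-- Functoriality of the extension. -/
noncomputable def map (T : Twist P Q) (T' : Twist P' Q') (α : P.Hom P') (β : Q.Hom Q')
    (h : ∀ i j, α.f i ≫ T'.φ i j = T.φ i j ≫ β.f j)
    (h' : ∀ i j, α.f i ≫ T'.φ' i j = T.φ' i j ≫ β.f j) : T.total.Hom T'.total where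
  f := fun n => biprod.map (α.f n) (β.f n)
  comm := fun i j => by
    change biprod.map _ _ ≫ twistMap _ _ _ = twistMap _ _ _ ≫ biprod.map _ _
    rw [biprod_map_eq_twistMap, biprod_map_eq_twistMap, twistMap_comp, twistMap_comp, α.comm,
      β.comm, h, zero_comp, comp_zero, add_zero, zero_add]
  comm' := fun i j => by
    change biprod.map _ _ ≫ twistMap _ _ _ = twistMap _ _ _ ≫ biprod.map _ _
    rw [biprod_map_eq_twistMap, biprod_map_eq_twistMap, twistMap_comp, twistMap_comp, α.comm',
      β.comm', h', zero_comp, comp_zero, add_zero, zero_add]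

variable [HasZeroObject C] {E : ExactStructure C} {I : Set ℤ}

theorem isAdmissible (T : Twist P Q) (hP : P.IsAdmissible E I) (hQ : Q.IsAdmissible E I) :
    T.total.IsAdmissible E I :=
  hQ.of_isSES T.inr T.fst (fun _ => E.isSES_inr_fst _ _) hP

theorem cls_total (T : Twist P Q) (hP : P.IsAdmissible E I) (hQ : Q.IsAdmissible E I) :
    T.total.cls E I = Q.cls E I + P.cls E I :=
  BinaryComplex.cls_eq_add T.inr T.fst (fun _ => E.isSES_inr_fst _ _) hQ (T.isAdmissible hP hQ) hP

end Twist

/-- A morphism of binary complexes, shifted. -/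
def BinaryComplex.Hom.shift {P Q : BinaryComplex C} (a : P.Hom Q) : P.shift.Hom Q.shift where
  f := fun n => a.f (n - 1)
  comm := fun i j => (Preadditive.comp_neg _ _).trans
    ((congrArg Neg.neg (a.comm (i - 1) (j - 1))).trans (Preadditive.neg_comp _ _).symm)
  comm' := fun i j => (Preadditive.comp_neg _ _).trans
    ((congrArg Neg.neg (a.comm' (i - 1) (j - 1))).trans (Preadditive.neg_comp _ _).symm)

namespace Triple

variable {E : ExactStructure C}

/-- The second map of a triple as a twist. -/
def twist₀ (t : Triple E) : Twist (t.R 1).shift (t.R 0) where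
  φ := fun i j => gradedMap t.g (i - 1) j
  φ' := fun i j => gradedMap t.g' (i - 1) j
  shape := fun i j h => gradedMap_of_ne _ fun h' => h (by omega)
  shape' := fun i j h => gradedMap_of_ne _ fun h' => h (by omega)
  comm := fun i j k => by
    -- The sign in the shift turns commutation of `g` with the differentials into the
    -- anticommutation demanded of a twist.
    change (- (t.R 1).d (i - 1) (j - 1)) ≫ gradedMap t.g (j - 1) k + _ = 0
    rw [Preadditive.neg_comp, comp_gradedMap_eq (t.R 1).shape (t.R 0).shape t.g_comm
      (l := j) (by omega)]
    exact neg_add_cancel _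
  comm' := fun i j k => by
    change (- (t.R 1).d' (i - 1) (j - 1)) ≫ gradedMap t.g' (j - 1) k + _ = 0
    rw [Preadditive.neg_comp, comp_gradedMap_eq (t.R 1).shape' (t.R 0).shape' t.g_comm'
      (l := j) (by omega)]
    exact neg_add_cancel _

variable [HasBinaryBiproducts C]

/-- The first map of a triple as a twist into the cone of the second map. -/
noncomputable def twist₁ (t : Triple E) : Twist (t.R 2).shift.shift t.twist₀.total where
  φ := fun i j => gradedMap t.f (i - 1 - 1) (j - 1) ≫ biprod.inl
  φ' := fun i j => gradedMap t.f' (i - 1 - 1) (j - 1) ≫ biprod.inl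
  shape := fun i j h => by rw [gradedMap_of_ne _ fun h' => h (by omega)]; exact zero_comp
  shape' := fun i j h => by rw [gradedMap_of_ne _ fun h' => h (by omega)]; exact zero_comp
  comm := fun i j k => by
    -- Two shifts leave no sign on `R 2`. The component in `R 1` cancels because `f` is a chain map,
    -- and the component in `R 0` is `f ≫ g = 0`.
    change (- - (t.R 2).d (i - 1 - 1) (j - 1 - 1)) ≫ gradedMap t.f (j - 1 - 1) (k - 1) ≫
      biprod.inl + (gradedMap t.f (i - 1 - 1) (j - 1) ≫ biprod.inl) ≫
        twistMap (- (t.R 1).d (j - 1) (k - 1)) ((t.R 0).d j k) (gradedMap t.g (j - 1) k) = 0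
    rw [Category.assoc, inl_twistMap, neg_neg, Preadditive.comp_add, ← Category.assoc,
      ← Category.assoc, ← Category.assoc, comp_gradedMap_eq (t.R 2).shape (t.R 1).shape t.f_comm
      (l := j - 1) (by omega), gradedMap_comp_eq_zero (fun n => (t.exact n).1),
      Preadditive.comp_neg, Preadditive.neg_comp, zero_comp, add_zero]
    exact add_neg_cancel _
  comm' := fun i j k => by
    change (- - (t.R 2).d' (i - 1 - 1) (j - 1 - 1)) ≫ gradedMap t.f' (j - 1 - 1) (k - 1) ≫
      biprod.inl + (gradedMap t.f' (i - 1 - 1) (j - 1) ≫ biprod.inl) ≫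
        twistMap (- (t.R 1).d' (j - 1) (k - 1)) ((t.R 0).d' j k) (gradedMap t.g' (j - 1) k) = 0
    rw [Category.assoc, inl_twistMap, neg_neg, Preadditive.comp_add, ← Category.assoc,
      ← Category.assoc, ← Category.assoc, comp_gradedMap_eq (t.R 2).shape' (t.R 1).shape' t.f_comm'
      (l := j - 1) (by omega), gradedMap_comp_eq_zero (fun n => (t.exact' n).1),
      Preadditive.comp_neg, Preadditive.neg_comp, zero_comp, add_zero]
    exact add_neg_cancel _

/-- The total complex of a triple. -/
noncomputable def tot (t : Triple E) : BinaryComplex C := t.twist₁.total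

/-- A morphism of triples. -/
structure Hom (t s : Triple E) where
  a : ∀ l, (t.R l).Hom (s.R l)
  f : ∀ n, (a 2).f n ≫ s.f n = t.f n ≫ (a 1).f n
  g : ∀ n, (a 1).f n ≫ s.g n = t.g n ≫ (a 0).f n
  f' : ∀ n, (a 2).f n ≫ s.f' n = t.f' n ≫ (a 1).f n
  g' : ∀ n, (a 1).f n ≫ s.g' n = t.g' n ≫ (a 0).f n

/-- Functoriality of the total complex. -/
noncomputable def Hom.tot {t s : Triple E} (a : t.Hom s) : t.tot.Hom s.tot :=
  t.twist₁.map s.twist₁ (a.a 2).shift.shift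
    (t.twist₀.map s.twist₀ (a.a 1).shift (a.a 0)
      (fun i j => gradedMap_natural a.g (i - 1) j)
      (fun i j => gradedMap_natural a.g' (i - 1) j))
    (fun i j => by
      change (a.a 2).f (i - 1 - 1) ≫ gradedMap s.f (i - 1 - 1) (j - 1) ≫ biprod.inl =
        (gradedMap t.f (i - 1 - 1) (j - 1) ≫ biprod.inl) ≫
          biprod.map ((a.a 1).f (j - 1)) ((a.a 0).f j)
      rw [Category.assoc, biprod.inl_map, ← Category.assoc, ← Category.assoc,
        gradedMap_natural a.f])
    (fun i j => by
      change (a.a 2).f (i - 1 - 1) ≫ gradedMap s.f' (i - 1 - 1) (j - 1) ≫ biprod.inl =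
        (gradedMap t.f' (i - 1 - 1) (j - 1) ≫ biprod.inl) ≫
          biprod.map ((a.a 1).f (j - 1)) ((a.a 0).f j)
      rw [Category.assoc, biprod.inl_map, ← Category.assoc, ← Category.assoc,
        gradedMap_natural a.f'])

variable [HasZeroObject C] {I : Set ℤ}

theorem Hom.tot_isSES {r t s : Triple E} (a : r.Hom t) (b : t.Hom s)
    (h : ∀ l n, E.IsSES ((a.a l).f n) ((b.a l).f n)) (n : ℤ) :
    E.IsSES (a.tot.f n) (b.tot.f n) :=
  (h 2 (n - 1 - 1)).biprod ((h 1 (n - 1)).biprod (h 0 n))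

/-- This is the filtration by rows: each of the two cones is an extension of its ends. -/
theorem cls_tot (t : Triple E) (hI : ∀ n ∈ I, n + 1 ∈ I)
    (h : ∀ l, (t.R l).IsAdmissible E I) : t.tot.cls E I =
      (t.R 0).cls E I + (t.R 1).shift.cls E I + (t.R 2).shift.shift.cls E I :=
  (t.twist₁.cls_total (((h 2).shift hI).shift hI)
    (t.twist₀.isAdmissible ((h 1).shift hI) (h 0))).trans
    (congrArg (· + _) (t.twist₀.cls_total ((h 1).shift hI) (h 0)))

end Triple

end

/-! ### The filtration of the total complex by degrees of the rows -/

section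

section Cut

variable {C : Type u} [Category.{v} C] [Preadditive C] [HasZeroObject C]

/-- Either the given object or zero. -/
noncomputable def cutObj : Bool → C → C
  | true, X => X
  | false, _ => 0

/-- Either the given morphism or zero. -/
noncomputable def cutHom : ∀ (b c : Bool) {X Y : C} (_ : X ⟶ Y), cutObj b X ⟶ cutObj c Y
  | true, true, _, _, f => f
  | true, false, _, _, _ => 0
  | false, _, _, _, _ => 0

theorem isZero_cutObj {X : C} (h : IsZero X) : ∀ b, IsZero (cutObj b X)
  | true => h
  | false => isZero_zero C

theorem cutHom_zero {X Y : C} : ∀ b c, cutHom b c (0 : X ⟶ Y) = 0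
  | true, true => rfl
  | true, false => rfl
  | false, _ => rfl

theorem cutHom_false_left {X Y : C} (f : X ⟶ Y) (c : Bool) : cutHom false c f = 0 := rfl

theorem cutHom_false_right {X Y : C} (f : X ⟶ Y) (b : Bool) : cutHom b false f = 0 := by
  cases b <;> rfl

theorem cutHom_eq_zero_left {X Y : C} (f : X ⟶ Y) {b : Bool} (c : Bool) (h : b = false) :
    cutHom b c f = 0 := by
  subst h; rfl

theorem cutHom_eq_zero_right {X Y : C} (f : X ⟶ Y) (b : Bool) {c : Bool} (h : c = false) :
    cutHom b c f = 0 := by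
  subst h; exact cutHom_false_right f b

theorem cutHom_comp_true {X Y Z : C} (f : X ⟶ Y) (g : Y ⟶ Z) (b c : Bool) :
    cutHom b true f ≫ cutHom true c g = cutHom b c (f ≫ g) := by
  cases b <;> cases c
  · exact zero_comp
  · exact zero_comp
  · exact comp_zero
  · rfl

theorem cutHom_comp_false {X Y Z : C} (f : X ⟶ Y) (g : Y ⟶ Z) (b c : Bool) :
    cutHom b false f ≫ cutHom false c g = 0 := by
  rw [cutHom_false_left, comp_zero]

theorem cutHom_comp_eq_zero {X Y Z : C} {f : X ⟶ Y} {g : Y ⟶ Z} (h : f ≫ g = 0) (a b c : Bool) :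
    cutHom a b f ≫ cutHom b c g = 0 := by
  cases b
  · exact cutHom_comp_false _ _ _ _
  · rw [cutHom_comp_true, h, cutHom_zero]

/-- When an end is cut away both sides vanish. Only when both ends are kept must the two middle
terms be kept or cut together, hence the form of `hb`. -/
theorem cutHom_comp_eq {X Y Z Y' : C} {f : X ⟶ Y} {g : Y ⟶ Z} {f' : X ⟶ Y'} {g' : Y' ⟶ Z}
    (h : f ≫ g = f' ≫ g') {a b b' c : Bool} (hb : a = true → c = true → b = b') :
    cutHom a b f ≫ cutHom b c g = cutHom a b' f' ≫ cutHom b' c g' := by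
  cases a
  · rw [cutHom_false_left, cutHom_false_left, zero_comp, zero_comp]
  cases c
  · rw [cutHom_false_right, cutHom_false_right, comp_zero, comp_zero]
  obtain rfl := hb rfl rfl
  cases b
  · rw [cutHom_comp_false, cutHom_comp_false]
  · rw [cutHom_comp_true, cutHom_comp_true, h]

theorem cutHom_isSES {E : ExactStructure C} {X Y Z : C} {f : X ⟶ Y} {g : Y ⟶ Z}
    (h : E.IsSES f g) : ∀ b, E.IsSES (cutHom b b f) (cutHom b b g)
  | true => h
  | false => ExactStructure.isSES_of_isZero (isZero_zero C) (isZero_zero C) (isZero_zero C) _ _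

theorem cutHom_id_isSES (E : ExactStructure C) (X : C) {a b c : Bool} (hb : b = (a || c))
    (hac : (a && c) = false) : E.IsSES (cutHom a b (𝟙 X)) (cutHom b c (𝟙 X)) := by
  subst hb
  cases a <;> cases c
  · exact ExactStructure.isSES_of_isZero (isZero_zero C) (isZero_zero C) (isZero_zero C) _ _
  · exact E.isSES_zero_id (isZero_zero C) _
  · exact E.isSES_id_zero (isZero_zero C) _
  · exact absurd hac (by simp)

/-- The part of a binary complex in the degrees selected by `p`. -/
noncomputable def BinaryComplex.cut (p : ℤ → Bool) (P : BinaryComplex C) : BinaryComplex C where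
  X := fun n => cutObj (p n) (P.X n)
  d := fun i j => cutHom (p i) (p j) (P.d i j)
  d' := fun i j => cutHom (p i) (p j) (P.d' i j)
  shape := fun i j h => by rw [P.shape i j h, cutHom_zero]
  shape' := fun i j h => by rw [P.shape' i j h, cutHom_zero]
  d_comp_d := fun i j k => cutHom_comp_eq_zero (P.d_comp_d i j k) _ _ _
  d'_comp_d' := fun i j k => cutHom_comp_eq_zero (P.d'_comp_d' i j k) _ _ _

/-- The natural map between two parts of a binary complex. -/
noncomputable def BinaryComplex.cutTrans (P : BinaryComplex C) {p q : ℤ → Bool}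
    (h : ∀ n, p (n + 1) = true → q n = true → q (n + 1) = p n) : (P.cut p).Hom (P.cut q) where
  f := fun n => cutHom (p n) (q n) (𝟙 (P.X n))
  comm := fun i j => by
    change cutHom _ _ _ ≫ cutHom _ _ _ = cutHom _ _ _ ≫ cutHom _ _ _
    by_cases hij : j + 1 = i
    · subst hij
      -- The two paths from degree `j + 1` of the source to degree `j` of the target pass through `q
      -- (j + 1)` and `p j`, which `h j` forces to agree.
      exact cutHom_comp_eq ((Category.id_comp _).trans (Category.comp_id _).symm) (h j)
    · rw [P.shape i j hij, cutHom_zero, cutHom_zero, zero_comp, comp_zero]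
  comm' := fun i j => by
    change cutHom _ _ _ ≫ cutHom _ _ _ = cutHom _ _ _ ≫ cutHom _ _ _
    by_cases hij : j + 1 = i
    · subst hij
      exact cutHom_comp_eq ((Category.id_comp _).trans (Category.comp_id _).symm) (h j)
    · rw [P.shape' i j hij, cutHom_zero, cutHom_zero, zero_comp, comp_zero]

end Cut

namespace Triple

variable {C : Type u} [Category.{v} C] [Preadditive C] [HasZeroObject C] {E : ExactStructure C}
  {I : Set ℤ}

/-- The part of a triple in the degrees selected by `p`. -/
noncomputable def cut (t : Triple E) (p : ℤ → Bool) : Triple E where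
  R := fun l => (t.R l).cut p
  f := fun n => cutHom (p n) (p n) (t.f n)
  g := fun n => cutHom (p n) (p n) (t.g n)
  f' := fun n => cutHom (p n) (p n) (t.f' n)
  g' := fun n => cutHom (p n) (p n) (t.g' n)
  f_comm := fun i j => cutHom_comp_eq (t.f_comm i j) fun h h' => h.trans h'.symm
  g_comm := fun i j => cutHom_comp_eq (t.g_comm i j) fun h h' => h.trans h'.symm
  f_comm' := fun i j => cutHom_comp_eq (t.f_comm' i j) fun h h' => h.trans h'.symm
  g_comm' := fun i j => cutHom_comp_eq (t.g_comm' i j) fun h h' => h.trans h'.symm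
  exact := fun n => cutHom_isSES (t.exact n) _
  exact' := fun n => cutHom_isSES (t.exact' n) _

/-- The natural map between two parts of a triple. -/
noncomputable def cutTrans (t : Triple E) {p q : ℤ → Bool}
    (h : ∀ n, p (n + 1) = true → q n = true → q (n + 1) = p n) : (t.cut p).Hom (t.cut q) where
  a := fun l => (t.R l).cutTrans h
  f := fun _ => cutHom_comp_eq ((Category.id_comp _).trans (Category.comp_id _).symm)
    fun hp hq => hq.trans hp.symm
  g := fun _ => cutHom_comp_eq ((Category.id_comp _).trans (Category.comp_id _).symm)
    fun hp hq => hq.trans hp.symm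
  f' := fun _ => cutHom_comp_eq ((Category.id_comp _).trans (Category.comp_id _).symm)
    fun hp hq => hq.trans hp.symm
  g' := fun _ => cutHom_comp_eq ((Category.id_comp _).trans (Category.comp_id _).symm)
    fun hp hq => hq.trans hp.symm

variable [HasBinaryBiproducts C]

theorem tot_isZero (t : Triple E) {n : ℤ} (h2 : IsZero ((t.R 2).X (n - 1 - 1)))
    (h1 : IsZero ((t.R 1).X (n - 1))) (h0 : IsZero ((t.R 0).X n)) : IsZero (t.tot.X n) :=
  (biprod_isZero_iff _ _).2 ⟨h2, (biprod_isZero_iff _ _).2 ⟨h1, h0⟩⟩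

theorem tot_supportedOn (t : Triple E) (hI : ∀ n ∈ I, n + 1 ∈ I)
    (h : ∀ l, (t.R l).SupportedOn I) : t.tot.SupportedOn I := fun n hn => by
  have h1 : n - 1 ∉ I := fun h' => hn (by simpa using hI _ h')
  have h2 : n - 1 - 1 ∉ I := fun h' => h1 (by simpa using hI _ h')
  exact t.tot_isZero (h 2 _ h2) (h 1 _ h1) (h 0 _ hn)

theorem tot_isBounded (t : Triple E) (h : ∀ l, (t.R l).IsBounded) : t.tot.IsBounded := by
  obtain ⟨a0, b0, h0⟩ := h 0
  obtain ⟨a1, b1, h1⟩ := h 1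
  obtain ⟨a2, b2, h2⟩ := h 2
  refine ⟨min a0 (min a1 a2), max b0 (max b1 b2) + 2, fun n hn => ?_⟩
  have hn' : n < min a0 (min a1 a2) ∨ max b0 (max b1 b2) + 2 < n := by
    by_contra h
    exact hn ⟨by omega, by omega⟩
  exact t.tot_isZero (h2 _ fun h => by have := h.1; have := h.2; omega)
    (h1 _ fun h => by have := h.1; have := h.2; omega)
    (h0 _ fun h => by have := h.1; have := h.2; omega)

theorem tot_isDiag (t : Triple E) (h : ∀ l, (t.R l).IsDiag) (hf : ∀ n, t.f n = t.f' n)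
    (hg : ∀ n, t.g n = t.g' n) : t.tot.IsDiag := fun i j => by
  change twistMap (- - (t.R 2).d _ _) (twistMap (- (t.R 1).d _ _) ((t.R 0).d i j)
      (gradedMap t.g _ _)) (gradedMap t.f _ _ ≫ biprod.inl) =
    twistMap (- - (t.R 2).d' _ _) (twistMap (- (t.R 1).d' _ _) ((t.R 0).d' i j)
      (gradedMap t.g' _ _)) (gradedMap t.f' _ _ ≫ biprod.inl)
  rw [h, h, h, funext hf, funext hg]

omit [HasZeroObject C] in
theorem twistMap_contract {X A B B' Z Z' : C} (f : X ⟶ A) (g : B ⟶ Z') :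
    twistMap (- - (0 : X ⟶ B')) (twistMap (- (0 : B ⟶ A)) (0 : Z ⟶ Z') g) (f ≫ biprod.inl) =
      biprod.map (𝟙 X) (biprod.fst ≫ g) ≫ biprod.map f (𝟙 Z') ≫ biprod.inr := by
  ext <;> simp [twistMap]

/-- This is the direct sum of `0 ⟶ X ⟶ X`, `A ⟶ B ⟶ D` and `Z ⟶ Z ⟶ 0`, with the zero summands
removed. -/
theorem isSES_contract {A B D : C} {f : A ⟶ B}
    {g : B ⟶ D} (h : E.IsSES f g) (X Z : C) :
    E.IsSES (biprod.map f (𝟙 Z) ≫ biprod.inr : A ⊞ Z ⟶ X ⊞ (B ⊞ Z))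
      (biprod.map (𝟙 X) (biprod.fst ≫ g) : X ⊞ (B ⊞ Z) ⟶ X ⊞ D) := by
  have h0 : IsZero (0 : C) := isZero_zero C
  have H := (E.isSES_zero_id h0 (0 : 0 ⟶ X)).biprod
    (h.biprod (E.isSES_id_zero h0 (0 : Z ⟶ 0)))
  refine H.of_iso ⟨biprod.snd, biprod.inr, ?_, by simp⟩ (Iso.refl _)
    ⟨biprod.map (𝟙 _) biprod.fst, biprod.map (𝟙 _) biprod.inl, ?_, by ext <;> simp⟩ ?_ ?_
  · apply biprod.hom_ext'
    · exact h0.eq_of_src _ _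
    · simp
  · apply biprod.hom_ext'
    · simp
    · apply biprod.hom_ext'
      · simp
      · exact h0.eq_of_src _ _
  · ext <;> simp
  · ext <;> simp

/-- Without differentials in the rows, the total complex is the direct sum of the shifted columns,
which are exact. Its cycles in degree `i` are the image of `f` inside `R 1` and all of `R 0`. -/
theorem tot_top_isAcyclic (t : Triple E) (h : ∀ l i j, (t.R l).d i j = 0) :
    E.IsAcyclic t.tot.top := by
  refine ⟨fun i => (t.R 2).X (i - 1) ⊞ (t.R 0).X i,
    fun i => biprod.map (t.f (i - 1)) (𝟙 _) ≫ biprod.inr,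
    fun i => biprod.map (𝟙 _) (biprod.fst ≫ t.g (i - 1)),
    fun i => isSES_contract (t.exact (i - 1)) _ _, fun i => ?_⟩
  change twistMap (- - (t.R 2).d _ _) (twistMap (- (t.R 1).d _ _) ((t.R 0).d i (i - 1))
    (gradedMap t.g _ _)) (gradedMap t.f _ _ ≫ biprod.inl) = _
  rw [h, h, h, gradedMap_self, gradedMap_self]
  exact twistMap_contract _ _

theorem tot_isAcyclic (t : Triple E) (h : ∀ l i j, (t.R l).d i j = 0)
    (h' : ∀ l i j, (t.R l).d' i j = 0) : t.tot.IsAcyclic E :=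
  ⟨t.tot_top_isAcyclic h, t.op.tot_top_isAcyclic h'⟩

theorem cut_single_d (t : Triple E) (N : ℤ) (l : Fin 3) (i j : ℤ) :
    ((t.cut fun n => decide (n = N)).R l).d i j = 0 := by
  by_cases hij : j + 1 = i
  · by_cases hi : i = N
    · exact cutHom_eq_zero_right _ _ (decide_eq_false (show ¬ j = N by omega))
    · exact cutHom_eq_zero_left _ _ (decide_eq_false hi)
  · exact (congrArg (cutHom _ _) ((t.R l).shape i j hij)).trans (cutHom_zero _ _)

theorem cut_single_d' (t : Triple E) (N : ℤ) (l : Fin 3) (i j : ℤ) :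
    ((t.cut fun n => decide (n = N)).R l).d' i j = 0 := t.op.cut_single_d N l i j

theorem cut_supportedOn (t : Triple E) (h : ∀ l, (t.R l).SupportedOn I) (p : ℤ → Bool)
    (l : Fin 3) : ((t.cut p).R l).SupportedOn I := fun n hn => isZero_cutObj (h l n hn) _

theorem cut_isBounded (t : Triple E) (h : ∀ l, (t.R l).IsBounded) (p : ℤ → Bool)
    (l : Fin 3) : ((t.cut p).R l).IsBounded :=
  (h l).of_isZero fun _ hn => isZero_cutObj hn _

theorem tot_cut_single_isAdmissible (t : Triple E) (hI : ∀ n ∈ I, n + 1 ∈ I)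
    (hb : ∀ l, (t.R l).IsBounded) (hs : ∀ l, (t.R l).SupportedOn I) (N : ℤ) :
    (t.cut fun n => decide (n = N)).tot.IsAdmissible E I where
  bounded := tot_isBounded _ (t.cut_isBounded hb _)
  acyclic := tot_isAcyclic _ (t.cut_single_d N) (t.cut_single_d' N)
  supported := tot_supportedOn _ hI (t.cut_supportedOn hs _)

theorem tot_cut_isSES (t : Triple E) {p q r : ℤ → Bool}
    (h : ∀ n, p (n + 1) = true → q n = true → q (n + 1) = p n)
    (h' : ∀ n, q (n + 1) = true → r n = true → r (n + 1) = q n)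
    (hq : ∀ n, q n = (p n || r n)) (hpr : ∀ n, (p n && r n) = false) (n : ℤ) :
    E.IsSES ((t.cutTrans h).tot.f n) ((t.cutTrans h').tot.f n) :=
  Hom.tot_isSES _ _ (fun _ n => cutHom_id_isSES E _ (hq n) (hpr n)) n

/-- Differentials lower the degree, so the part below a bound is a subcomplex, and raising the bound
by one adds a single degree as quotient. The cut rows need not be acyclic, but the total complexes
of the single degrees are, and admissibility passes to extensions. -/
theorem tot_cut_lt (t : Triple E) (hI : ∀ n ∈ I, n + 1 ∈ I)
    (hb : ∀ l, (t.R l).IsBounded) (hs : ∀ l, (t.R l).SupportedOn I) {a : ℤ}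
    (ha : ∀ l, ∀ n < a, IsZero ((t.R l).X n)) (k : ℕ) :
    (t.cut fun n => decide (n < a + k)).tot.IsAdmissible E I ∧
      (t.cut fun n => decide (n < a + k)).tot.cls E I =
        ∑ m ∈ Finset.range k, (t.cut fun n => decide (n = a + m)).tot.cls E I := by
  induction k with
  | zero =>
    have hz : ∀ l n, IsZero (((t.cut fun n => decide (n < a + (0 : ℕ))).R l).X n) := fun l n => by
      change IsZero (cutObj (decide (n < a + (0 : ℕ))) _)
      by_cases hn : n < a
      · exact isZero_cutObj (ha l n hn) _
      · rw [decide_eq_false (by simpa using hn)]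
        exact isZero_zero C
    have := fun n => tot_isZero _ (hz 2 (n - 1 - 1)) (hz 1 (n - 1)) (hz 0 n)
    exact ⟨BinaryComplex.isAdmissible_of_isZero this, by
      rw [BinaryComplex.cls_eq_zero_of_isZero this, Finset.range_zero, Finset.sum_empty]⟩
  | succ k ih =>
    have hN := t.tot_cut_single_isAdmissible hI hb hs (a + k)
    have hses := t.tot_cut_isSES (p := fun n => decide (n < a + k))
      (q := fun n => decide (n < a + (k + 1 : ℕ))) (r := fun n => decide (n = a + k))
      (fun n h _ => by grind) (fun n h h' => by grind) (fun n => by grind) (fun n => by grind)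
    have hk := ih.1.of_isSES _ _ hses hN
    exact ⟨hk, by rw [BinaryComplex.cls_eq_add _ _ hses ih.1 hk hN, ih.2,
      Finset.sum_range_succ]⟩

theorem cls_tot_eq_sum (t : Triple E) (hI : ∀ n ∈ I, n + 1 ∈ I)
    (hb : ∀ l, (t.R l).IsBounded) (hs : ∀ l, (t.R l).SupportedOn I) {a : ℤ} {k : ℕ}
    (ha : ∀ l, (t.R l).SupportedOn (Set.Ico a (a + k))) :
    t.tot.cls E I = ∑ m ∈ Finset.range k, (t.cut fun n => decide (n = a + m)).tot.cls E I := by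
  obtain ⟨h, hk⟩ := t.tot_cut_lt hI hb hs (a := a)
    (fun l n hn => ha l n fun h => absurd h.1 (not_le.2 hn)) k
  have hz : ∀ l n, IsZero (((t.cut fun n => decide (a + k ≤ n)).R l).X n) := fun l n => by
    change IsZero (cutObj (decide (a + k ≤ n)) _)
    by_cases hn : a + k ≤ n
    · exact isZero_cutObj (ha l n fun h => absurd h.2 (not_lt.2 hn)) _
    · rw [decide_eq_false hn]
      exact isZero_zero C
  have hz' := fun n => tot_isZero _ (hz 2 (n - 1 - 1)) (hz 1 (n - 1)) (hz 0 n)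
  -- Selecting every degree gives back `t` definitionally, and the quotient by the degrees below `a
  -- + k` is zero.
  have hses := t.tot_cut_isSES (p := fun n => decide (n < a + k))
      (q := fun _ => true) (r := fun n => decide (a + k ≤ n))
      (fun n h _ => by grind) (fun n h h' => by grind) (fun n => by grind) (fun n => by grind)
  have hadm := h.of_isSES _ _ hses (BinaryComplex.isAdmissible_of_isZero hz')
  have := BinaryComplex.cls_eq_add _ _ hses h hadm (BinaryComplex.isAdmissible_of_isZero hz')
  rw [BinaryComplex.cls_eq_zero_of_isZero hz', add_zero, hk] at this
  exact this

end Triple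

/-- The total complex of `0 ⟶ P ⟶ P` is the cone of the identity. By rows its class is that of `P`
plus that of `P.shift`. By degrees it is a sum of classes of diagonal complexes: a single degree
retains no row differentials, and the identity is the same on top and bottom. -/
theorem BinaryComplex.IsAdmissible.cls_shift {C : Type u} [Category.{v} C] [Preadditive C]
    [HasZeroObject C] [HasBinaryBiproducts C] {E : ExactStructure C} {I : Set ℤ}
    {P : BinaryComplex C} (h : P.IsAdmissible E I) (hI : ∀ n ∈ I, n + 1 ∈ I) :
    P.shift.cls E I = - P.cls E I := by
  have h0 : IsZero (0 : C) := isZero_zero C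
  let R : Fin 3 → BinaryComplex C := ![P, P, BinaryComplex.zero C]
  let t : Triple E :=
    { R := R
      f := fun n => h0.to_ (P.X n)
      g := fun n => 𝟙 (P.X n)
      f' := fun n => h0.to_ (P.X n)
      g' := fun n => 𝟙 (P.X n)
      f_comm := fun i j => h0.eq_of_src _ _
      g_comm := fun i j => (Category.id_comp (P.d i j)).trans (Category.comp_id (P.d i j)).symm
      f_comm' := fun i j => h0.eq_of_src _ _
      g_comm' := fun i j => (Category.id_comp (P.d' i j)).trans (Category.comp_id (P.d' i j)).symm
      exact := fun n => E.isSES_zero_id h0 _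
      exact' := fun n => E.isSES_zero_id h0 _ }
  have hadm : ∀ l, (t.R l).IsAdmissible E I := by
    intro l; fin_cases l
    exacts [h, h, isAdmissible_of_isZero fun _ => h0]
  obtain ⟨a, b, hab⟩ := h.bounded
  have hsupp : ∀ l, (t.R l).SupportedOn (Set.Ico a (a + (b + 1 - a).toNat)) := by
    have : P.SupportedOn (Set.Ico a (a + (b + 1 - a).toNat)) := hab.mono fun n hn =>
      ⟨hn.1, by have := hn.1; have := hn.2; omega⟩
    intro l; fin_cases l
    exacts [this, this, fun _ _ => h0]
  have := t.cls_tot_eq_sum hI (fun l => (hadm l).bounded) (fun l => (hadm l).supported) hsupp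
  rw [Finset.sum_eq_zero, t.cls_tot hI hadm] at this
  · have hz : ((t.R 2).shift.shift.cls E I) = 0 := cls_eq_zero_of_isZero fun _ => h0
    rw [hz, add_zero] at this
    exact eq_neg_of_add_eq_zero_right this
  · intro m _
    refine cls_eq_zero_of_isDiag (Triple.tot_isDiag _ (fun l i j => ?_) (fun _ => rfl)
      fun _ => rfl)
    rw [Triple.cut_single_d, Triple.cut_single_d']

end

/-! ### Columns as graded pieces: rows against columns -/

section

section

variable {C : Type u} [Category.{v} C] [Preadditive C]

theorem isIso_of_isZero {X Y : C} (hX : IsZero X) (hY : IsZero Y) (f : X ⟶ Y) : IsIso f :=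
  ⟨0, hX.eq_of_src _ _, hY.eq_of_src _ _⟩

theorem isIso_neg {X Y : C} (f : X ⟶ Y) [IsIso f] : IsIso (-f) :=
  ⟨- inv f, by simp, by simp⟩

theorem isIso_inl_of_isZero [HasBinaryBiproducts C] {X Y : C} (hY : IsZero Y) :
    IsIso (biprod.inl : X ⟶ X ⊞ Y) :=
  ⟨biprod.fst, by simp, by
    apply biprod.hom_ext'
    · simp
    · exact hY.eq_of_src _ _⟩

theorem isIso_inr_of_isZero [HasBinaryBiproducts C] {X Y : C} (hX : IsZero X) :
    IsIso (biprod.inr : Y ⟶ X ⊞ Y) :=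
  ⟨biprod.snd, by simp, by
    apply biprod.hom_ext'
    · exact hX.eq_of_src _ _
    · simp⟩

theorem inl_twistMap_inl [HasBinaryBiproducts C] {X Y A A' D D' B' : C} {x : X ⟶ A}
    {d : A ⟶ A'} (hd : d = 0) {e : D ⟶ D' ⊞ B'} {φ : A ⟶ D'} {f : X ⟶ Y} {y : Y ⟶ D'}
    (h : x ≫ φ = f ≫ y) :
    (x ≫ biprod.inl) ≫ twistMap d e (φ ≫ biprod.inl) = f ≫ (y ≫ biprod.inl) ≫ biprod.inr := by
  rw [Category.assoc, inl_twistMap, hd, zero_comp, zero_add, Category.assoc,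
    Category.assoc, reassoc_of% h]

theorem inl_inr_twistMap [HasBinaryBiproducts C] {X Y A A' B B' D D' : C} {x : X ⟶ A} {d : A ⟶ A'}
    (hd : d = 0) {b : B ⟶ B'} {γ : A ⟶ B'} {e : D ⟶ D'} {c : D ⟶ A' ⊞ B'} {g : X ⟶ Y} {y : Y ⟶ B'}
    (h : x ≫ γ = g ≫ y) :
    ((x ≫ biprod.inl) ≫ biprod.inr) ≫ twistMap e (twistMap d b γ) c =
      g ≫ (y ≫ biprod.inr) ≫ biprod.inr := by
  rw [Category.assoc, Category.assoc, inr_twistMap, ← Category.assoc biprod.inl, inl_twistMap, hd,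
    zero_comp, zero_add, Category.assoc, Category.assoc, reassoc_of% h]

theorem isIso_gradedMap_id (X : ℤ → C) {i j : ℤ} (h : i = j) :
    IsIso (gradedMap (fun n => 𝟙 (X n)) i j) := by
  subst h
  rw [gradedMap_self]
  infer_instance

variable [HasZeroObject C]

theorem isIso_cutHom {X Y : C} (f : X ⟶ Y) [IsIso f] {b c : Bool} (h : b = c) :
    IsIso (cutHom b c f) := by
  subst h
  cases b
  · exact isIso_of_isZero (isZero_zero C) (isZero_zero C) _
  · assumption

/-- Degree `N` of the rows appears in the total complex as `N`, `N + 1 - 1` and `N + 2 - 1 - 1`.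
Graded identities transport between these, and this square shows that the transport respects the
maps of the triple. -/
theorem cutHom_gradedMap (p : ℤ → Bool) {X Y : ℤ → C} (f : ∀ n, X n ⟶ Y n) {i j k : ℤ}
    (hij : i = j) (hjk : j = k) :
    cutHom true (p j) (gradedMap (fun n => 𝟙 (X n)) i j) ≫
      gradedMap (fun n => cutHom (p n) (p n) (f n)) j k =
        f i ≫ cutHom true (p k) (gradedMap (fun n => 𝟙 (Y n)) i k) := by
  subst hij hjk
  rw [gradedMap_self, gradedMap_self, gradedMap_self]
  exact cutHom_comp_eq (b' := true) ((Category.id_comp (f i)).trans (Category.comp_id (f i)).symm)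
    fun _ h => h

/-- The map out of a graded object in degrees `2, 1, 0`. -/
noncomputable def extDesc {X : Fin 3 → C} {Y : ℤ → C} (a₀ : X 0 ⟶ Y 0) (a₁ : X 1 ⟶ Y 1)
    (a₂ : X 2 ⟶ Y 2) : ∀ n : ℤ, extX X n ⟶ Y n
  | 0 => a₀
  | 1 => a₁
  | 2 => a₂
  | _ => 0

theorem extDesc_comm {X : Fin 3 → C} {Y : ℤ → C} {a₀ : X 0 ⟶ Y 0} {a₁ : X 1 ⟶ Y 1}
    {a₂ : X 2 ⟶ Y 2} {i : X 2 ⟶ X 1} {p : X 1 ⟶ X 0} {d : ∀ m n, Y m ⟶ Y n}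
    (hd : ∀ m n, ¬ (n + 1 = m) → d m n = 0) (hY : IsZero (Y (-1)))
    (hi : a₂ ≫ d 2 1 = i ≫ a₁) (hp : a₁ ≫ d 1 0 = p ≫ a₀)
    (m n : ℤ) : extDesc a₀ a₁ a₂ m ≫ d m n = extD X i p m n ≫ extDesc a₀ a₁ a₂ n := by
  by_cases h : n + 1 = m
  · subst h
    by_cases h0 : n = 0
    · subst h0; exact hp
    by_cases h1 : n = 1
    · subst h1; exact hi
    by_cases h2 : n = -1
    · subst h2
      exact hY.eq_of_tgt _ _
    · exact (extX_isZero X (by omega) (by omega) (by omega)).eq_of_src _ _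
  · rw [extD_zero _ _ _ _ _ h, hd _ _ h, comp_zero, zero_comp]

theorem extDesc_isIso {X : Fin 3 → C} {Y : ℤ → C} (a₀ : X 0 ⟶ Y 0) (a₁ : X 1 ⟶ Y 1)
    (a₂ : X 2 ⟶ Y 2) [h₀ : IsIso a₀] [h₁ : IsIso a₁] [h₂ : IsIso a₂]
    (hY : ∀ n, n ≠ 0 → n ≠ 1 → n ≠ 2 → IsZero (Y n)) (n : ℤ) : IsIso (extDesc a₀ a₁ a₂ n) := by
  by_cases h0 : n = 0
  · subst h0; exact h₀
  by_cases h1 : n = 1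
  · subst h1; exact h₁
  by_cases h2 : n = 2
  · subst h2; exact h₂
  exact isIso_of_isZero (extX_isZero X h0 h1 h2) (hY n h0 h1 h2) _

end

namespace BinaryComplex

variable {C : Type u} [Category.{v} C] [Preadditive C]

/-- The inverse of the shift. -/
def unshift (P : BinaryComplex C) : BinaryComplex C where
  X := fun n => P.X (n + 1)
  d := fun i j => - P.d (i + 1) (j + 1)
  d' := fun i j => - P.d' (i + 1) (j + 1)
  shape := fun i j h => neg_eq_zero.2 (P.shape _ _ fun h' => h (by
    change j + 1 + 1 = i + 1 at h'; change j + 1 = i; omega))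
  shape' := fun i j h => neg_eq_zero.2 (P.shape' _ _ fun h' => h (by
    change j + 1 + 1 = i + 1 at h'; change j + 1 = i; omega))
  d_comp_d := fun i j k => by simp [P.d_comp_d]
  d'_comp_d' := fun i j k => by simp [P.d'_comp_d']

theorem eqToHom_d {X : ℤ → C} (d : ∀ i j, X i ⟶ X j) {i i' j j' : ℤ} (hi : i = i') (hj : j = j') :
    eqToHom (congrArg X hi) ≫ d i' j' = (- - d i j) ≫ eqToHom (congrArg X hj) := by
  subst hi hj
  simp

/-- The shift of the inverse shift. -/
def unshiftShiftHom (P : BinaryComplex C) : P.unshift.shift.Hom P where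
  f := fun n => eqToHom (congrArg P.X (sub_add_cancel n 1))
  comm := fun i j => eqToHom_d P.d (sub_add_cancel i 1) (sub_add_cancel j 1)
  comm' := fun i j => eqToHom_d P.d' (sub_add_cancel i 1) (sub_add_cancel j 1)

variable [HasZeroObject C] [HasBinaryBiproducts C] {E : ExactStructure C} {I : Set ℤ}

/-- Each shift contributes a factor `-1`, so induction reduces to `n = 0`. The degrees `m₀`, `m₁`,
`m₂` are free variables so that the unshifted complex can be inserted without transporting its
objects. -/
theorem cls_of_three_term (hI : ∀ n ∈ I, n + 1 ∈ I) (hI' : Set.Icc 0 2 ⊆ I) (b : BinarySES E)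
    (n : ℕ) : ∀ (W : BinaryComplex C) (_ : W.SupportedOn (Set.Icc n (n + 2))) (m₀ m₁ m₂ : ℤ)
    (_ : m₀ = n) (_ : m₁ = n + 1) (_ : m₂ = n + 2) (a₀ : b.X 0 ⟶ W.X m₀) (a₁ : b.X 1 ⟶ W.X m₁)
    (a₂ : b.X 2 ⟶ W.X m₂) (_ : IsIso a₀) (_ : IsIso a₁) (_ : IsIso a₂)
    (_ : a₂ ≫ W.d m₂ m₁ = b.i ≫ a₁) (_ : a₁ ≫ W.d m₁ m₀ = b.p ≫ a₀)
    (_ : a₂ ≫ W.d' m₂ m₁ = b.i' ≫ a₁) (_ : a₁ ≫ W.d' m₁ m₀ = b.p' ≫ a₀),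
    W.IsAdmissible E I ∧ W.cls E I = (-1 : ℤ) ^ n • b.graysonClass hI' := by
  induction n with
  | zero =>
    rintro W hW m₀ m₁ m₂ rfl rfl rfl a₀ a₁ a₂ _ _ _ hi hp hi' hp'
    have hW' : ∀ n, n ≠ 0 → n ≠ 1 → n ≠ 2 → IsZero (W.X n) := fun n h0 h1 h2 => hW n fun h => by
      have := h.1; have := h.2; push_cast at *; omega
    have hb := b.toBinaryAcyclicComplex.isAdmissible
      (b.toBinaryAcyclicComplex_supportedOn hI')
    let f : b.toBinaryAcyclicComplex.toBinaryComplex.Hom W :=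
      { f := extDesc a₀ a₁ a₂
        comm := extDesc_comm W.shape (hW' _ (by norm_num) (by norm_num) (by norm_num)) hi hp
        comm' := extDesc_comm W.shape' (hW' _ (by norm_num) (by norm_num) (by norm_num)) hi' hp' }
    have hf : ∀ n, IsIso (f.f n) := extDesc_isIso a₀ a₁ a₂ hW'
    refine ⟨hb.of_isIso f hf, ?_⟩
    rw [← cls_eq_of_isIso f hf hb, pow_zero, one_smul]
    exact BinaryAcyclicComplex.cls_eq _ _
  | succ n ih =>
    intro W hW m₀ m₁ m₂ h₀ h₁ h₂ a₀ a₁ a₂ i₀ i₁ i₂ hi hp hi' hp'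
    push_cast at h₀ h₁ h₂
    obtain rfl : m₂ = (n + 2 : ℤ) + 1 := by omega
    subst h₀ h₁
    -- Unshifting negates both differentials; replacing `a₁` by `-a₁` restores the commutative
    -- squares.
    obtain ⟨hV, hcls⟩ := ih W.unshift (fun k hk => hW _ fun h => hk (by
        have := h.1; have := h.2; push_cast at *; constructor <;> omega)) n (n + 1) (n + 2)
      rfl rfl rfl a₀ (-a₁) a₂ i₀ (isIso_neg a₁) i₂
      ((Preadditive.comp_neg _ _).trans ((congrArg Neg.neg hi).trans
        (Preadditive.comp_neg _ _).symm))
      ((Preadditive.neg_comp_neg _ _).trans hp)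
      ((Preadditive.comp_neg _ _).trans ((congrArg Neg.neg hi').trans
        (Preadditive.comp_neg _ _).symm))
      ((Preadditive.neg_comp_neg _ _).trans hp')
    have hiso : ∀ n, IsIso (W.unshiftShiftHom.f n) := fun n =>
      inferInstanceAs (IsIso (eqToHom (congrArg W.X (sub_add_cancel n 1))))
    refine ⟨(hV.shift hI).of_isIso _ hiso, ?_⟩
    rw [← cls_eq_of_isIso _ hiso (hV.shift hI), hV.cls_shift hI, hcls, pow_succ, mul_neg_one,
      neg_smul]

end BinaryComplex

namespace Triple

variable {C : Type u} [Category.{v} C] [Preadditive C] [HasZeroObject C] [HasBinaryBiproducts C]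
  {E : ExactStructure C} {I : Set ℤ}

/-- In the total complex, row `l` is shifted by `l`. A single degree `N` therefore yields the column
`R 2 ⟶ R 1 ⟶ R 0` in degrees `N + 2`, `N + 1`, `N`. -/
theorem cls_tot_cut_single (t : Triple E) (hI : ∀ n ∈ I, n + 1 ∈ I) (hI' : Set.Icc 0 2 ⊆ I)
    (N : ℕ) : (t.cut fun n => decide (n = (N : ℤ))).tot.cls E I =
      (-1 : ℤ) ^ N • (t.col N).graysonClass hI' := by
  let p : ℤ → Bool := fun n => decide (n = (N : ℤ))
  have hp : ∀ n, n = (N : ℤ) → true = p n := fun n h => (decide_eq_true h).symm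
  have hz : ∀ l n, n ≠ (N : ℤ) → IsZero (((t.cut p).R l).X n) := fun l n hn => by
    change IsZero (cutObj (decide (n = (N : ℤ))) _)
    rw [decide_eq_false hn]
    exact isZero_zero C
  let x₀ : (t.R 0).X N ⟶ ((t.cut p).R 0).X N :=
    cutHom true (p N) (gradedMap (fun n => 𝟙 ((t.R 0).X n)) N N)
  let x₁ : (t.R 1).X N ⟶ ((t.cut p).R 1).X (N + 1 - 1) :=
    cutHom true (p (N + 1 - 1)) (gradedMap (fun n => 𝟙 ((t.R 1).X n)) N (N + 1 - 1))
  let x₂ : (t.R 2).X N ⟶ ((t.cut p).R 2).X (N + 2 - 1 - 1) :=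
    cutHom true (p (N + 2 - 1 - 1)) (gradedMap (fun n => 𝟙 ((t.R 2).X n)) N (N + 2 - 1 - 1))
  have hx₀ : IsIso x₀ := @isIso_cutHom _ _ _ _ _ _ _ (isIso_gradedMap_id _ rfl) _ _ (hp _ rfl)
  have hx₁ : IsIso x₁ := @isIso_cutHom _ _ _ _ _ _ _ (isIso_gradedMap_id _ (by omega)) _ _
    (hp _ (by omega))
  have hx₂ : IsIso x₂ := @isIso_cutHom _ _ _ _ _ _ _ (isIso_gradedMap_id _ (by omega)) _ _
    (hp _ (by omega))
  refine (BinaryComplex.cls_of_three_term hI hI' (t.col N) N (t.cut p).tot (fun n hn => ?_) N (N + 1)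
    (N + 2) rfl rfl rfl ((x₀ ≫ biprod.inr) ≫ biprod.inr) ((x₁ ≫ biprod.inl) ≫ biprod.inr)
    (x₂ ≫ biprod.inl) ?_ ?_ ?_ ?_ ?_ ?_ ?_).2
  · have h : ∀ k : ℤ, 0 ≤ k → k ≤ 2 → n - k ≠ N := fun k hk hk' h => hn ⟨by omega, by omega⟩
    exact tot_isZero _ (hz 2 _ (by have := h 2; omega)) (hz 1 _ (by have := h 1; omega))
      (hz 0 _ (by have := h 0; omega))
  · have h₁ := isIso_inr_of_isZero (Y := ((t.cut p).R 0).X N) (hz 1 (N - 1) (by omega))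
    have h₂ := isIso_inr_of_isZero (Y := ((t.cut p).R 1).X (N - 1) ⊞ ((t.cut p).R 0).X N)
      (hz 2 (N - 1 - 1) (by omega))
    exact IsIso.comp_isIso' (IsIso.comp_isIso' hx₀ h₁) h₂
  · have h₁ := isIso_inl_of_isZero (X := ((t.cut p).R 1).X (N + 1 - 1)) (hz 0 (N + 1) (by omega))
    have h₂ := isIso_inr_of_isZero (Y := ((t.cut p).R 1).X (N + 1 - 1) ⊞
      ((t.cut p).R 0).X (N + 1)) (hz 2 (N + 1 - 1 - 1) (by omega))
    exact IsIso.comp_isIso' (IsIso.comp_isIso' hx₁ h₁) h₂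
  · have h₁ := isIso_inl_of_isZero (X := ((t.cut p).R 2).X (N + 2 - 1 - 1))
      ((biprod_isZero_iff _ _).2 ⟨hz 1 (N + 2 - 1) (by omega), hz 0 (N + 2) (by omega)⟩)
    exact IsIso.comp_isIso' hx₂ h₁
  · exact inl_twistMap_inl (neg_eq_zero.2 (neg_eq_zero.2 (t.cut_single_d N 2 _ _)))
      (cutHom_gradedMap p t.f (by omega) (by omega))
  · exact inl_inr_twistMap (neg_eq_zero.2 (t.cut_single_d N 1 _ _))
      (cutHom_gradedMap p t.g (by omega) (by omega))
  · exact inl_twistMap_inl (neg_eq_zero.2 (neg_eq_zero.2 (t.cut_single_d' N 2 _ _)))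
      (cutHom_gradedMap p t.f' (by omega) (by omega))
  · exact inl_inr_twistMap (neg_eq_zero.2 (t.cut_single_d' N 1 _ _))
      (cutHom_gradedMap p t.g' (by omega) (by omega))

/-- The alternating sum of the rows is the alternating sum of the columns. -/
theorem cls_rows_eq_cls_cols (t : Triple E) (hI : ∀ n ∈ I, n + 1 ∈ I) (hI' : Set.Icc 0 2 ⊆ I)
    (h : ∀ l, (t.R l).IsAdmissible E I) {k : ℕ} (hk : ∀ l, (t.R l).SupportedOn (Set.Ico 0 k)) :
    (t.R 0).cls E I - (t.R 1).cls E I + (t.R 2).cls E I =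
      ∑ m ∈ Finset.range k, (-1 : ℤ) ^ m • (t.col m).graysonClass hI' := by
  have h₁ := t.cls_tot_eq_sum hI (fun l => (h l).bounded) (fun l => (h l).supported) (a := 0)
    (k := k) (by simpa using hk)
  rw [t.cls_tot hI h, ((h 2).shift hI).cls_shift hI, (h 2).cls_shift hI, (h 1).cls_shift hI,
    neg_neg, ← sub_eq_add_neg] at h₁
  rw [h₁]
  refine Finset.sum_congr rfl fun m _ => ?_
  rw [zero_add]
  exact t.cls_tot_cut_single hI hI' m

end Triple

end

/-! ### Heller's relation on isomorphism classes -/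

section

section Heller

variable {M : Type*} [AddCommMonoid M]

/-- Heller's relation on a commutative monoid with a notion of extensions: after adding a common
summand, both elements are extensions of the same elements. -/
def HellerRel (T : M → M → M → Prop) (x y : M) : Prop :=
  ∃ a b k, T a (x + k) b ∧ T a (y + k) b

namespace HellerRel

variable {T : M → M → M → Prop} (hs : ∀ a b, T a (a + b) b)
  (ha : ∀ {a m b a' m' b'}, T a m b → T a' m' b' → T (a + a') (m + m') (b + b'))

include hs in
theorem refl (x : M) : HellerRel T x x := ⟨x, 0, 0, hs x 0, hs x 0⟩

theorem symm {x y : M} : HellerRel T x y → HellerRel T y x :=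
  fun ⟨a, b, k, h, h'⟩ => ⟨a, b, k, h', h⟩

include ha in
-- The extensions are added up, and the intermediate element `y` joins the common summand.
theorem trans {x y z : M} : HellerRel T x y → HellerRel T y z → HellerRel T x z := by
  rintro ⟨a, b, k, h₁, h₂⟩ ⟨a', b', k', h₃, h₄⟩
  refine ⟨a + a', b + b', k + (y + k'), ?_, ?_⟩
  · have := ha h₁ h₃
    rwa [add_assoc] at this
  · have := ha h₂ h₄
    rwa [show y + k + (z + k') = z + (k + (y + k')) by abel] at this

include hs ha in
theorem add_right {x y : M} (z : M) : HellerRel T x y → HellerRel T (x + z) (y + z) := by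
  rintro ⟨a, b, k, h₁, h₂⟩
  refine ⟨a + z, b + 0, k, ?_, ?_⟩
  · have := ha h₁ (hs z 0)
    rwa [show x + k + (z + 0) = x + z + k by abel] at this
  · have := ha h₂ (hs z 0)
    rwa [show y + k + (z + 0) = y + z + k by abel] at this

include hs ha in
theorem add {x y x' y' : M} (h : HellerRel T x y) (h' : HellerRel T x' y') :
    HellerRel T (x + x') (y + y') := by
  refine (h.add_right hs ha x').trans ha ?_
  rw [add_comm y x', add_comm y y']
  exact h'.add_right hs ha y

/-- The common summand `k` absorbs `z`. This cancellation makes the relation behave like equality in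
`K_0`. -/
theorem add_right_cancel {x y z : M} : HellerRel T (x + z) (y + z) → HellerRel T x y := by
  rintro ⟨a, b, k, h₁, h₂⟩
  exact ⟨a, b, z + k, by rwa [add_assoc] at h₁, by rwa [add_assoc] at h₂⟩

include hs in
theorem of_ext {a m b : M} (h : T a m b) : HellerRel T m (a + b) :=
  ⟨a, b, 0, by rwa [add_zero], by rw [add_zero]; exact hs a b⟩

end HellerRel

end Heller

namespace BinaryComplex

variable {C : Type u} [Category.{v} C] [Preadditive C]

/-- The inverse of an isomorphism. -/
def Isom.symm {P Q : BinaryComplex C} (θ : P.Isom Q) : Q.Isom P where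
  f := fun n => (θ.f n).symm
  comm := fun i j => by
    rw [Iso.symm_hom, Iso.symm_hom, Iso.inv_comp_eq, ← Category.assoc, θ.comm, Category.assoc,
      Iso.hom_inv_id, Category.comp_id]
  comm' := fun i j => by
    rw [Iso.symm_hom, Iso.symm_hom, Iso.inv_comp_eq, ← Category.assoc, θ.comm', Category.assoc,
      Iso.hom_inv_id, Category.comp_id]

/-- The composition of isomorphisms. -/
def Isom.trans {P Q R : BinaryComplex C} (θ : P.Isom Q) (η : Q.Isom R) : P.Isom R where
  f := fun n => θ.f n ≪≫ η.f n
  comm := fun i j => by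
    rw [Iso.trans_hom, Iso.trans_hom, Category.assoc, η.comm, ← Category.assoc, θ.comm,
      Category.assoc]
  comm' := fun i j => by
    rw [Iso.trans_hom, Iso.trans_hom, Category.assoc, η.comm', ← Category.assoc, θ.comm',
      Category.assoc]

/-- The identity. -/
def Isom.refl (P : BinaryComplex C) : P.Isom P where
  f := fun _ => Iso.refl _
  comm := fun _ _ => (Category.id_comp _).trans (Category.comp_id _).symm
  comm' := fun _ _ => (Category.id_comp _).trans (Category.comp_id _).symm

/-- A degreewise invertible morphism is an isomorphism. -/
noncomputable def Hom.toIsom {P Q : BinaryComplex C} (f : P.Hom Q) (hf : ∀ n, IsIso (f.f n)) :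
    P.Isom Q where
  f := fun n => @asIso _ _ _ _ (f.f n) (hf n)
  comm := f.comm
  comm' := f.comm'

/-- `M` is an extension of `B` by `A`. -/
def IsExt (E : ExactStructure C) (A M B : BinaryComplex C) : Prop :=
  ∃ (f : A.Hom M) (g : M.Hom B), ∀ n, E.IsSES (f.f n) (g.f n)

theorem IsExt.of_isom {E : ExactStructure C} {A M B A' M' B' : BinaryComplex C}
    (h : IsExt E A M B) (a : A.Isom A') (m : M.Isom M') (b : B.Isom B') : IsExt E A' M' B' := by
  obtain ⟨f, g, h⟩ := h
  refine ⟨⟨fun n => (a.f n).inv ≫ f.f n ≫ (m.f n).hom, fun i j => ?_, fun i j => ?_⟩,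
    ⟨fun n => (m.f n).inv ≫ g.f n ≫ (b.f n).hom, fun i j => ?_, fun i j => ?_⟩,
    fun n => (h n).of_iso (a.f n) (m.f n) (b.f n) (by simp) (by simp)⟩
  · have h₁ := a.symm.comm i j
    change (a.f i).inv ≫ _ = _ ≫ (a.f j).inv at h₁
    rw [Category.assoc, Category.assoc, m.comm, reassoc_of% f.comm, reassoc_of% h₁]
  · have h₁ := a.symm.comm' i j
    change (a.f i).inv ≫ _ = _ ≫ (a.f j).inv at h₁
    rw [Category.assoc, Category.assoc, m.comm', reassoc_of% f.comm', reassoc_of% h₁]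
  · have h₁ := m.symm.comm i j
    change (m.f i).inv ≫ _ = _ ≫ (m.f j).inv at h₁
    rw [Category.assoc, Category.assoc, b.comm, reassoc_of% g.comm, reassoc_of% h₁]
  · have h₁ := m.symm.comm' i j
    change (m.f i).inv ≫ _ = _ ≫ (m.f j).inv at h₁
    rw [Category.assoc, Category.assoc, b.comm', reassoc_of% g.comm', reassoc_of% h₁]

variable [HasBinaryBiproducts C]

theorem biprod_associator_natural {X Y Z X' Y' Z' : C} (a : X ⟶ X') (b : Y ⟶ Y') (c : Z ⟶ Z') :
    (biprod.associator X Y Z).hom ≫ biprod.map a (biprod.map b c) =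
      biprod.map (biprod.map a b) c ≫ (biprod.associator X' Y' Z').hom := by
  ext <;> simp

/-- Associativity of the direct sum. -/
noncomputable def associator (P Q R : BinaryComplex C) :
    ((P.biprod Q).biprod R).Isom (P.biprod (Q.biprod R)) where
  f := fun n => biprod.associator (P.X n) (Q.X n) (R.X n)
  comm := fun _ _ => biprod_associator_natural _ _ _
  comm' := fun _ _ => biprod_associator_natural _ _ _

/-- Commutativity of the direct sum. -/
noncomputable def braiding (P Q : BinaryComplex C) : (P.biprod Q).Isom (Q.biprod P) where
  f := fun n => biprod.braiding (P.X n) (Q.X n)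
  comm := fun _ _ => (biprod.braid_natural _ _).symm
  comm' := fun _ _ => (biprod.braid_natural _ _).symm

/-- The direct sum of isomorphisms. -/
noncomputable def Isom.biprod {P Q P' Q' : BinaryComplex C} (θ : P.Isom P') (η : Q.Isom Q') :
    (P.biprod Q).Isom (P'.biprod Q') where
  f := fun n => biprod.mapIso (θ.f n) (η.f n)
  comm := fun i j => biprod_map_comp_eq (θ.comm i j) (η.comm i j)
  comm' := fun i j => biprod_map_comp_eq (θ.comm' i j) (η.comm' i j)

variable [HasZeroObject C] {E : ExactStructure C} {I : Set ℤ}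

theorem IsAdmissible.biprod {P Q : BinaryComplex C} (hP : P.IsAdmissible E I)
    (hQ : Q.IsAdmissible E I) : (P.biprod Q).IsAdmissible E I :=
  ⟨hP.bounded.biprod hQ.bounded, hP.acyclic.biprod hQ.acyclic, hP.supported.biprod hQ.supported⟩

theorem isExt_biprod (E : ExactStructure C) (A B : BinaryComplex C) : IsExt E A (A.biprod B) B :=
  ⟨⟨fun _ => biprod.inl, fun _ _ => biprod.inl_map _ _, fun _ _ => biprod.inl_map _ _⟩,
    ⟨fun _ => biprod.snd, fun _ _ => (biprod.map_snd _ _).symm, fun _ _ => (biprod.map_snd _ _).symm⟩,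
    fun _ => E.isSES_inl_snd _ _⟩

theorem IsExt.biprod {A M B A' M' B' : BinaryComplex C} (h : IsExt E A M B)
    (h' : IsExt E A' M' B') : IsExt E (A.biprod A') (M.biprod M') (B.biprod B') := by
  obtain ⟨f, g, h⟩ := h
  obtain ⟨f', g', h'⟩ := h'
  exact ⟨⟨fun n => biprod.map (f.f n) (f'.f n), fun i j =>
      biprod_map_comp_eq (f.comm i j) (f'.comm i j), fun i j =>
      biprod_map_comp_eq (f.comm' i j) (f'.comm' i j)⟩,
    ⟨fun n => biprod.map (g.f n) (g'.f n), fun i j =>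
      biprod_map_comp_eq (g.comm i j) (g'.comm i j), fun i j =>
      biprod_map_comp_eq (g.comm' i j) (g'.comm' i j)⟩, fun n => (h n).biprod (h' n)⟩

end BinaryComplex

section IsoClass

variable {C : Type u} [Category.{v} C] [Preadditive C]

/-- Admissible binary complexes with equal differentials. -/
abbrev DiagComplex (E : ExactStructure C) (I : Set ℤ) :=
  {P : BinaryComplex C // P.IsDiag ∧ P.IsAdmissible E I}

instance DiagComplex.setoid (E : ExactStructure C) (I : Set ℤ) : Setoid (DiagComplex E I) where
  r := fun P Q => Nonempty (P.1.Isom Q.1)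
  iseqv := ⟨fun P => ⟨.refl P.1⟩, fun ⟨θ⟩ => ⟨θ.symm⟩, fun ⟨θ⟩ ⟨η⟩ => ⟨θ.trans η⟩⟩

/-- Isomorphism classes of admissible complexes. -/
def IsoClass (E : ExactStructure C) (I : Set ℤ) : Type _ := Quotient (DiagComplex.setoid E I)

variable [HasZeroObject C] [HasBinaryBiproducts C] {E : ExactStructure C} {I : Set ℤ}

/-- The direct sum. -/
noncomputable def DiagComplex.biprod (P Q : DiagComplex E I) : DiagComplex E I :=
  ⟨P.1.biprod Q.1, P.2.1.biprod Q.2.1, P.2.2.biprod Q.2.2⟩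

/-- The zero complex. -/
noncomputable def DiagComplex.zero (E : ExactStructure C) (I : Set ℤ) : DiagComplex E I :=
  ⟨BinaryComplex.zero C, fun _ _ => rfl,
    BinaryComplex.isAdmissible_of_isZero fun _ => isZero_zero C⟩

namespace IsoClass

/-- The class of a complex. -/
def mk (P : DiagComplex E I) : IsoClass E I := Quotient.mk _ P

theorem mk_eq {P Q : DiagComplex E I} (θ : P.1.Isom Q.1) : mk P = mk Q := Quotient.sound ⟨θ⟩

noncomputable instance : Add (IsoClass E I) :=
  ⟨Quotient.map₂ DiagComplex.biprod fun _ _ ⟨θ⟩ _ _ ⟨η⟩ => ⟨θ.biprod η⟩⟩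

noncomputable instance : Zero (IsoClass E I) := ⟨mk (DiagComplex.zero E I)⟩

/-- Direct sums are associative and commutative only up to isomorphism; passing to isomorphism
classes makes the monoid arguments on Heller's relation available. -/
noncomputable instance : AddCommMonoid (IsoClass E I) where
  add_assoc := fun a b c => Quotient.inductionOn₃ a b c fun P Q R =>
    mk_eq (BinaryComplex.associator P.1 Q.1 R.1)
  add_comm := fun a b => Quotient.inductionOn₂ a b fun P Q =>
    mk_eq (BinaryComplex.braiding P.1 Q.1)
  zero_add := fun a => Quotient.inductionOn a fun P =>
    mk_eq ((BinaryComplex.braiding _ P.1).trans P.1.isomBiprodZero.symm)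
  add_zero := fun a => Quotient.inductionOn a fun P => mk_eq P.1.isomBiprodZero.symm
  nsmul := nsmulRec

/-- Extensions of isomorphism classes. -/
def Ext (a m b : IsoClass E I) : Prop :=
  ∃ A M B : DiagComplex E I, mk A = a ∧ mk M = m ∧ mk B = b ∧ BinaryComplex.IsExt E A.1 M.1 B.1

theorem ext_add (a b : IsoClass E I) : Ext a (a + b) b :=
  Quotient.inductionOn₂ a b fun A B => ⟨A, A.biprod B, B, rfl, rfl, rfl,
    BinaryComplex.isExt_biprod E A.1 B.1⟩

theorem Ext.add {a m b a' m' b' : IsoClass E I} : Ext a m b → Ext a' m' b' →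
    Ext (a + a') (m + m') (b + b') := by
  rintro ⟨A, M, B, rfl, rfl, rfl, h⟩ ⟨A', M', B', rfl, rfl, rfl, h'⟩
  exact ⟨A.biprod A', M.biprod M', B.biprod B', rfl, rfl, rfl, h.biprod h'⟩

theorem Ext.isExt {A M B : DiagComplex E I} (h : Ext (mk A) (mk M) (mk B)) :
    BinaryComplex.IsExt E A.1 M.1 B.1 := by
  obtain ⟨A', M', B', ha, hm, hb, h⟩ := h
  obtain ⟨a⟩ := Quotient.exact ha
  obtain ⟨m⟩ := Quotient.exact hm
  obtain ⟨b⟩ := Quotient.exact hb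
  exact h.of_isom a m b

theorem exists_of_hellerRel {X Y : DiagComplex E I} (h : HellerRel Ext (mk X) (mk Y)) :
    ∃ A B K : DiagComplex E I, BinaryComplex.IsExt E A.1 (X.1.biprod K.1) B.1 ∧
      BinaryComplex.IsExt E A.1 (Y.1.biprod K.1) B.1 := by
  obtain ⟨a, b, k, h, h'⟩ := h
  induction a using Quotient.inductionOn with | h A
  induction b using Quotient.inductionOn with | h B
  induction k using Quotient.inductionOn with | h K
  exact ⟨A, B, K, Ext.isExt (M := X.biprod K) h, Ext.isExt (M := Y.biprod K) h'⟩

end IsoClass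

end IsoClass

end

/-! ### Disk complexes and truncations of acyclic complexes -/

section

section Mix

variable {C : Type u} [Category.{v} C] [Preadditive C] [HasZeroObject C]

/-- At most one of two given objects. -/
noncomputable def cutObj₂ : Bool → Bool → C → C → C
  | true, _, X, _ => X
  | false, true, _, Y => Y
  | false, false, _, _ => 0

/-- The inclusion of the first object. -/
noncomputable def cutInl : ∀ (x y : Bool) (X Y : C), cutObj x X ⟶ cutObj₂ x y X Y
  | true, _, X, _ => 𝟙 X
  | false, _, _, _ => 0

/-- The projection to the second object. -/
noncomputable def cutSnd : ∀ (x y : Bool) (X Y : C), cutObj₂ x y X Y ⟶ cutObj y Y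
  | false, true, _, Y => 𝟙 Y
  | true, _, _, _ => 0
  | false, false, _, _ => 0

/-- At most one of two given morphisms. -/
noncomputable def cutHom₂ : ∀ (x y : Bool) {X Y X' Y' : C} (_ : X ⟶ X') (_ : Y ⟶ Y'),
    cutObj₂ x y X Y ⟶ cutObj₂ x y X' Y'
  | true, _, _, _, _, _, f, _ => f
  | false, true, _, _, _, _, _, g => g
  | false, false, _, _, _, _, _, _ => 0

theorem cutInl_isSES (E : ExactStructure C) (X Y : C) {x y : Bool} (h : (x && y) = false) :
    E.IsSES (cutInl x y X Y) (cutSnd x y X Y) := by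
  have h0 : IsZero (0 : C) := isZero_zero C
  cases x <;> cases y
  · exact ExactStructure.isSES_of_isZero h0 h0 h0 _ _
  · exact E.isSES_zero_id h0 _
  · exact E.isSES_id_zero h0 _
  · exact absurd h (by decide)

theorem cutInl_natural {X Y X' Y' : C} (f : X ⟶ X') (g : Y ⟶ Y') (x y : Bool) :
    cutInl x y X Y ≫ cutHom₂ x y f g = cutHom x x f ≫ cutInl x y X' Y' := by
  cases x
  · exact (isZero_zero C).eq_of_src _ _
  · exact (Category.id_comp f).trans (Category.comp_id f).symm

theorem cutSnd_natural {X Y X' Y' : C} (f : X ⟶ X') (g : Y ⟶ Y') (x y : Bool)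
    (h : (x && y) = false) :
    cutHom₂ x y f g ≫ cutSnd x y X' Y' = cutSnd x y X Y ≫ cutHom y y g := by
  cases x <;> cases y
  · exact (isZero_zero C).eq_of_src _ _
  · exact (Category.comp_id g).trans (Category.id_comp g).symm
  · exact (isZero_zero C).eq_of_tgt _ _
  · exact absurd h (by decide)

theorem cutHom₂_isSES {E : ExactStructure C} {X Y Z X' Y' Z' : C} {f : X ⟶ Y} {g : Y ⟶ Z}
    {f' : X' ⟶ Y'} {g' : Y' ⟶ Z'} (h : E.IsSES f g) (h' : E.IsSES f' g') (x y : Bool) :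
    E.IsSES (cutHom₂ x y f f') (cutHom₂ x y g g') := by
  have h0 : IsZero (0 : C) := isZero_zero C
  cases x <;> cases y
  · exact ExactStructure.isSES_of_isZero h0 h0 h0 _ _
  · exact h'
  · exact h
  · exact h

theorem cutHom₂_isIso {X Y X' Y' : C} {f : X ⟶ X'} {g : Y ⟶ Y'} {x y : Bool}
    (h : x = true → IsIso f) (h' : y = true → IsIso g) : IsIso (cutHom₂ x y f g) := by
  cases x <;> cases y
  · exact isIso_of_isZero (isZero_zero C) (isZero_zero C) _
  · exact h' rfl
  · exact h rfl
  · exact h rfl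

theorem isZero_cutObj₂ {X Y : C} {x y : Bool} (h : x = true → IsZero X) (h' : y = true → IsZero Y) :
    IsZero (cutObj₂ x y X Y) := by
  cases x <;> cases y
  · exact isZero_zero C
  · exact h' rfl
  · exact h rfl
  · exact h rfl

/-- A term of a truncated acyclic complex. -/
noncomputable def mixObj : Bool → Bool → C → C → C
  | true, true, _, P => P
  | true, false, J, _ => J
  | false, _, _, _ => 0

/-- The cycles of a truncated acyclic complex. -/
noncomputable def mixM : ∀ (b c : Bool) {J P : C} (_ : J ⟶ P), cutObj b J ⟶ mixObj b c J P
  | true, true, _, _, m => m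
  | true, false, J, _, _ => 𝟙 J
  | false, _, _, _, _ => 0

/-- The boundaries of a truncated acyclic complex. -/
noncomputable def mixE : ∀ (b c : Bool) {P J' : C} (J : C) (_ : P ⟶ J'),
    mixObj b c J P ⟶ cutObj c J'
  | true, true, _, _, _, e => e
  | true, false, _, _, _, _ => 0
  | false, _, _, _, _, _ => 0

/-- The inclusion of a truncated acyclic complex into the next one. -/
noncomputable def mixI : ∀ (b c c' : Bool) {J P : C} (_ : J ⟶ P), mixObj c c' J P ⟶ mixObj b c J P
  | true, true, true, _, P, _ => 𝟙 P
  | true, true, false, _, _, m => m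
  | true, false, _, _, _, _ => 0
  | false, _, _, _, _, _ => 0

/-- The projection from a truncated acyclic complex to the graded piece. -/
noncomputable def mixQ : ∀ (b c c' : Bool) {P J' : C} (J : C) (_ : P ⟶ J'),
    mixObj b c J P ⟶ cutObj₂ (b && !c) (c && !c') J J'
  | true, false, _, _, _, J, _ => 𝟙 J
  | true, true, false, _, _, _, e => e
  | true, true, true, _, _, _, _ => 0
  | false, _, _, _, _, _, _ => 0

/-- The comparison of a truncated acyclic complex with the whole complex. -/
noncomputable def mixTo : ∀ (b c : Bool) {J P : C} (_ : J ⟶ P), mixObj b c J P ⟶ P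
  | true, true, _, P, _ => 𝟙 P
  | true, false, _, _, m => m
  | false, _, _, _, _ => 0

theorem isZero_mixObj {J P : C} (hJ : IsZero J) (hP : IsZero P) :
    ∀ b c, IsZero (mixObj b c J P)
  | true, true => hP
  | true, false => hJ
  | false, _ => isZero_zero C

variable {E : ExactStructure C} {J P J' : C} {m : J ⟶ P} {e : P ⟶ J'}

/-- The flags `b`, `c` and, below, `c'` tell whether degrees `n`, `n - 1` and `n - 2` are selected.
A selected degree keeps its whole term if the next lower degree is selected too, and only its cycles
otherwise. -/
theorem mix_isSES (h : E.IsSES m e) {b c : Bool} (hcb : c = true → b = true) :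
    E.IsSES (mixM b c m) (mixE b c J e) := by
  have h0 : IsZero (0 : C) := isZero_zero C
  cases b <;> cases c
  · exact ExactStructure.isSES_of_isZero h0 h0 h0 _ _
  · exact absurd (hcb rfl) (by decide)
  · exact E.isSES_id_zero h0 _
  · exact h

theorem mixI_isSES (h : E.IsSES m e) {b c c' : Bool} (hcb : c = true → b = true)
    (hc : c' = true → c = true) : E.IsSES (mixI b c c' m) (mixQ b c c' J e) := by
  have h0 : IsZero (0 : C) := isZero_zero C
  cases b <;> cases c <;> cases c' <;> try exact absurd (hcb rfl) (by decide)
  · exact ExactStructure.isSES_of_isZero h0 h0 h0 _ _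
  · exact absurd (hc rfl) (by decide)
  · exact E.isSES_zero_id h0 _
  · exact absurd (hc rfl) (by decide)
  · exact h
  · exact E.isSES_id_zero h0 _

theorem mixM_mixI (m : J ⟶ P) {b c c' : Bool} (hcb : c = true → b = true)
    (hc : c' = true → c = true) :
    mixM c c' m ≫ mixI b c c' m = cutHom c b (𝟙 J) ≫ mixM b c m := by
  cases c
  · exact (isZero_zero C).eq_of_src _ _
  obtain rfl := hcb rfl
  cases c'
  · rfl
  · exact (Category.comp_id m).trans (Category.id_comp m).symm

theorem mixI_mixE (w : m ≫ e = 0) {b c c' : Bool} (hcb : c = true → b = true)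
    (hc : c' = true → c = true) :
    mixI b c c' m ≫ mixE b c J e = mixE c c' J e ≫ cutHom c' c (𝟙 J') := by
  cases c
  · exact (isZero_zero C).eq_of_src _ _
  obtain rfl := hcb rfl
  cases c'
  · exact w.trans zero_comp.symm
  · exact (Category.id_comp e).trans (Category.comp_id e).symm

theorem mixM_mixQ (w : m ≫ e = 0) {b c c' : Bool} (hcb : c = true → b = true) :
    mixM b c m ≫ mixQ b c c' J e =
      cutHom b (b && !c) (𝟙 J) ≫ cutInl (b && !c) (c && !c') J J' := by
  cases b
  · exact (isZero_zero C).eq_of_src _ _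
  cases c
  · rfl
  cases c'
  · exact w.trans zero_comp.symm
  · exact (isZero_zero C).eq_of_tgt _ _

theorem mixQ_mixE (e : P ⟶ J') {b c c' : Bool} (hcb : c = true → b = true) :
    mixQ b c c' J e ≫ cutSnd (b && !c) (c && !c') J J' =
      mixE b c J e ≫ cutHom c (c && !c') (𝟙 J') := by
  cases c
  · exact (isZero_zero C).eq_of_tgt _ _
  obtain rfl := hcb rfl
  cases c'
  · rfl
  · exact (isZero_zero C).eq_of_tgt _ _

end Mix

variable {C : Type u} [Category.{v} C] [Preadditive C]

/-- Short exact sequences `J n ↣ P n ↠ J (n - 1)`. -/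
structure Pieces (E : ExactStructure C) where
  J : ℤ → C
  P : ℤ → C
  m : ∀ n, J n ⟶ P n
  e : ∀ n, P n ⟶ J (n - 1)
  exact : ∀ n, E.IsSES (m n) (e n)

namespace Pieces

variable {E : ExactStructure C} {I : Set ℤ}

theorem e_gradedMap_zero (X : Pieces E) (i j k : ℤ) :
    (X.e i ≫ gradedMap X.m (i - 1) j) ≫ X.e j ≫ gradedMap X.m (j - 1) k = 0 := by
  by_cases h : i - 1 = j
  · subst h
    rw [gradedMap_self, Category.assoc, reassoc_of% (X.exact (i - 1)).1, zero_comp, comp_zero]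
  · rw [gradedMap_of_ne _ h, comp_zero, zero_comp]

/-- The acyclic complex assembled from short exact sequences. -/
def complex (X : Pieces E) : BinaryComplex C where
  X := X.P
  d := fun i j => X.e i ≫ gradedMap X.m (i - 1) j
  d' := fun i j => X.e i ≫ gradedMap X.m (i - 1) j
  shape := fun i j h => by
    rw [gradedMap_of_ne _ fun h' => h (show j + 1 = i by omega), comp_zero]
  shape' := fun i j h => by
    rw [gradedMap_of_ne _ fun h' => h (show j + 1 = i by omega), comp_zero]
  d_comp_d := X.e_gradedMap_zero
  d'_comp_d' := X.e_gradedMap_zero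

theorem complex_isDiag (X : Pieces E) : X.complex.IsDiag := fun _ _ => rfl

theorem complex_isAcyclic (X : Pieces E) : X.complex.IsAcyclic E :=
  X.complex_isDiag.isAcyclic ⟨X.J, X.m, X.e, X.exact, fun n =>
    congrArg (X.e n ≫ ·) (gradedMap_self X.m (n - 1))⟩

/-- Compatible maps. -/
structure Hom (X Y : Pieces E) where
  a : ∀ n, X.J n ⟶ Y.J n
  b : ∀ n, X.P n ⟶ Y.P n
  m : ∀ n, X.m n ≫ b n = a n ≫ Y.m n
  e : ∀ n, b n ≫ Y.e n = X.e n ≫ a (n - 1)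

theorem Hom.comm {X Y : Pieces E} (f : X.Hom Y) (i j : ℤ) :
    f.b i ≫ Y.e i ≫ gradedMap Y.m (i - 1) j = (X.e i ≫ gradedMap X.m (i - 1) j) ≫ f.b j := by
  rw [← Category.assoc, f.e, Category.assoc, Category.assoc,
    gradedMap_natural (fun n => (f.m n).symm)]

/-- The induced morphism of complexes. -/
def Hom.complex {X Y : Pieces E} (f : X.Hom Y) : X.complex.Hom Y.complex where
  f := f.b
  comm := f.comm
  comm' := f.comm

/-- The short exact sequences of an acyclic complex. -/
def ofData {A : ChainComplex C ℤ} (d : AcyclicData E A) : Pieces E where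
  J := d.J
  P := A.X
  m := d.m
  e := d.e
  exact := d.exact

/-- An acyclic complex is assembled from its short exact sequences. -/
def ofDataIsom {A : ChainComplex C ℤ} (d : AcyclicData E A) :
    (ofData d).complex.Isom (BinaryComplex.ofChain A) := by
  have h : ∀ i j, (Iso.refl (A.X i)).hom ≫ A.d i j =
      (d.e i ≫ gradedMap d.m (i - 1) j) ≫ (Iso.refl (A.X j)).hom := fun i j => by
    rw [Iso.refl_hom, Iso.refl_hom, Category.id_comp, Category.comp_id]
    by_cases hij : i - 1 = j
    · subst hij
      rw [gradedMap_self, d.d_eq]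
    · rw [gradedMap_of_ne _ hij, comp_zero, A.shape _ _ fun h => hij (by
        change j + 1 = i at h; omega)]
  exact ⟨fun n => Iso.refl (A.X n), h, h⟩

variable [HasZeroObject C]

/-- The complex with identity differentials between two copies of `A n` for each selected `n`. -/
noncomputable def disk (E : ExactStructure C) (A : ℤ → C) (r : ℤ → Bool)
    (hr : ∀ n, (r n && r (n - 1)) = false) : Pieces E where
  J := fun n => cutObj (r n) (A n)
  P := fun n => cutObj₂ (r n) (r (n - 1)) (A n) (A (n - 1))
  m := fun n => cutInl (r n) (r (n - 1)) (A n) (A (n - 1))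
  e := fun n => cutSnd (r n) (r (n - 1)) (A n) (A (n - 1))
  exact := fun n => cutInl_isSES E (A n) (A (n - 1)) (hr n)

/-- Functoriality of the disk complex. -/
noncomputable def diskMap {A B : ℤ → C} (f : ∀ n, A n ⟶ B n) (r : ℤ → Bool)
    (hr : ∀ n, (r n && r (n - 1)) = false) : (disk E A r hr).Hom (disk E B r hr) where
  a := fun n => cutHom (r n) (r n) (f n)
  b := fun n => cutHom₂ (r n) (r (n - 1)) (f n) (f (n - 1))
  m := fun n => cutInl_natural (f n) (f (n - 1)) _ _
  e := fun n => cutSnd_natural (f n) (f (n - 1)) _ _ (hr n)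

theorem isExt_disk {A B D : ℤ → C} {f : ∀ n, A n ⟶ B n} {g : ∀ n, B n ⟶ D n}
    (h : ∀ n, E.IsSES (f n) (g n)) (r : ℤ → Bool) (hr : ∀ n, (r n && r (n - 1)) = false) :
    BinaryComplex.IsExt E (disk E A r hr).complex (disk E B r hr).complex
      (disk E D r hr).complex :=
  ⟨(diskMap f r hr).complex, (diskMap g r hr).complex, fun n =>
    cutHom₂_isSES (h n) (h (n - 1)) _ _⟩

/-- Invertibility of maps of disk complexes. -/
noncomputable def diskIsom {A B : ℤ → C} (f : ∀ n, A n ⟶ B n) (r : ℤ → Bool)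
    (hr : ∀ n, (r n && r (n - 1)) = false) (hf : ∀ n, r n = true → IsIso (f n)) :
    (disk E A r hr).complex.Isom (disk E B r hr).complex :=
  (diskMap f r hr).complex.toIsom fun n => cutHom₂_isIso (hf n) (hf (n - 1))

/-- The truncation of an acyclic complex. -/
noncomputable def trunc (X : Pieces E) (p : ℤ → Bool) (hp : ∀ n, p (n - 1) = true → p n = true) :
    Pieces E where
  J := fun n => cutObj (p n) (X.J n)
  P := fun n => mixObj (p n) (p (n - 1)) (X.J n) (X.P n)
  m := fun n => mixM (p n) (p (n - 1)) (X.m n)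
  e := fun n => mixE (p n) (p (n - 1)) (X.J n) (X.e n)
  exact := fun n => mix_isSES (X.exact n) (hp n)

/-- When the lowest degree `k` is dropped, the cycles `J k` disappear from degree `k`, and the term
in degree `k + 1` shrinks to its cycles, with quotient `J k`. The quotient complex is thus the
identity of `J k`. The selections `q` and `r` are given by equations so that they can be arbitrary
decidable predicates. -/
theorem isExt_trunc (X : Pieces E) {p q r : ℤ → Bool} (hp : ∀ n, p (n - 1) = true → p n = true)
    (hq : ∀ n, q (n - 1) = true → q n = true) (hr : ∀ n, (r n && r (n - 1)) = false)
    (hqp : ∀ n, q n = p (n - 1)) (hrp : ∀ n, r n = (p n && !p (n - 1))) :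
    BinaryComplex.IsExt E (X.trunc q hq).complex (X.trunc p hp).complex
      (disk E X.J r hr).complex := by
  obtain rfl : q = fun n => p (n - 1) := funext hqp
  obtain rfl : r = fun n => p n && !p (n - 1) := funext hrp
  let F : (X.trunc (fun n => p (n - 1)) hq).Hom (X.trunc p hp) :=
    { a := fun n => cutHom (p (n - 1)) (p n) (𝟙 (X.J n))
      b := fun n => mixI (p n) (p (n - 1)) (p (n - 1 - 1)) (X.m n)
      m := fun n => mixM_mixI (X.m n) (hp n) (hp (n - 1))
      e := fun n => mixI_mixE (X.exact n).1 (hp n) (hp (n - 1)) }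
  let G : (X.trunc p hp).Hom (disk E X.J (fun n => p n && !p (n - 1)) hr) :=
    { a := fun n => cutHom (p n) (p n && !p (n - 1)) (𝟙 (X.J n))
      b := fun n => mixQ (p n) (p (n - 1)) (p (n - 1 - 1)) (X.J n) (X.e n)
      m := fun n => mixM_mixQ (X.exact n).1 (hp n)
      e := fun n => mixQ_mixE (X.e n) (hp n) }
  exact ⟨F.complex, G.complex, fun n => mixI_isSES (X.exact n) (hp n) (hp (n - 1))⟩

theorem mixM_mixTo {J P : C} (m : J ⟶ P) (b c : Bool) :
    mixM b c m ≫ mixTo b c m = cutHom b true (𝟙 J) ≫ m := by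
  cases b
  · exact (isZero_zero C).eq_of_src _ _
  cases c
  · rfl
  · exact (Category.comp_id m).trans (Category.id_comp m).symm

theorem mixTo_mixE {J P J' : C} {m : J ⟶ P} {e : P ⟶ J'} (w : m ≫ e = 0) {b c : Bool}
    (hcb : c = true → b = true) :
    mixTo b c m ≫ e = mixE b c J e ≫ cutHom c true (𝟙 J') := by
  cases b
  · exact (isZero_zero C).eq_of_src _ _
  cases c
  · exact w.trans zero_comp.symm
  · exact (Category.id_comp e).trans (Category.comp_id e).symm

theorem mixTo_isIso {J P J' : C} {m : J ⟶ P} {e : P ⟶ J'} (h : E.IsSES m e) {b c : Bool}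
    (hb : b = false → IsZero P) (hc : b = true → c = false → IsZero J') :
    IsIso (mixTo b c m) := by
  cases b
  · exact isIso_of_isZero (isZero_zero C) (hb rfl) _
  cases c
  · have hJ' := hc rfl rfl
    obtain ⟨y, hy⟩ := h.exists_lift (𝟙 P) (hJ'.eq_of_tgt _ _)
    have := h.mono
    exact ⟨y, (cancel_mono m).1 (by
      change (m ≫ y) ≫ m = 𝟙 J ≫ m
      rw [Category.assoc, hy, Category.comp_id, Category.id_comp]), hy⟩
  · exact inferInstanceAs (IsIso (𝟙 P))

/-- A truncation in a range where the complex vanishes. -/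
noncomputable def truncIsom (X : Pieces E) (p : ℤ → Bool)
    (hp : ∀ n, p (n - 1) = true → p n = true) (h : ∀ n, p n = false → IsZero (X.P n)) :
    (X.trunc p hp).complex.Isom X.complex :=
  let F : (X.trunc p hp).Hom X :=
    { a := fun n => cutHom (p n) true (𝟙 (X.J n))
      b := fun n => mixTo (p n) (p (n - 1)) (X.m n)
      m := fun n => mixM_mixTo (X.m n) _ _
      e := fun n => mixTo_mixE (X.exact n).1 (hp n) }
  F.complex.toIsom fun n => mixTo_isIso (X.exact n) (h n) fun _ hn =>
    (X.exact (n - 1)).isZero_left (h (n - 1) hn)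

end Pieces

end

/-! ### Heller's criterion for acyclic complexes with the same objects -/

section

variable {C : Type u} [Category.{v} C] [Preadditive C] [HasZeroObject C] {E : ExactStructure C}
  {I : Set ℤ}

namespace Pieces

/-- The class of the complex assembled from short exact sequences. -/
def isoClass (X : Pieces E) (hb : X.complex.IsBounded) (hs : X.complex.SupportedOn I) :
    IsoClass E I :=
  Quotient.mk _ ⟨X.complex, X.complex_isDiag, hb, X.complex_isAcyclic, hs⟩

theorem single_disjoint (j n : ℤ) : (decide (n = j) && decide (n - 1 = j)) = false := by
  by_cases h : n = j
  · rw [decide_eq_false (show ¬ n - 1 = j by omega), Bool.and_false]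
  · rw [decide_eq_false h, Bool.false_and]

/-- The complex with identity differential between two copies of `A`, in degrees `j + 1`
and `j`. -/
noncomputable def single (E : ExactStructure C) (j : ℤ) (A : ℤ → C) : Pieces E :=
  disk E A (fun n => decide (n = j)) (single_disjoint j)

theorem single_supportedOn (j : ℤ) (A : ℤ → C) :
    (single E j A).complex.SupportedOn (Set.Icc j (j + 1)) := fun n hn =>
  isZero_cutObj₂ (fun h => absurd (of_decide_eq_true h) fun h => hn ⟨h.ge, by omega⟩)
    (fun h => absurd (of_decide_eq_true h) fun h => hn ⟨by omega, by omega⟩)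

theorem single_isZero (j : ℤ) {A : ℤ → C} (h : IsZero (A j)) (n : ℤ) :
    IsZero ((single E j A).complex.X n) :=
  isZero_cutObj₂ (fun h' => by rwa [of_decide_eq_true h'])
    (fun h' => by rwa [of_decide_eq_true h'])

theorem trunc_isZero (X : Pieces E) (p : ℤ → Bool) (hp : ∀ n, p (n - 1) = true → p n = true)
    {n : ℤ} (h : IsZero (X.complex.X n)) : IsZero ((X.trunc p hp).complex.X n) :=
  isZero_mixObj ((X.exact n).isZero_left h) h _ _

theorem le_pred {k n : ℤ} (h : decide (k ≤ n - 1) = true) : decide (k ≤ n) = true := by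
  rw [decide_eq_true_iff] at h ⊢
  omega

end Pieces

namespace IsoClass

variable [HasBinaryBiproducts C]

theorem eq_zero_of_isZero {P : DiagComplex E I} (h : ∀ n, IsZero (P.1.X n)) :
    (mk P : IsoClass E I) = 0 :=
  mk_eq (Q := DiagComplex.zero E I)
    ((⟨fun _ => 0, fun i _ => (h i).eq_of_src _ _, fun i _ => (h i).eq_of_src _ _⟩ :
      P.1.Hom (BinaryComplex.zero C)).toIsom fun n => isIso_of_isZero (h n) (isZero_zero C) _)

variable {a j : ℤ}

/-- The class of the complex with two copies of `A n` for `n = j`. -/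
noncomputable def single (E : ExactStructure C) (hj : a ≤ j) (A : ℤ → C) :
    IsoClass E (Set.Ici a) :=
  (Pieces.single E j A).isoClass ⟨_, _, Pieces.single_supportedOn j A⟩
    ((Pieces.single_supportedOn j A).mono fun _ h => hj.trans h.1)

theorem single_ext (hj : a ≤ j) {A B D : C} {f : A ⟶ B} {g : B ⟶ D} (h : E.IsSES f g) :
    Ext (single E hj fun _ => A) (single E hj fun _ => B) (single E hj fun _ => D) :=
  ⟨_, _, _, rfl, rfl, rfl, Pieces.isExt_disk (fun _ => h) _ _⟩

/-- A disk sees only `A j`. With a constant family, the object can vary while the position `j` stays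
fixed, as the next induction needs. -/
theorem single_eq_const (hj : a ≤ j) (A : ℤ → C) :
    single E hj A = single E hj fun _ => A j :=
  Quotient.sound ⟨Pieces.diskIsom (gradedMap (fun n => 𝟙 (A n)) · j) _ _
    fun _ hn => isIso_gradedMap_id A (of_decide_eq_true hn)⟩

/-- Induction from degree `a - 1`, where all cycles vanish. In each degree the common term is an
extension of the lower cycles by the current ones, for either complex, so the relation for the lower
cycles can be cancelled. -/
theorem hellerRel_single {X Y : ChainComplex C ℤ} (hXY : X.X = Y.X) (dX : AcyclicData E X)
    (dY : AcyclicData E Y) (ha : ∀ n < a, IsZero (X.X n)) (hj : a ≤ j) (n : ℤ) (hn : a - 1 ≤ n) :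
    HellerRel Ext (single E hj fun _ => dX.J n) (single E hj fun _ => dY.J n) := by
  induction n, hn using Int.leInduction with
  | base =>
    have hX := ha (a - 1) (by omega)
    have hY : IsZero (Y.X (a - 1)) := by rwa [← hXY]
    have h₁ : single E hj (fun _ => dX.J (a - 1)) = 0 :=
      eq_zero_of_isZero (Pieces.single_isZero j (dX.isZero_J hX))
    have h₂ : single E hj (fun _ => dY.J (a - 1)) = 0 :=
      eq_zero_of_isZero (Pieces.single_isZero j (dY.isZero_J hY))
    rw [h₁, h₂]
    exact HellerRel.refl ext_add _
  | succ n hn ih =>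
    have h₁ := HellerRel.of_ext ext_add (single_ext hj (dX.exact (n + 1)))
    have h₂ := HellerRel.of_ext ext_add (single_ext hj (dY.exact (n + 1)))
    rw [← hXY] at h₂
    have h₃ := h₁.symm.trans Ext.add h₂
    have hn1 : n + 1 - 1 = n := by omega
    rw [hn1] at h₃
    refine HellerRel.add_right_cancel (h₃.trans Ext.add ?_)
    exact HellerRel.add ext_add Ext.add (HellerRel.refl ext_add _) ih.symm

/-- The class of a truncation. -/
noncomputable def trunc (X : Pieces E) (hb : X.complex.IsBounded) (hs : X.complex.SupportedOn I)
    (k : ℤ) : IsoClass E I :=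
  (X.trunc (fun n => decide (k ≤ n)) fun _ => Pieces.le_pred).isoClass
    (hb.of_isZero fun _ => X.trunc_isZero _ _) fun n hn => X.trunc_isZero _ _ (hs n hn)

theorem trunc_ext (X : Pieces E) (hb : X.complex.IsBounded)
    (hs : X.complex.SupportedOn (Set.Ici a)) (hj : a ≤ j) :
    Ext (trunc X hb hs (j + 1)) (trunc X hb hs j) (single E hj X.J) :=
  ⟨_, _, _, rfl, rfl, rfl, X.isExt_trunc _ _ _ (fun n => by
    rw [decide_eq_decide]; omega) (fun n => by
    rw [← decide_not, ← Bool.decide_and, decide_eq_decide]; omega)⟩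

/-- Descending induction on `k`, starting above `b` where both truncations are zero. Each step adds
the disk on the cycles in degree `k`, and these disks are related by `hellerRel_single`. -/
theorem hellerRel_trunc {X Y : ChainComplex C ℤ} (hXY : X.X = Y.X) (dX : AcyclicData E X)
    (dY : AcyclicData E Y) {b : ℤ} (hX : (Pieces.ofData dX).complex.SupportedOn (Set.Icc a b))
    (hY : (Pieces.ofData dY).complex.SupportedOn (Set.Icc a b)) (i : ℕ) (k : ℤ) (hk : a ≤ k)
    (hi : k = b + 1 - i) :
    HellerRel Ext
      (trunc (Pieces.ofData dX) ⟨a, b, hX⟩ (hX.mono Set.Icc_subset_Ici_self) k)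
      (trunc (Pieces.ofData dY) ⟨a, b, hY⟩ (hY.mono Set.Icc_subset_Ici_self) k) := by
  induction i generalizing k with
  | zero =>
    have key : ∀ (Z : Pieces E) (hZ : Z.complex.SupportedOn (Set.Icc a b)),
        trunc Z ⟨a, b, hZ⟩ (hZ.mono Set.Icc_subset_Ici_self) k = 0 := fun Z hZ =>
      eq_zero_of_isZero fun n => by
        by_cases hn : k ≤ n
        · exact Z.trunc_isZero _ _ (hZ n fun h => by have := h.2; push_cast at hi; omega)
        · change IsZero (mixObj (decide (k ≤ n)) _ _ _)
          rw [decide_eq_false hn]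
          exact isZero_zero C
    rw [key _ hX, key _ hY]
    exact HellerRel.refl ext_add _
  | succ i ih =>
    have h := ih (k + 1) (by omega) (by push_cast at hi; omega)
    have h₁ := HellerRel.of_ext ext_add
      (trunc_ext (Pieces.ofData dX) ⟨a, b, hX⟩ (hX.mono Set.Icc_subset_Ici_self) hk)
    have h₂ := HellerRel.of_ext ext_add
      (trunc_ext (Pieces.ofData dY) ⟨a, b, hY⟩ (hY.mono Set.Icc_subset_Ici_self) hk)
    refine h₁.trans Ext.add (HellerRel.trans Ext.add ?_ h₂.symm)
    refine HellerRel.add ext_add Ext.add h ?_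
    rw [single_eq_const, single_eq_const hk (Pieces.ofData dY).J]
    exact hellerRel_single hXY dX dY (fun n hn => hX n fun h => absurd h.1 (not_le.2 hn)) hk k
      (by omega)

/-- Heller's criterion: acyclic complexes with the same objects become extensions of the same
complexes, after adding a common summand. -/
theorem exists_isExt {X Y : ChainComplex C ℤ} (hXY : X.X = Y.X) (hX : E.IsAcyclic X)
    (hY : E.IsAcyclic Y) {a b : ℤ} (hab' : ∀ n, n ∉ Set.Icc a b → IsZero (X.X n)) :
    ∃ A B K : DiagComplex E (Set.Ici a),
      BinaryComplex.IsExt E A.1 ((BinaryComplex.ofChain X).biprod K.1) B.1 ∧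
        BinaryComplex.IsExt E A.1 ((BinaryComplex.ofChain Y).biprod K.1) B.1 := by
  obtain ⟨dX⟩ := AcyclicData.nonempty hX
  obtain ⟨dY⟩ := AcyclicData.nonempty hY
  -- Enlarging `b` ensures `a ≤ b`, so that the descent from `b + 1` in a natural number of steps
  -- reaches `a`.
  obtain ⟨b, hb, hab⟩ : ∃ b, a ≤ b ∧ ∀ n, n ∉ Set.Icc a b → IsZero (X.X n) :=
    ⟨max a b, le_max_left _ _, fun n hn => hab' n fun h => hn ⟨h.1, h.2.trans (le_max_right _ _)⟩⟩
  have hX : (Pieces.ofData dX).complex.SupportedOn (Set.Icc a b) := hab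
  have hY : (Pieces.ofData dY).complex.SupportedOn (Set.Icc a b) := fun n hn => by
    change IsZero (Y.X n)
    rw [← hXY]
    exact hab n hn
  have key : ∀ (Z : Pieces E) (hZ : Z.complex.SupportedOn (Set.Icc a b)),
      trunc Z ⟨a, b, hZ⟩ (hZ.mono Set.Icc_subset_Ici_self) a =
        Z.isoClass ⟨a, b, hZ⟩ (hZ.mono Set.Icc_subset_Ici_self) := fun Z hZ =>
    Quotient.sound ⟨Z.truncIsom _ _ fun n hn => hZ n fun h =>
      absurd h.1 (decide_eq_false_iff_not.1 hn)⟩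
  have h : HellerRel Ext
      ((Pieces.ofData dX).isoClass ⟨a, b, hX⟩ (hX.mono Set.Icc_subset_Ici_self))
      ((Pieces.ofData dY).isoClass ⟨a, b, hY⟩ (hY.mono Set.Icc_subset_Ici_self)) := by
    rw [← key _ hX, ← key _ hY]
    exact hellerRel_trunc hXY dX dY hX hY (b + 1 - a).toNat a le_rfl (by omega)
  obtain ⟨A, B, K, h₁, h₂⟩ := exists_of_hellerRel h
  exact ⟨A, B, K, h₁.of_isom (.refl _) ((Pieces.ofDataIsom dX).biprod (.refl _)) (.refl _),
    h₂.of_isom (.refl _) ((Pieces.ofDataIsom dY).biprod (.refl _)) (.refl _)⟩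

end IsoClass

end

/-! ### The comparison homomorphism and its inverse -/

section

variable {C : Type u} [Category.{v} C] [Preadditive C] [HasZeroObject C] [HasBinaryBiproducts C]
  {E : ExactStructure C} {I : Set ℤ}

/-- Every binary acyclic complex has a witness, supported in the same lower bound. -/
theorem Witness.exists_of_supportedOn {P : BinaryComplex C} (ha : P.IsAcyclic E) {a b : ℤ}
    (hab : P.SupportedOn (Set.Icc a b)) :
    ∃ w : Witness E P, (∀ l, (w.t.R l).IsAdmissible E (Set.Ici a)) ∧
      w.K.IsAdmissible E (Set.Ici a) := by
  -- The complexes `P.top` and `P.bot` have the same objects. The extensions of the first become the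
  -- top maps of the triple, those of the second its bottom maps.
  obtain ⟨A, B, K, ⟨f, g, h⟩, ⟨f', g', h'⟩⟩ := IsoClass.exists_isExt (X := P.top) (Y := P.bot) rfl
    ha.top ha.bot hab
  have hP : P.IsAdmissible E (Set.Ici a) := ⟨⟨a, b, hab⟩, ha, hab.mono Set.Icc_subset_Ici_self⟩
  have hA := A.2.1
  have hB := B.2.1
  have hK := K.2.1
  let R : Fin 3 → BinaryComplex C := ![B.1, P.biprod K.1, A.1]
  let t : Triple E :=
    { R := R
      f := f.f
      g := g.f
      f' := f'.f
      g' := g'.f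
      f_comm := f.comm
      g_comm := g.comm
      f_comm' := fun i j => by
        have := f'.comm' i j
        change f'.f i ≫ biprod.map (P.d' i j) (K.1.d' i j) = A.1.d' i j ≫ f'.f j
        exact this
      g_comm' := g'.comm'
      exact := h
      exact' := h' }
  have ht : ∀ l, (t.R l).IsAdmissible E (Set.Ici a) := by
    intro l; fin_cases l
    exacts [B.2.2, hP.biprod K.2.2, A.2.2]
  exact ⟨⟨t, fun l => (ht l).acyclic, fun l => (ht l).bounded, hA, hB, K.1, hK, K.2.2.acyclic,
    .refl _⟩, ht, K.2.2⟩

namespace NenashevK1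

variable (hI : ∀ n ∈ I, n + 1 ∈ I) (hI' : Set.Icc 0 2 ⊆ I)

include hI in
-- The rows of `D`, extended by zero, form a triple with the columns of `D` in degrees `0`, `1`,
-- `2`, so this is an instance of the relation between rows and columns.
theorem graysonClass_double (D : BinaryDoubleSES E) :
    (D.col 0).graysonClass hI' - (D.col 1).graysonClass hI' + (D.col 2).graysonClass hI' =
      (D.row 2).graysonClass hI' - (D.row 1).graysonClass hI' + (D.row 0).graysonClass hI' := by
  have hadm : ∀ l, (D.triple.R l).IsAdmissible E I := fun l =>
    (D.row l).toBinaryAcyclicComplex.isAdmissible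
      ((D.row l).toBinaryAcyclicComplex_supportedOn hI')
  have h := D.triple.cls_rows_eq_cls_cols hI hI' hadm (k := 3) fun l n hn =>
    (D.row l).toBinaryAcyclicComplex_supportedOn (I := Set.Icc 0 2) subset_rfl n
      fun h => hn ⟨h.1, by have := h.2; push_cast; omega⟩
  have hr : ∀ l, (D.triple.R l).cls E I = (D.row l).graysonClass hI' := fun l =>
    BinaryAcyclicComplex.cls_eq _ _
  have h0 : (D.triple.col (0 : ℕ)).graysonClass hI' = (D.col 0).graysonClass hI' := rfl
  have h1 : (D.triple.col (1 : ℕ)).graysonClass hI' = (D.col 1).graysonClass hI' := rfl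
  have h2 : (D.triple.col (2 : ℕ)).graysonClass hI' = (D.col 2).graysonClass hI' := rfl
  rw [Finset.sum_range_succ, Finset.sum_range_succ, Finset.sum_range_one, hr, hr, hr, h0, h1, h2,
    pow_zero, pow_one, neg_one_sq, one_smul, one_smul, neg_one_smul] at h
  rw [sub_eq_add_neg, ← h]
  abel

/-- The comparison homomorphism. -/
noncomputable def toGrayson : NenashevK1 E →+ GraysonK0 E I :=
  QuotientAddGroup.lift _ (FreeAbelianGroup.lift fun P : BinarySES E => P.graysonClass hI') (by
    rw [AddSubgroup.closure_le]
    rintro x (⟨P, hi, hp⟩ | ⟨D⟩)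
    · change FreeAbelianGroup.lift _ _ = 0
      rw [FreeAbelianGroup.lift_apply_of]
      exact (BinaryAcyclicComplex.cls_eq _ (P.toBinaryAcyclicComplex_supportedOn hI')).symm.trans
        (BinaryComplex.cls_eq_zero_of_isDiag (P.toBinaryAcyclicComplex_isDiag hi hp))
    · change FreeAbelianGroup.lift _ _ = 0
      simp only [map_sub, map_add, FreeAbelianGroup.lift_apply_of]
      rw [sub_eq_zero]
      exact graysonClass_double hI hI' D)

theorem toGrayson_of (P : BinarySES E) :
    toGrayson hI hI' (of E P) = P.graysonClass hI' :=
  FreeAbelianGroup.lift_apply_of _ _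

/-- In a witness the outer rows and the extra summand are diagonal, hence of class zero. The
relation between rows and columns then writes the class of `P` as a combination of classes of length
two. -/
theorem cls_mem_range {P : BinaryComplex C} (hP : P.IsAdmissible E I) {b : ℤ}
    (hb : P.SupportedOn (Set.Icc 0 b)) (hI0 : Set.Ici 0 ⊆ I) :
    P.cls E I ∈ (toGrayson (E := E) hI hI').range := by
  obtain ⟨w, hw, hK⟩ := Witness.exists_of_supportedOn hP.acyclic hb
  have hadm : ∀ {Q : BinaryComplex C}, Q.IsAdmissible E (Set.Ici 0) → Q.IsAdmissible E I :=
    fun h => ⟨h.bounded, h.acyclic, h.supported.mono hI0⟩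
  obtain ⟨k, hk⟩ : ∃ k : ℕ, ∀ l, (w.t.R l).SupportedOn (Set.Ico 0 k) := by
    choose a' b' hab using fun l => (hw l).bounded
    refine ⟨(max (b' 0) (max (b' 1) (b' 2)) + 1).toNat, fun l n hn => ?_⟩
    by_cases h0 : 0 ≤ n
    · refine hab l n fun h => hn ⟨h0, ?_⟩
      have : b' l ≤ max (b' 0) (max (b' 1) (b' 2)) := by
        fin_cases l
        exacts [by simp, by simp, by simp]
      have := h.2
      omega
    · exact (hw l).supported n h0
  have h := w.t.cls_rows_eq_cls_cols hI hI' (fun l => hadm (hw l)) hk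
  have h1 : (w.t.R 1).cls E I = P.cls E I := by
    let F : (w.t.R 1).Hom (P.biprod w.K) := ⟨fun n => (w.iso.f n).hom, w.iso.comm, w.iso.comm'⟩
    rw [BinaryComplex.cls_eq_of_isIso F (fun n => inferInstanceAs (IsIso (w.iso.f n).hom))
      (hadm (hw 1))]
    obtain ⟨f, g, hfg⟩ := BinaryComplex.isExt_biprod E P w.K
    rw [BinaryComplex.cls_eq_add f g hfg hP (hP.biprod (hadm hK)) (hadm hK),
      BinaryComplex.cls_eq_zero_of_isDiag w.K_diag, add_zero]
  rw [h1, BinaryComplex.cls_eq_zero_of_isDiag w.diag0, BinaryComplex.cls_eq_zero_of_isDiag w.diag2,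
    zero_sub, add_zero] at h
  rw [← neg_neg (P.cls E I), h]
  exact neg_mem (sum_mem fun m _ => zsmul_mem (AddMonoidHom.mem_range.2
    ⟨of E (w.t.col m), toGrayson_of hI hI' (w.t.col m)⟩) _)

/-- A shift moves the lower bound up by one and only changes the sign of the class. -/
theorem cls_mem_range' (hI0 : Set.Ici 0 ⊆ I) (k : ℕ) {P : BinaryComplex C}
    (hP : P.IsAdmissible E I) {b : ℤ} (hb : P.SupportedOn (Set.Icc (-k) b)) :
    P.cls E I ∈ (toGrayson (E := E) hI hI').range := by
  induction k generalizing P b with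
  | zero => exact cls_mem_range hI hI' hP (by simpa using hb) hI0
  | succ k ih =>
    have := ih (hP.shift hI) (b := b + 1) fun n hn => hb _ fun h => hn
      ⟨by have := h.1; push_cast at this; linarith, by linarith [h.2]⟩
    rw [hP.cls_shift hI] at this
    exact neg_mem_iff.1 this

theorem toGrayson_surjective (hI0 : Set.Ici 0 ⊆ I) :
    Function.Surjective (toGrayson (E := E) hI hI') := by
  intro x
  induction x using QuotientAddGroup.induction_on with | H x
  change _ ∈ (toGrayson (E := E) hI hI').range
  induction x using FreeAbelianGroup.induction_on with
  | zero => exact zero_mem _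
  | of P =>
    obtain ⟨a, b, hab⟩ := P.1.bounded
    have := cls_mem_range' hI hI' hI0 (-a).toNat (P.1.isAdmissible P.2) (b := b)
      (hab.mono fun n hn => ⟨by have := hn.1; omega, hn.2⟩)
    rwa [P.1.cls_eq P.2] at this
  | neg P h => exact neg_mem h
  | add x y hx hy => exact add_mem hx hy

/-- The inverse homomorphism, given by the alternating sum of the columns of a witness. -/
noncomputable def ofWitness (E : ExactStructure C) (P : BinaryAcyclicComplex E) : NenashevK1 E :=
  -- The sign is the one with which the middle row enters the alternating sum of the rows.
  - (Witness.exists_of_supportedOn ⟨P.top_acyclic, P.bot_acyclic⟩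
    P.bounded.choose_spec.choose_spec).choose.t.chi

/-- Any witness may replace the chosen one, in particular those built without control of the
supports. -/
theorem ofWitness_eq (P : BinaryAcyclicComplex E) (w : Witness E P.toBinaryComplex) :
    ofWitness E P = - w.t.chi :=
  congrArg Neg.neg (Witness.chi_unique _ w P.bounded ⟨P.top_acyclic, P.bot_acyclic⟩)

/-- A sum of witnesses for `P`, `P'.op` and `P''.op` is compared with the witness of alternating sum
zero from `Witness.exists_of_isSES`; exchanging top and bottom negates the last two contributions.
-/
theorem ofWitness_ses (P' P P'' : BinaryAcyclicComplex E)
    (f : P'.toBinaryComplex.Hom P.toBinaryComplex) (g : P.toBinaryComplex.Hom P''.toBinaryComplex)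
    (h : ∀ n, E.IsSES (f.f n) (g.f n)) :
    ofWitness E P = ofWitness E P' + ofWitness E P'' := by
  have ha : P.toBinaryComplex.IsAcyclic E := ⟨P.top_acyclic, P.bot_acyclic⟩
  have ha' : P'.toBinaryComplex.IsAcyclic E := ⟨P'.top_acyclic, P'.bot_acyclic⟩
  have ha'' : P''.toBinaryComplex.IsAcyclic E := ⟨P''.top_acyclic, P''.bot_acyclic⟩
  obtain ⟨w, hw⟩ := Witness.exists_of_isSES f g h P.bounded P'.bounded P''.bounded ha ha' ha''
  have exists_witness : ∀ Q : BinaryAcyclicComplex E, Nonempty (Witness E Q.toBinaryComplex) :=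
    fun Q => by
      obtain ⟨a, b, hab⟩ := Q.bounded
      exact ⟨(Witness.exists_of_supportedOn ⟨Q.top_acyclic, Q.bot_acyclic⟩ hab).choose⟩
  obtain ⟨u⟩ := exists_witness P
  obtain ⟨u'⟩ := exists_witness P'
  obtain ⟨u''⟩ := exists_witness P''
  have hb' : BinaryComplex.IsBounded P'.toBinaryComplex.op := P'.bounded
  have hb'' : BinaryComplex.IsBounded P''.toBinaryComplex.op := P''.bounded
  have := Witness.chi_unique w (u.biprod (u'.op.biprod u''.op))
    (BinaryComplex.IsBounded.biprod P.bounded (hb'.biprod hb'')) (ha.biprod (ha'.op.biprod ha''.op))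
  rw [hw, Witness.chi_biprod, Witness.chi_biprod, Witness.chi_op, Witness.chi_op] at this
  rw [ofWitness_eq P u, ofWitness_eq P' u', ofWitness_eq P'' u'', ← neg_add, neg_inj]
  rw [← sub_eq_zero, this]
  abel

/-- The inverse of the comparison homomorphism. -/
noncomputable def ofGrayson (E : ExactStructure C) (I : Set ℤ) : GraysonK0 E I →+ NenashevK1 E :=
  QuotientAddGroup.lift _ (FreeAbelianGroup.lift fun P => ofWitness E P.1) (by
    rw [AddSubgroup.closure_le]
    rintro x (⟨P', P, P'', f, g, h⟩ | ⟨P, h⟩)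
    · change FreeAbelianGroup.lift _ _ = 0
      rw [map_sub, map_sub, FreeAbelianGroup.lift_apply_of, FreeAbelianGroup.lift_apply_of,
        FreeAbelianGroup.lift_apply_of, ofWitness_ses P'.1 P.1 P''.1 f g h]
      abel
    · change FreeAbelianGroup.lift _ _ = 0
      rw [FreeAbelianGroup.lift_apply_of]
      obtain ⟨w, hw⟩ := Witness.exists_of_isDiag h P.1.bounded ⟨P.1.top_acyclic, P.1.bot_acyclic⟩
      rw [ofWitness_eq P.1 w, hw, neg_zero])

/-- The sign in `ofWitness` cancels the sign from the odd degree of the column `P` in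
`Witness.exists_of_length_two`. -/
theorem ofGrayson_graysonClass (P : BinarySES E) :
    ofGrayson E I (P.graysonClass hI') = of E P := by
  refine (FreeAbelianGroup.lift_apply_of _ _).trans ?_
  obtain ⟨w, hw⟩ := Witness.exists_of_length_two P
  exact (ofWitness_eq P.toBinaryAcyclicComplex w).trans (by rw [hw, neg_neg])

theorem toGrayson_injective : Function.Injective (toGrayson (E := E) hI hI') := by
  have h : (ofGrayson E I).comp (toGrayson (E := E) hI hI') = AddMonoidHom.id _ := by
    refine QuotientAddGroup.addMonoidHom_ext _ (FreeAbelianGroup.lift_ext _ _ fun P => ?_)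
    exact (congrArg (ofGrayson E I) (toGrayson_of hI hI' P)).trans (ofGrayson_graysonClass hI' P)
  exact Function.LeftInverse.injective (DFunLike.congr_fun h)

end NenashevK1

end

/-- For every exact category, sending the class of a binary acyclic complex of length two to its
class in Grayson's group is a well-defined homomorphism and an isomorphism, both for complexes
concentrated in nonnegative degrees and for arbitrary bounded `ℤ`-graded complexes. -/
theorem theorem1p1 {C : Type u} [Category.{v} C] [Preadditive C] [HasZeroObject C]
    [HasBinaryBiproducts C] (E : ExactStructure C) :
    (∃ Φ : NenashevK1 E →+ GraysonK0 E (Set.Ici (0 : ℤ)),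
      (∀ P : BinarySES E, Φ (NenashevK1.of E P) = P.graysonClass Set.Icc_subset_Ici_self) ∧
        Function.Bijective Φ) ∧
    (∃ Φ : NenashevK1 E →+ GraysonK0 E (Set.univ : Set ℤ),
      (∀ P : BinarySES E, Φ (NenashevK1.of E P) = P.graysonClass (Set.subset_univ _)) ∧
        Function.Bijective Φ) := by
  have hI : ∀ n ∈ Set.Ici (0 : ℤ), n + 1 ∈ Set.Ici (0 : ℤ) := fun n hn =>
    Set.mem_Ici.2 (by have := Set.mem_Ici.1 hn; omega)
  have hU : ∀ n ∈ (Set.univ : Set ℤ), n + 1 ∈ (Set.univ : Set ℤ) := fun _ _ => Set.mem_univ _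
  exact ⟨⟨NenashevK1.toGrayson hI _, NenashevK1.toGrayson_of hI _,
      NenashevK1.toGrayson_injective hI _, NenashevK1.toGrayson_surjective hI _ subset_rfl⟩,
    ⟨NenashevK1.toGrayson hU _, NenashevK1.toGrayson_of hU _,
      NenashevK1.toGrayson_injective hU _, NenashevK1.toGrayson_surjective hU _
        (Set.subset_univ _)⟩⟩
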